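/- Let $A$ be a C*-algebra. For $n\in\{0,1,2,\dots\}$, say that $A$ has \emph{nuclear dimension} $n$ if $n$ is the smallest natural number for which there are a directed set $\Lambda$, finite-dimensional C*-algebras $F^i_\lambda$ ($i=0,\dots,n$, $\lambda\in\Lambda$) and completely positive contractions $\psi^i_\lambda\colon A\to F^i_\lambda$ and $\phi^i_\lambda\colon F^i_\lambda\to A$ such that every $\phi^i_\lambda$ has order zero (i.e. $\phi^i_\lambda(a)\phi^i_\lambda(b)=0$ whenever $a,b\ge 0$ and $ab=0$) and $\lim_\lambda\sum_{i=0}^n\phi^i_\lambda\psi^i_\lambda(a)=a$ for all $a\in A$. Let $Cu(A)=W(A\otimes\mathcal K)$ be the stabilized Cuntz semigroup of $A$. Here $\mathcal K$ is the algebra of compact operators on a separable infinite-dimensional Hilbert space, and, for a C*-algebra $B$, $W(B)$ is the set of positive elements of the matrix algebras $M_m(B)$, $m\ge 0$, modulo Cuntz equivalence, with addition $[a]+[b]=[a\oplus b]$ and with the order given by $[a]\le[b]$ if and only if $x_k^*bx_k\to a$ for some sequence of rectangular matrices $x_k$ over $B$ (Cuntz equivalence means that $[a]\le[b]$ and $[b]\le[a]$).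 If $A$ has nuclear dimension $n$, then $Cu(A)$ has the $n$-comparison property: if $x,y_0,\dots,y_n\in Cu(A)$ are such that for each $i=0,\dots,n$ there is an integer $k_i\ge 1$ with $(k_i+1)x\le k_iy_i$, then $x\le y_0+\dots+y_n$. More strongly, if $x,y_0,\dots,y_n\in Cu(A)$ are such that for each $i=0,\dots,n$ there is an integer $k_i\ge 1$ with $k_ix\le k_iy_i$, then $x\le y_0+\dots+y_n$. -/

import Mathlib

noncomputable section

open Filter Topology

universe u

/-! ### The stabilization `A ⊗ 𝒦` -/

/-- The infinite matrices over `A`, indexed by `ℕ × ℕ`, that vanish outside of a finite corner. -/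
def finSuppSubmodule (A : Type u) [NonUnitalCStarAlgebra A] : Submodule ℂ (ℕ → ℕ → A) where
  carrier := {x | ∃ N : ℕ, ∀ i j, N ≤ i ∨ N ≤ j → x i j = 0}
  zero_mem' := ⟨0, fun _ _ _ => rfl⟩
  add_mem' := by
    rintro x y ⟨N, hN⟩ ⟨M, hM⟩
    refine ⟨max N M, fun i j h => ?_⟩
    have h1 : x i j = 0 := hN i j (by omega)
    have h2 : y i j = 0 := hM i j (by omega)
    simp [h1, h2]
  smul_mem' := by
    rintro c x ⟨N, hN⟩
    exact ⟨N, fun i j h => by simp [hN i j h]⟩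

/-- The *-algebra `M_∞(A) = ⋃ₙ Mₙ(A)`, where `Mₙ(A)` is the upper left corner of `Mₙ₊₁(A)`. -/
def FinSuppMatrix (A : Type u) [NonUnitalCStarAlgebra A] : Type u := finSuppSubmodule A

namespace FinSuppMatrix

section Algebra

variable {A : Type u} [NonUnitalCStarAlgebra A]

instance : AddCommGroup (FinSuppMatrix A) := inferInstanceAs (AddCommGroup (finSuppSubmodule A))

instance : Module ℂ (FinSuppMatrix A) := inferInstanceAs (Module ℂ (finSuppSubmodule A))

/-- The entry of a matrix at position `(i, j)`. -/
def entry (x : FinSuppMatrix A) (i j : ℕ) : A := x.1 i j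

/-- `x` lies in the upper left `N × N` corner. -/
def SuppLE (x : FinSuppMatrix A) (N : ℕ) : Prop := ∀ i j, N ≤ i ∨ N ≤ j → x.entry i j = 0

theorem exists_suppLE (x : FinSuppMatrix A) : ∃ N, x.SuppLE N := x.2

theorem SuppLE.mono {x : FinSuppMatrix A} {N M : ℕ} (h : x.SuppLE N) (hNM : N ≤ M) :
    x.SuppLE M := fun i j hij => h i j (by omega)

@[ext]
theorem ext {x y : FinSuppMatrix A} (h : ∀ i j, x.entry i j = y.entry i j) : x = y :=
  Subtype.ext (funext fun i => funext fun j => h i j)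

theorem entry_add (x y : FinSuppMatrix A) (i j : ℕ) :
    (x + y).entry i j = x.entry i j + y.entry i j := rfl

theorem entry_zero (i j : ℕ) : (0 : FinSuppMatrix A).entry i j = 0 := rfl

theorem entry_smul (c : ℂ) (x : FinSuppMatrix A) (i j : ℕ) :
    (c • x).entry i j = c • x.entry i j := rfl

theorem sum_aux {x : FinSuppMatrix A} {N : ℕ} (hx : x.SuppLE N) (y : FinSuppMatrix A) (i j : ℕ) :
    ∑ᶠ k, x.entry i k * y.entry k j = ∑ k : Fin N, x.entry i k * y.entry k j := by
  rw [Fin.sum_univ_eq_sum_range (fun k => x.entry i k * y.entry k j)]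
  refine finsum_eq_sum_of_support_subset _ fun k hk => ?_
  by_contra hk'
  refine hk ?_
  have : N ≤ k := by simpa using hk'
  simp [hx i k (Or.inr this)]

/-- Matrix multiplication. -/
instance : Mul (FinSuppMatrix A) where
  mul x y := ⟨fun i j => ∑ᶠ k, x.entry i k * y.entry k j, by
    obtain ⟨N, hN⟩ := x.exists_suppLE
    obtain ⟨M, hM⟩ := y.exists_suppLE
    refine ⟨max N M, fun i j h => ?_⟩
    change ∑ᶠ k, x.entry i k * y.entry k j = 0
    rw [sum_aux hN]
    refine Finset.sum_eq_zero fun k _ => ?_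
    rcases h with h | h
    · rw [hN i k (Or.inl (by omega)), zero_mul]
    · rw [hM k j (Or.inr (by omega)), mul_zero]⟩

/-- The conjugate transpose. -/
instance : Star (FinSuppMatrix A) where
  star x := ⟨fun i j => star (x.entry j i), by
    obtain ⟨N, hN⟩ := x.exists_suppLE
    exact ⟨N, fun i j h => by simp [hN j i h.symm]⟩⟩

theorem entry_star (x : FinSuppMatrix A) (i j : ℕ) :
    (star x).entry i j = star (x.entry j i) := rfl

theorem entry_mul {x : FinSuppMatrix A} {N : ℕ} (hx : x.SuppLE N) (y : FinSuppMatrix A)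
    (i j : ℕ) : (x * y).entry i j = ∑ k : Fin N, x.entry i k * y.entry k j :=
  sum_aux hx y i j

theorem SuppLE.add {x y : FinSuppMatrix A} {N : ℕ} (hx : x.SuppLE N) (hy : y.SuppLE N) :
    (x + y).SuppLE N := fun i j h => by rw [entry_add, hx i j h, hy i j h, add_zero]

theorem SuppLE.smul {x : FinSuppMatrix A} {N : ℕ} (hx : x.SuppLE N) (c : ℂ) :
    (c • x).SuppLE N := fun i j h => by rw [entry_smul, hx i j h, smul_zero]

theorem SuppLE.star {x : FinSuppMatrix A} {N : ℕ} (hx : x.SuppLE N) :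
    (star x).SuppLE N := fun i j h => by rw [entry_star, hx j i h.symm, star_zero]

theorem SuppLE.mul {x y : FinSuppMatrix A} {N : ℕ} (hx : x.SuppLE N) (hy : y.SuppLE N) :
    (x * y).SuppLE N := fun i j h => by
  rw [entry_mul hx]
  refine Finset.sum_eq_zero fun k _ => ?_
  rcases h with h | h
  · rw [hx i k (Or.inl h), zero_mul]
  · rw [hy k j (Or.inr h), mul_zero]

/-- The upper left `N × N` corner of a matrix. -/
def corner (N : ℕ) (x : FinSuppMatrix A) : CStarMatrix (Fin N) (Fin N) A :=
  CStarMatrix.ofMatrix fun i j => x.entry i j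

theorem corner_apply (N : ℕ) (x : FinSuppMatrix A) (i j : Fin N) :
    corner N x i j = x.entry i j := rfl

theorem corner_mul {x : FinSuppMatrix A} {N : ℕ} (hx : x.SuppLE N) (y : FinSuppMatrix A) :
    corner N (x * y) = corner N x * corner N y := by
  ext i j
  rw [corner_apply, entry_mul hx, CStarMatrix.mul_apply]
  rfl

theorem corner_add (N : ℕ) (x y : FinSuppMatrix A) :
    corner N (x + y) = corner N x + corner N y := rfl

theorem corner_smul (N : ℕ) (c : ℂ) (x : FinSuppMatrix A) :
    corner N (c • x) = c • corner N x := rfl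

theorem corner_zero (N : ℕ) : corner N (0 : FinSuppMatrix A) = 0 := rfl

theorem corner_star (N : ℕ) (x : FinSuppMatrix A) :
    corner N (star x) = star (corner N x) := by
  ext i j
  rw [CStarMatrix.star_apply]
  rfl

theorem ext_corner {x y : FinSuppMatrix A} {N : ℕ} (hx : x.SuppLE N) (hy : y.SuppLE N)
    (h : corner N x = corner N y) : x = y := by
  ext i j
  by_cases hij : N ≤ i ∨ N ≤ j
  · rw [hx i j hij, hy i j hij]
  · push Not at hij
    exact congrFun (congrFun h ⟨i, hij.1⟩) ⟨j, hij.2⟩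

theorem exists_suppLE₃ (x y z : FinSuppMatrix A) :
    ∃ N, x.SuppLE N ∧ y.SuppLE N ∧ z.SuppLE N := by
  obtain ⟨N, hN⟩ := x.exists_suppLE
  obtain ⟨M, hM⟩ := y.exists_suppLE
  obtain ⟨K, hK⟩ := z.exists_suppLE
  exact ⟨max N (max M K), hN.mono (by omega), hM.mono (by omega), hK.mono (by omega)⟩

instance : NonUnitalRing (FinSuppMatrix A) where
  left_distrib x y z := by
    obtain ⟨N, hx, hy, hz⟩ := exists_suppLE₃ x y z
    refine ext_corner (hx.mul (hy.add hz)) ((hx.mul hy).add (hx.mul hz)) ?_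
    simp only [corner_mul hx, corner_add, mul_add]
  right_distrib x y z := by
    obtain ⟨N, hx, hy, hz⟩ := exists_suppLE₃ x y z
    refine ext_corner ((hx.add hy).mul hz) ((hx.mul hz).add (hy.mul hz)) ?_
    simp only [corner_mul hx, corner_mul hy, corner_mul (hx.add hy), corner_add, add_mul]
  zero_mul x := by
    ext i j
    rw [entry_mul (N := 0) (fun _ _ _ => rfl)]
    rfl
  mul_zero x := by
    obtain ⟨N, hx, -, -⟩ := exists_suppLE₃ x x x
    ext i j
    rw [entry_mul hx]
    simp [entry_zero]
  mul_assoc x y z := by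
    obtain ⟨N, hx, hy, hz⟩ := exists_suppLE₃ x y z
    refine ext_corner ((hx.mul hy).mul hz) (hx.mul (hy.mul hz)) ?_
    simp only [corner_mul hx, corner_mul hy, corner_mul (hx.mul hy), mul_assoc]

instance : StarRing (FinSuppMatrix A) where
  star_involutive x := by ext i j; simp only [entry_star, star_star]
  star_add x y := by ext i j; simp only [entry_star, entry_add, star_add]
  star_mul x y := by
    obtain ⟨N, hx, hy, -⟩ := exists_suppLE₃ x y y
    refine ext_corner (hx.mul hy).star (hy.star.mul hx.star) ?_
    simp only [corner_mul hx, corner_mul hy.star, corner_star, star_mul]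

instance : StarModule ℂ (FinSuppMatrix A) where
  star_smul c x := by ext i j; simp only [entry_star, entry_smul, star_smul]

instance : IsScalarTower ℂ (FinSuppMatrix A) (FinSuppMatrix A) where
  smul_assoc c x y := by
    obtain ⟨N, hx, hy, -⟩ := exists_suppLE₃ x y y
    ext i j
    simp only [smul_eq_mul, entry_mul (hx.smul c), entry_smul, entry_mul hx, Finset.smul_sum,
      smul_mul_assoc]

instance : SMulCommClass ℂ (FinSuppMatrix A) (FinSuppMatrix A) where
  smul_comm c x y := by
    obtain ⟨N, hx, hy, -⟩ := exists_suppLE₃ x y y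
    ext i j
    simp only [smul_eq_mul, entry_smul, entry_mul hx, Finset.smul_sum, mul_smul_comm]

/-- An `N × N` matrix, placed in the upper left corner of an infinite matrix. -/
def ofCorner {N : ℕ} (a : CStarMatrix (Fin N) (Fin N) A) : FinSuppMatrix A :=
  ⟨fun i j => if h : i < N ∧ j < N then a ⟨i, h.1⟩ ⟨j, h.2⟩ else 0,
    N, fun i j hij => dif_neg (by omega)⟩

theorem ofCorner_suppLE {N : ℕ} (a : CStarMatrix (Fin N) (Fin N) A) : (ofCorner a).SuppLE N :=
  fun _ _ hij => dif_neg (by omega)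

theorem corner_ofCorner {N : ℕ} (a : CStarMatrix (Fin N) (Fin N) A) :
    corner N (ofCorner a) = a := by
  ext i j
  exact dif_pos ⟨i.2, j.2⟩

theorem ofCorner_corner {N : ℕ} {x : FinSuppMatrix A} (hx : x.SuppLE N) :
    ofCorner (corner N x) = x :=
  ext_corner (ofCorner_suppLE _) hx (corner_ofCorner _)

/-- The inclusion of `M_N(A)` in `M_M(A)` as the upper left corner, for `N ≤ M`. -/
def cornerIncl {N M : ℕ} (h : N ≤ M) :
    CStarMatrix (Fin N) (Fin N) A →⋆ₙₐ[ℂ] CStarMatrix (Fin M) (Fin M) A where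
  toFun a := corner M (ofCorner a)
  map_smul' c a := by
    rw [← corner_smul]
    congr 1
    refine ext_corner (ofCorner_suppLE _) ((ofCorner_suppLE _).smul c) ?_
    rw [corner_ofCorner, corner_smul, corner_ofCorner]
    rfl
  map_zero' := by
    have h0 : (0 : FinSuppMatrix A).SuppLE N := fun _ _ _ => rfl
    have h1 : ofCorner (0 : CStarMatrix (Fin N) (Fin N) A) = 0 :=
      ext_corner (ofCorner_suppLE _) h0 (by rw [corner_ofCorner, corner_zero])
    rw [h1, corner_zero]
  map_add' a b := by
    rw [← corner_add]
    congr 1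
    refine ext_corner (ofCorner_suppLE _) ((ofCorner_suppLE _).add (ofCorner_suppLE _)) ?_
    rw [corner_ofCorner, corner_add, corner_ofCorner, corner_ofCorner]
  map_mul' a b := by
    rw [← corner_mul ((ofCorner_suppLE a).mono h)]
    congr 1
    refine ext_corner (ofCorner_suppLE _) ((ofCorner_suppLE _).mul (ofCorner_suppLE _)) ?_
    rw [corner_ofCorner, corner_mul (ofCorner_suppLE _), corner_ofCorner, corner_ofCorner]
  map_star' a := by
    rw [← corner_star]
    congr 1
    refine ext_corner (ofCorner_suppLE _) (ofCorner_suppLE _).star ?_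
    rw [corner_ofCorner, corner_star, corner_ofCorner]

theorem cornerIncl_injective {N M : ℕ} (h : N ≤ M) :
    Function.Injective (cornerIncl (A := A) h) := by
  intro a b hab
  have := ext_corner ((ofCorner_suppLE a).mono h) ((ofCorner_suppLE b).mono h) hab
  rw [← corner_ofCorner a, ← corner_ofCorner b, this]

end Algebra

section Norm

variable {A : Type u} [NonUnitalCStarAlgebra A] [PartialOrder A] [StarOrderedRing A]

/-- The C*-norm on `M_∞(A)`: the norm of `x` in any of the C*-algebras `M_N(A)` that contain it. -/
instance : Norm (FinSuppMatrix A) where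
  norm x := ‖corner x.exists_suppLE.choose x‖

theorem norm_corner_of_le {x : FinSuppMatrix A} {N M : ℕ} (hx : x.SuppLE N) (h : N ≤ M) :
    ‖corner M x‖ = ‖corner N x‖ := by
  rw [← NonUnitalStarAlgHom.norm_map (cornerIncl h) (cornerIncl_injective h) (corner N x)]
  change _ = ‖corner M (ofCorner (corner N x))‖
  rw [ofCorner_corner hx]

theorem norm_eq {x : FinSuppMatrix A} {N : ℕ} (hx : x.SuppLE N) : ‖x‖ = ‖corner N x‖ := by
  have hc : x.SuppLE _ := x.exists_suppLE.choose_spec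
  change ‖corner _ x‖ = _
  rw [← norm_corner_of_le hc (le_max_left _ N), ← norm_corner_of_le hx (le_max_right _ N)]

theorem normedSpaceCore : NormedSpace.Core ℂ (FinSuppMatrix A) where
  norm_nonneg x := norm_nonneg (corner _ x)
  norm_smul c x := by
    obtain ⟨N, hx⟩ := x.exists_suppLE
    rw [norm_eq hx, norm_eq (hx.smul c), corner_smul, norm_smul]
  norm_triangle x y := by
    obtain ⟨N, hx, hy, -⟩ := exists_suppLE₃ x y y
    rw [norm_eq hx, norm_eq hy, norm_eq (hx.add hy), corner_add]
    exact norm_add_le _ _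
  norm_eq_zero_iff x := by
    obtain ⟨N, hx⟩ := x.exists_suppLE
    rw [norm_eq hx, norm_eq_zero]
    exact ⟨fun h => ext_corner hx (fun _ _ _ => rfl) h, fun h => by rw [h]; rfl⟩

instance : NormedAddCommGroup (FinSuppMatrix A) := .ofCore normedSpaceCore

instance : NormedSpace ℂ (FinSuppMatrix A) := .ofCore normedSpaceCore

instance : NonUnitalNormedRing (FinSuppMatrix A) where
  __ : NonUnitalRing (FinSuppMatrix A) := inferInstance
  __ : NormedAddCommGroup (FinSuppMatrix A) := inferInstance
  norm_mul_le x y := by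
    obtain ⟨N, hx, hy, -⟩ := exists_suppLE₃ x y y
    rw [norm_eq hx, norm_eq hy, norm_eq (hx.mul hy), corner_mul hx]
    exact norm_mul_le _ _

instance : CStarRing (FinSuppMatrix A) where
  norm_mul_self_le x := by
    obtain ⟨N, hx⟩ := x.exists_suppLE
    rw [norm_eq hx, norm_eq (hx.star.mul hx), corner_mul hx.star, corner_star]
    exact (CStarRing.norm_star_mul_self (x := corner N x)).ge

end Norm

end FinSuppMatrix

/-- The stabilization `A ⊗ 𝒦` of `A`, where `𝒦` is the algebra of compact operators on a separable
infinite-dimensional Hilbert space: the completion of `M_∞(A)` in its C*-norm. -/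
def Stabilization (A : Type u) [NonUnitalCStarAlgebra A] [PartialOrder A] [StarOrderedRing A] :
    Type u :=
  UniformSpace.Completion (FinSuppMatrix A)

namespace Stabilization

open UniformSpace

variable {A : Type u} [NonUnitalCStarAlgebra A] [PartialOrder A] [StarOrderedRing A]

instance : NormedAddCommGroup (Stabilization A) :=
  inferInstanceAs (NormedAddCommGroup (Completion (FinSuppMatrix A)))

instance : NormedSpace ℂ (Stabilization A) :=
  inferInstanceAs (NormedSpace ℂ (Completion (FinSuppMatrix A)))

instance : CompleteSpace (Stabilization A) :=
  inferInstanceAs (CompleteSpace (Completion (FinSuppMatrix A)))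

/-- The canonical isometric embedding of `M_∞(A)` in `A ⊗ 𝒦`. -/
def of : FinSuppMatrix A →ₗᵢ[ℂ] Stabilization A := Completion.toComplₗᵢ

theorem isDenseInducing_of : IsDenseInducing (of : FinSuppMatrix A → Stabilization A) :=
  Completion.isDenseInducing_coe

theorem denseRange_of : DenseRange (of : FinSuppMatrix A → Stabilization A) :=
  isDenseInducing_of.dense

/-- The continuous extension of the multiplication of `M_∞(A)`. -/
instance : Mul (Stabilization A) where
  mul x y := (isDenseInducing_of.prodMap isDenseInducing_of).extend
    (fun p : FinSuppMatrix A × FinSuppMatrix A => of (p.1 * p.2)) (x, y)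

/-- The continuous extension of the involution of `M_∞(A)`. -/
instance : Star (Stabilization A) where
  star := isDenseInducing_of.extend fun x : FinSuppMatrix A => of (star x)

theorem of_mul (x y : FinSuppMatrix A) : of (x * y) = of x * of y :=
  ((isDenseInducing_of.prodMap isDenseInducing_of).extend_eq
    (of.continuous.comp continuous_mul) (x, y)).symm

theorem continuous_mul_aux : Continuous fun p : Stabilization A × Stabilization A => p.1 * p.2 := by
  let m := (AddMonoidHom.mul : FinSuppMatrix A →+ FinSuppMatrix A →+ FinSuppMatrix A).compr₂
    (of (A := A)).toLinearMap.toAddMonoidHom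
  have hm : Continuous fun p : FinSuppMatrix A × FinSuppMatrix A => m p.1 p.2 :=
    of.continuous.comp continuous_mul
  let e : FinSuppMatrix A →+ Stabilization A := (of (A := A)).toLinearMap.toAddMonoidHom
  have di : IsDenseInducing e := isDenseInducing_of
  exact (di.extend_Z_bilin di hm :)

theorem of_star (x : FinSuppMatrix A) : of (star x) = star (of x) :=
  (isDenseInducing_of.extend_eq (f := fun x : FinSuppMatrix A => of (star x))
    (of.continuous.comp (starₗᵢ (E := FinSuppMatrix A) ℂ).continuous) x).symm

theorem continuous_star_aux : Continuous (star : Stabilization A → Stabilization A) := by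
  have h : UniformContinuous fun x : FinSuppMatrix A => of (star x) :=
    of.isometry.uniformContinuous.comp (starₗᵢ (E := FinSuppMatrix A) ℂ).isometry.uniformContinuous
  exact (uniformContinuous_uniformly_extend
    (of (A := A)).isometry.isUniformInducing denseRange_of h).continuous

instance : ContinuousMul (Stabilization A) := ⟨continuous_mul_aux⟩

instance : ContinuousStar (Stabilization A) := ⟨continuous_star_aux⟩

instance : NonUnitalRing (Stabilization A) where
  left_distrib x y z := by
    refine denseRange_of.induction_on₃ (isClosed_eq (by fun_prop) (by fun_prop))
      (fun a b c => ?_) x y z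
    simp only [← map_add, ← of_mul, mul_add]
  right_distrib x y z := by
    refine denseRange_of.induction_on₃ (isClosed_eq (by fun_prop) (by fun_prop))
      (fun a b c => ?_) x y z
    simp only [← map_add, ← of_mul, add_mul]
  zero_mul x := by
    refine denseRange_of.induction_on x (isClosed_eq (by fun_prop) (by fun_prop)) fun a => ?_
    rw [← map_zero of, ← of_mul, zero_mul]
  mul_zero x := by
    refine denseRange_of.induction_on x (isClosed_eq (by fun_prop) (by fun_prop)) fun a => ?_
    rw [← map_zero of, ← of_mul, mul_zero]
  mul_assoc x y z := by
    refine denseRange_of.induction_on₃ (isClosed_eq (by fun_prop) (by fun_prop))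
      (fun a b c => ?_) x y z
    simp only [← of_mul, mul_assoc]

instance : NonUnitalNormedRing (Stabilization A) where
  __ : NonUnitalRing (Stabilization A) := inferInstance
  __ : NormedAddCommGroup (Stabilization A) := inferInstance
  norm_mul_le x y := by
    refine denseRange_of.induction_on₂ (isClosed_le (by fun_prop) (by fun_prop))
      (fun a b => ?_) x y
    simpa only [← of_mul, of.norm_map] using norm_mul_le a b

instance : StarRing (Stabilization A) where
  star_involutive x := by
    refine denseRange_of.induction_on x (isClosed_eq (by fun_prop) (by fun_prop)) fun a => ?_
    simp only [← of_star, star_star]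
  star_add x y := by
    refine denseRange_of.induction_on₂ (isClosed_eq (by fun_prop) (by fun_prop))
      (fun a b => ?_) x y
    simp only [← map_add, ← of_star, star_add]
  star_mul x y := by
    refine denseRange_of.induction_on₂ (isClosed_eq (by fun_prop) (by fun_prop))
      (fun a b => ?_) x y
    simp only [← of_mul, ← of_star, star_mul]

instance : CStarRing (Stabilization A) where
  norm_mul_self_le x := by
    refine denseRange_of.induction_on x (isClosed_le (by fun_prop) (by fun_prop)) fun a => ?_
    simpa only [← of_star, ← of_mul, of.norm_map] using CStarRing.norm_mul_self_le a

theorem continuous_smul_aux (c : ℂ) : Continuous fun x : Stabilization A => c • x :=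
  continuous_const_smul c

instance : IsScalarTower ℂ (Stabilization A) (Stabilization A) where
  smul_assoc c x y := by
    have h1 : Continuous fun p : Stabilization A × Stabilization A => (c • p.1) * p.2 :=
      ((continuous_smul_aux c).comp continuous_fst).mul continuous_snd
    have h2 : Continuous fun p : Stabilization A × Stabilization A => c • (p.1 * p.2) :=
      (continuous_smul_aux c).comp continuous_mul
    refine denseRange_of.induction_on₂ (p := fun x y => (c • x) * y = c • (x * y))
      (isClosed_eq h1 h2) (fun a b => ?_) x y
    simp only [← map_smul, ← of_mul, smul_mul_assoc]

instance : SMulCommClass ℂ (Stabilization A) (Stabilization A) where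
  smul_comm c x y := by
    have h1 : Continuous fun p : Stabilization A × Stabilization A => c • (p.1 * p.2) :=
      (continuous_smul_aux c).comp continuous_mul
    have h2 : Continuous fun p : Stabilization A × Stabilization A => p.1 * (c • p.2) :=
      continuous_fst.mul ((continuous_smul_aux c).comp continuous_snd)
    refine denseRange_of.induction_on₂ (p := fun x y => c • (x * y) = x * (c • y))
      (isClosed_eq h1 h2) (fun a b => ?_) x y
    simp only [← map_smul, ← of_mul, mul_smul_comm]

instance : StarModule ℂ (Stabilization A) where
  star_smul c x := by
    have h1 : Continuous fun x : Stabilization A => star (c • x) :=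
      continuous_star.comp (continuous_smul_aux c)
    have h2 : Continuous fun x : Stabilization A => star c • star x :=
      (continuous_smul_aux _).comp continuous_star
    refine denseRange_of.induction_on (p := fun x => star (c • x) = star c • star x) x
      (isClosed_eq h1 h2) fun a => ?_
    simp only [← map_smul, ← of_star, star_smul]

instance : NonUnitalCStarAlgebra (Stabilization A) where

/-- The order for which the positive elements are those of the form `x* x`. -/
instance : PartialOrder (Stabilization A) := CStarAlgebra.spectralOrder _

instance : StarOrderedRing (Stabilization A) := CStarAlgebra.spectralOrderedRing _

end Stabilization

/-! ### The Cuntz semigroup -/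

section Cuntz

variable {B : Type u} [NonUnitalCStarAlgebra B]

/-- The block diagonal sum of two matrices. -/
def blockSum {m n m' n' : Type} (a : CStarMatrix m n B) (b : CStarMatrix m' n' B) :
    CStarMatrix (m ⊕ m') (n ⊕ n') B :=
  CStarMatrix.ofMatrix (Matrix.fromBlocks a 0 0 b)

section blockSum

variable {m n m' n' : Type} (a : CStarMatrix m n B) (b : CStarMatrix m' n' B)

theorem blockSum_inl_inl (i : m) (j : n) : blockSum a b (Sum.inl i) (Sum.inl j) = a i j := rfl

theorem blockSum_inl_inr (i : m) (j : n') : blockSum a b (Sum.inl i) (Sum.inr j) = 0 := rfl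

theorem blockSum_inr_inl (i : m') (j : n) : blockSum a b (Sum.inr i) (Sum.inl j) = 0 := rfl

theorem blockSum_inr_inr (i : m') (j : n') : blockSum a b (Sum.inr i) (Sum.inr j) = b i j := rfl

end blockSum

namespace CuntzLE

theorem conj_apply {m n : Type} [Fintype n] (x : CStarMatrix n m B) (b : CStarMatrix n n B) (i j : m) :
    (x.conjTranspose * b * x) i j = ∑ k, (∑ l, star (x l i) * b l k) * x k j := rfl

theorem tendsto_iff {m n : Type} {ι : Type*} {f : Filter ι} {y : ι → CStarMatrix m n B}
    {a : CStarMatrix m n B} :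
    Tendsto y f (𝓝 a) ↔ ∀ i j, Tendsto (fun k => y k i j) f (𝓝 (a i j)) := by
  have h : ∀ (y' : ι → m → n → B) (a' : m → n → B),
      Tendsto y' f (𝓝 a') ↔ ∀ i j, Tendsto (fun k => y' k i j) f (𝓝 (a' i j)) := fun y' a' => by
    rw [tendsto_pi_nhds]
    exact forall_congr' fun i => tendsto_pi_nhds
  exact h y a

theorem conj_conj {l m n : Type} [Fintype l] [Fintype n] (b : CStarMatrix l l B) (y : CStarMatrix l n B) (x : CStarMatrix n m B) :
    x.conjTranspose * (y.conjTranspose * b * y) * x = (y * x).conjTranspose * b * (y * x) := by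
  have h : (y * x).conjTranspose = x.conjTranspose * y.conjTranspose :=
    Matrix.conjTranspose_mul (M := y) (N := x)
  rw [h]
  let X : Matrix n m B := x
  let Y : Matrix l n B := y
  let b' : Matrix l l B := b
  change X.conjTranspose * (Y.conjTranspose * b' * Y) * X
    = (X.conjTranspose * Y.conjTranspose) * b' * (Y * X)
  simp only [Matrix.mul_assoc]

end CuntzLE

variable [PartialOrder B] [StarOrderedRing B]

/-- Cuntz subequivalence `a ≾ b` of square matrices over `B`, of possibly different sizes: there is
a sequence of rectangular matrices `x k` such that `(x k)* b (x k)` converges to `a`. -/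
def CuntzLE {m n : Type} [Fintype m] [Fintype n] (a : CStarMatrix m m B) (b : CStarMatrix n n B) :
    Prop :=
  ∃ x : ℕ → CStarMatrix n m B, Tendsto (fun k => (x k).conjTranspose * b * x k) atTop (𝓝 a)

namespace CuntzLE

variable {l m n m' n' : Type} [Fintype l] [Fintype m] [Fintype n] [Fintype m'] [Fintype n']

theorem iff_mem_closure {a : CStarMatrix m m B} {b : CStarMatrix n n B} :
    CuntzLE a b ↔
      a ∈ closure (Set.range fun x : CStarMatrix n m B => x.conjTranspose * b * x) := by
  rw [mem_closure_iff_seq_limit]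
  constructor
  · rintro ⟨x, hx⟩
    exact ⟨_, fun k => ⟨x k, rfl⟩, hx⟩
  · rintro ⟨y, hy, hlim⟩
    choose x hx using hy
    exact ⟨x, by simpa only [hx] using hlim⟩

theorem refl (a : CStarMatrix m m B) : CuntzLE a a := by
  rw [iff_mem_closure]
  let l := CStarAlgebra.approximateUnit (CStarMatrix m m B)
  have hl : l.IsIncreasingApproximateUnit :=
    CStarAlgebra.increasingApproximateUnit (CStarMatrix m m B)
  have : l.NeBot := hl.neBot
  have h1 : Tendsto (fun e => e * a * e) l (𝓝 a) := by
    rw [tendsto_iff_norm_sub_tendsto_zero]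
    have hR := tendsto_iff_norm_sub_tendsto_zero.1 (hl.tendsto_mul_right a)
    have hL := tendsto_iff_norm_sub_tendsto_zero.1 (hl.tendsto_mul_left a)
    refine squeeze_zero' (Eventually.of_forall fun _ => norm_nonneg _) ?_
      (by simpa using hR.add hL)
    filter_upwards [hl.eventually_norm] with e he
    have : e * a * e - a = (e * a - a) * e + (a * e - a) := by rw [sub_mul]; abel
    rw [this]
    refine (norm_add_le _ _).trans ?_
    have h2 : ‖(e * a - a) * e‖ ≤ ‖e * a - a‖ :=
      (norm_mul_le _ _).trans (mul_le_of_le_one_right (norm_nonneg _) he)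
    linarith
  have h2 : ∀ᶠ e in l, e * a * e ∈
      Set.range fun x : CStarMatrix m m B => x.conjTranspose * a * x := by
    filter_upwards [hl.eventually_star_eq] with e he
    refine ⟨e, ?_⟩
    rw [CStarMatrix.star_eq_conjTranspose] at he
    simp only [he]
  exact mem_closure_of_tendsto h1 h2

theorem trans {a : CStarMatrix m m B} {b : CStarMatrix n n B} {c : CStarMatrix l l B}
    (hab : CuntzLE a b) (hbc : CuntzLE b c) : CuntzLE a c := by
  rw [iff_mem_closure] at *
  refine closure_minimal ?_ isClosed_closure hab
  rintro _ ⟨x, rfl⟩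
  have hc : Continuous fun z : CStarMatrix n n B => x.conjTranspose * z * x := by
    refine continuous_iff_continuousAt.2 fun z => ?_
    rw [ContinuousAt, tendsto_iff]
    intro i j
    simp only [conj_apply]
    refine tendsto_finsetSum _ fun k _ => Tendsto.mul_const _ (tendsto_finsetSum _ fun p _ =>
      Tendsto.const_mul _ ?_)
    exact tendsto_iff.1 tendsto_id p k
  refine map_mem_closure (f := fun z : CStarMatrix n n B => x.conjTranspose * z * x) hc hbc ?_
  rintro _ ⟨y, rfl⟩
  exact ⟨y * x, (conj_conj c y x).symm⟩

theorem of_equiv {s : Type} {a : CStarMatrix m m B} {b : CStarMatrix n n B} (e : s ≃ m)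
    (e' : s ≃ n) (h : ∀ i j, a (e i) (e j) = b (e' i) (e' j)) : CuntzLE a b := by
  obtain ⟨x, hx⟩ := refl b
  let f : m ≃ n := e.symm.trans e'
  refine ⟨fun k => CStarMatrix.ofMatrix fun p q => x k p (f q), tendsto_iff.2 fun i j => ?_⟩
  have h1 := tendsto_iff.1 hx (f i) (f j)
  have h2 : b (f i) (f j) = a i j := by
    simpa [f] using (h (e.symm i) (e.symm j)).symm
  rw [← h2]
  exact h1

theorem blockSum_mono {a : CStarMatrix m m B} {b : CStarMatrix n n B} {a' : CStarMatrix m' m' B}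
    {b' : CStarMatrix n' n' B} (ha : CuntzLE a a') (hb : CuntzLE b b') :
    CuntzLE (blockSum a b) (blockSum a' b') := by
  obtain ⟨x, hx⟩ := ha
  obtain ⟨y, hy⟩ := hb
  refine ⟨fun k => blockSum (x k) (y k),
    tendsto_iff.2 fun i j => ?_⟩
  have hx' := fun i j => tendsto_iff.1 hx i j
  have hy' := fun i j => tendsto_iff.1 hy i j
  simp only [conj_apply] at hx' hy' ⊢
  rcases i with i | i <;> rcases j with j | j <;>
    simp only [Fintype.sum_sum_type, blockSum_inl_inl, blockSum_inl_inr, blockSum_inr_inl,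
      blockSum_inr_inr, star_zero, mul_zero, zero_mul, add_zero, zero_add, Finset.sum_const_zero]
  · exact hx' i j
  · exact tendsto_const_nhds
  · exact tendsto_const_nhds
  · exact hy' i j

end CuntzLE

theorem exists_eq_star_mul_self {C : Type u} [NonUnitalCStarAlgebra C] [PartialOrder C]
    [StarOrderedRing C] {c : C} (hc : 0 ≤ c) : ∃ x : C, c = star x * x :=
  CStarAlgebra.nonneg_iff_eq_star_mul_self.1 hc

theorem blockSum_nonneg {m n : Type} [Fintype m] [Fintype n] {a : CStarMatrix m m B}
    {b : CStarMatrix n n B} (ha : 0 ≤ a) (hb : 0 ≤ b) : 0 ≤ blockSum a b := by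
  obtain ⟨x, rfl⟩ := exists_eq_star_mul_self ha
  obtain ⟨y, rfl⟩ := exists_eq_star_mul_self hb
  have h : blockSum (star x * x) (star y * y) = star (blockSum x y) * blockSum x y := by
    ext i j
    rcases i with i | i <;> rcases j with j | j <;>
      simp only [CStarMatrix.mul_apply, CStarMatrix.star_apply, Fintype.sum_sum_type,
        blockSum_inl_inl, blockSum_inl_inr, blockSum_inr_inl, blockSum_inr_inr, star_zero,
        mul_zero, zero_mul, add_zero, zero_add, Finset.sum_const_zero]
  rw [h]
  exact star_mul_self_nonneg _

/-- The positive elements of the matrix algebras `Mₙ(B)`, for all `n`. -/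
structure PosMatrix (B : Type u) [NonUnitalCStarAlgebra B] [PartialOrder B] [StarOrderedRing B] :
    Type u where
  /-- The size of the matrix. -/
  size : ℕ
  /-- The matrix. -/
  mat : CStarMatrix (Fin size) (Fin size) B
  nonneg : 0 ≤ mat

namespace PosMatrix

/-- The preorder is Cuntz subequivalence. -/
instance : Preorder (PosMatrix B) where
  le a b := CuntzLE a.mat b.mat
  le_refl a := CuntzLE.refl a.mat
  le_trans _ _ _ hab hbc := CuntzLE.trans hab hbc

theorem le_def {a b : PosMatrix B} : a ≤ b ↔ CuntzLE a.mat b.mat := Iff.rfl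

/-- The sum `a ⊕ b` is block diagonal. -/
instance : Add (PosMatrix B) where
  add a b :=
    { size := a.size + b.size
      mat := CStarMatrix.reindexₐ ℂ B finSumFinEquiv (blockSum a.mat b.mat)
      nonneg := map_nonneg _ (blockSum_nonneg a.nonneg b.nonneg) }

/-- The matrix of size zero. -/
instance : Zero (PosMatrix B) where
  zero := { size := 0, mat := 0, nonneg := le_rfl }

theorem le_of_equiv {a b : PosMatrix B} {s : Type} (e : s ≃ Fin a.size) (e' : s ≃ Fin b.size)
    (h : ∀ i j, a.mat (e i) (e j) = b.mat (e' i) (e' j)) : a ≤ b :=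
  CuntzLE.of_equiv e e' h

theorem add_mat_apply (a b : PosMatrix B) (i j : Fin a.size ⊕ Fin b.size) :
    (a + b).mat (finSumFinEquiv i) (finSumFinEquiv j) = blockSum a.mat b.mat i j := by
  change blockSum a.mat b.mat (finSumFinEquiv.symm (finSumFinEquiv i))
    (finSumFinEquiv.symm (finSumFinEquiv j)) = _
  rw [Equiv.symm_apply_apply, Equiv.symm_apply_apply]

theorem add_mono {a b a' b' : PosMatrix B} (ha : a ≤ a') (hb : b ≤ b') : a + b ≤ a' + b' := by
  have h1 : CuntzLE (a + b).mat (blockSum a.mat b.mat) :=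
    CuntzLE.of_equiv finSumFinEquiv (Equiv.refl _) (add_mat_apply a b)
  have h2 : CuntzLE (blockSum a'.mat b'.mat) (a' + b').mat :=
    CuntzLE.of_equiv (Equiv.refl _) finSumFinEquiv fun i j => (add_mat_apply a' b' i j).symm
  exact (h1.trans (CuntzLE.blockSum_mono ha hb)).trans h2

theorem add_comm_le (a b : PosMatrix B) : a + b ≤ b + a := by
  refine le_of_equiv (a := a + b) (b := b + a) finSumFinEquiv
    ((Equiv.sumComm _ _).trans finSumFinEquiv) fun i j => ?_
  rw [add_mat_apply, Equiv.trans_apply, Equiv.trans_apply, add_mat_apply]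
  rcases i with i | i <;> rcases j with j | j <;> rfl

theorem add_assoc_equiv (a b c : PosMatrix B) (i j : (Fin a.size ⊕ Fin b.size) ⊕ Fin c.size) :
    (a + b + c).mat (finSumFinEquiv ((finSumFinEquiv.sumCongr (Equiv.refl _)) i))
        (finSumFinEquiv ((finSumFinEquiv.sumCongr (Equiv.refl _)) j)) =
      (a + (b + c)).mat
        (finSumFinEquiv (((Equiv.refl _).sumCongr finSumFinEquiv) (Equiv.sumAssoc _ _ _ i)))
        (finSumFinEquiv (((Equiv.refl _).sumCongr finSumFinEquiv) (Equiv.sumAssoc _ _ _ j))) := by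
  have h1 := add_mat_apply (a + b) c
  have h2 := add_mat_apply a (b + c)
  rw [h1, h2]
  have h3 := fun i j => add_mat_apply a b i j
  have h4 := fun i j => add_mat_apply b c i j
  rcases i with (i | i) | i <;> rcases j with (j | j) | j
  · exact h3 (Sum.inl i) (Sum.inl j)
  · exact h3 (Sum.inl i) (Sum.inr j)
  · rfl
  · exact h3 (Sum.inr i) (Sum.inl j)
  · exact (h3 (Sum.inr i) (Sum.inr j)).trans (h4 (Sum.inl i) (Sum.inl j)).symm
  · exact (h4 (Sum.inl i) (Sum.inr j)).symm
  · rfl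
  · exact (h4 (Sum.inr i) (Sum.inl j)).symm
  · exact (h4 (Sum.inr i) (Sum.inr j)).symm

theorem add_assoc_le (a b c : PosMatrix B) : a + b + c ≤ a + (b + c) :=
  le_of_equiv (a := a + b + c) (b := a + (b + c))
    ((finSumFinEquiv.sumCongr (Equiv.refl _)).trans finSumFinEquiv)
    ((Equiv.sumAssoc _ _ _).trans (((Equiv.refl _).sumCongr finSumFinEquiv).trans finSumFinEquiv))
    (add_assoc_equiv a b c)

theorem le_add_assoc (a b c : PosMatrix B) : a + (b + c) ≤ a + b + c :=
  le_of_equiv (a := a + (b + c)) (b := a + b + c)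
    ((Equiv.sumAssoc _ _ _).trans (((Equiv.refl _).sumCongr finSumFinEquiv).trans finSumFinEquiv))
    ((finSumFinEquiv.sumCongr (Equiv.refl _)).trans finSumFinEquiv)
    fun i j => (add_assoc_equiv a b c i j).symm

theorem add_zero_equiv (a : PosMatrix B) (i j : Fin a.size ⊕ Fin 0) :
    (a + 0).mat (finSumFinEquiv (n := 0) i) (finSumFinEquiv (n := 0) j) =
      a.mat (Equiv.sumEmpty (Fin a.size) (Fin 0) i) (Equiv.sumEmpty (Fin a.size) (Fin 0) j) := by
  refine (add_mat_apply a 0 i j).trans ?_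
  rcases i with i | i
  · rcases j with j | j
    · rfl
    · exact j.elim0
  · exact i.elim0

theorem add_zero_le (a : PosMatrix B) : a + 0 ≤ a :=
  le_of_equiv (a := a + 0) (b := a) (finSumFinEquiv (n := 0)) (Equiv.sumEmpty _ _)
    (add_zero_equiv a)

theorem le_add_zero (a : PosMatrix B) : a ≤ a + 0 :=
  le_of_equiv (a := a) (b := a + 0) (Equiv.sumEmpty _ _) (finSumFinEquiv (n := 0))
    fun i j => (add_zero_equiv a i j).symm

end PosMatrix

/-- The Cuntz semigroup `W(B)`: the positive elements of the matrix algebras `Mₙ(B)`, up to Cuntz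
equivalence (`a ≾ b` and `b ≾ a`), ordered by Cuntz subequivalence. -/
def CuntzSemigroup (B : Type u) [NonUnitalCStarAlgebra B] [PartialOrder B] [StarOrderedRing B] :
    Type u :=
  Antisymmetrization (PosMatrix B) (· ≤ ·)

namespace CuntzSemigroup

instance : PartialOrder (CuntzSemigroup B) :=
  inferInstanceAs (PartialOrder (Antisymmetrization (PosMatrix B) (· ≤ ·)))

/-- The class `[a]` of a positive matrix. -/
def mk (a : PosMatrix B) : CuntzSemigroup B := toAntisymmetrization (· ≤ ·) a

theorem mk_le_mk {a b : PosMatrix B} : mk a ≤ mk b ↔ a ≤ b := Iff.rfl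

theorem mk_eq_mk {a b : PosMatrix B} (hab : a ≤ b) (hba : b ≤ a) : mk a = mk b :=
  le_antisymm (mk_le_mk.2 hab) (mk_le_mk.2 hba)

theorem ind {p : CuntzSemigroup B → Prop} (h : ∀ a, p (mk a)) (x : CuntzSemigroup B) : p x :=
  Quotient.inductionOn x h

/-- `[a] + [b] = [a ⊕ b]`. -/
instance : Add (CuntzSemigroup B) where
  add := Quotient.map₂ (· + ·) fun _ _ h₁ _ _ h₂ =>
    ⟨PosMatrix.add_mono h₁.1 h₂.1, PosMatrix.add_mono h₁.2 h₂.2⟩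

instance : Zero (CuntzSemigroup B) where
  zero := mk 0

theorem mk_add (a b : PosMatrix B) : mk (a + b) = mk a + mk b := rfl

theorem mk_zero : mk (0 : PosMatrix B) = 0 := rfl

theorem add_comm_aux (x y : CuntzSemigroup B) : x + y = y + x := by
  induction x using ind with | _ a
  induction y using ind with | _ b
  exact mk_eq_mk (PosMatrix.add_comm_le a b) (PosMatrix.add_comm_le b a)

theorem add_zero_aux (x : CuntzSemigroup B) : x + 0 = x := by
  induction x using ind with | _ a
  exact mk_eq_mk (PosMatrix.add_zero_le a) (PosMatrix.le_add_zero a)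

instance : AddCommMonoid (CuntzSemigroup B) where
  add_assoc x y z := by
    induction x using ind with | _ a
    induction y using ind with | _ b
    induction z using ind with | _ c
    exact mk_eq_mk (PosMatrix.add_assoc_le a b c) (PosMatrix.le_add_assoc a b c)
  zero_add x := by rw [add_comm_aux, add_zero_aux]
  add_zero := add_zero_aux
  add_comm := add_comm_aux
  nsmul := nsmulRec

instance : IsOrderedAddMonoid (CuntzSemigroup B) where
  add_le_add_left x y hxy z := by
    induction x using ind with | _ a
    induction y using ind with | _ b
    induction z using ind with | _ c
    exact PosMatrix.add_mono hxy (le_refl c)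

end CuntzSemigroup

end Cuntz

/-- The stabilized Cuntz semigroup `Cu(A) = W(A ⊗ 𝒦)`. -/
abbrev Cu (A : Type u) [NonUnitalCStarAlgebra A] [PartialOrder A] [StarOrderedRing A] : Type u :=
  CuntzSemigroup (Stabilization A)

/-! ### The `n`-comparison property -/

/-- The relation `x ≤ₛ y` in an ordered semigroup: `(k + 1) x ≤ k y` for some `k ≥ 1`. -/
def StablyLE {S : Type u} [AddCommMonoid S] [PartialOrder S] (x y : S) : Prop :=
  ∃ k : ℕ, 0 < k ∧ (k + 1) • x ≤ k • y

/-- The `n`-comparison property of an ordered semigroup. -/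
def HasNComparison (S : Type u) [AddCommMonoid S] [PartialOrder S] (n : ℕ) : Prop :=
  ∀ (x : S) (y : Fin (n + 1) → S), (∀ i, StablyLE x (y i)) → x ≤ ∑ i, y i

/-! ### Nuclear dimension -/

/-- A finite-dimensional C*-algebra. -/
structure FinDimCStarAlgebra : Type (u + 1) where
  /-- The underlying type. -/
  carrier : Type u
  [cstarAlgebra : NonUnitalCStarAlgebra carrier]
  [partialOrder : PartialOrder carrier]
  [starOrderedRing : StarOrderedRing carrier]
  [finiteDimensional : FiniteDimensional ℂ carrier]

namespace FinDimCStarAlgebra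

instance : CoeSort FinDimCStarAlgebra.{u} (Type u) := ⟨carrier⟩

attribute [instance] cstarAlgebra partialOrder starOrderedRing finiteDimensional

end FinDimCStarAlgebra

section NuclearDimension

variable {A₁ A₂ : Type u} [NonUnitalCStarAlgebra A₁] [PartialOrder A₁] [StarOrderedRing A₁]
  [NonUnitalCStarAlgebra A₂] [PartialOrder A₂] [StarOrderedRing A₂]

/-- A completely positive map is a contraction. -/
def IsContraction (φ : CompletelyPositiveMap A₁ A₂) : Prop := ∀ a, ‖φ a‖ ≤ ‖a‖

/-- A completely positive map has order zero: it preserves orthogonality of positive elements. -/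
def IsOrderZero (φ : CompletelyPositiveMap A₁ A₂) : Prop :=
  ∀ a b, 0 ≤ a → 0 ≤ b → a * b = 0 → φ a * φ b = 0

/-- There are nets of c.p.c. maps `ψ i l : A → F i l` and c.p.c. order zero maps `φ i l : F i l → A`,
for `i = 0, …, n`, with `F i l` finite-dimensional, such that `∑ i, φ i l (ψ i l a)` converges
to `a` for every `a`. -/
def HasDecomposableApproximations (A : Type u) [NonUnitalCStarAlgebra A] [PartialOrder A]
    [StarOrderedRing A] (n : ℕ) : Prop :=
  ∃ (Λ : Type u) (_ : Preorder Λ) (_ : IsDirectedOrder Λ) (_ : Nonempty Λ)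
    (F : Fin (n + 1) → Λ → FinDimCStarAlgebra.{u})
    (ψ : ∀ i l, CompletelyPositiveMap A (F i l))
    (φ : ∀ i l, CompletelyPositiveMap (F i l) A),
    (∀ i l, IsContraction (ψ i l)) ∧ (∀ i l, IsContraction (φ i l)) ∧
    (∀ i l, IsOrderZero (φ i l)) ∧
    ∀ a, Tendsto (fun l => ∑ i, φ i l (ψ i l a)) atTop (𝓝 a)

/-- `A` has nuclear dimension `n`: `n` is the smallest natural number for which such approximations
exist. -/
def HasNuclearDimension (A : Type u) [NonUnitalCStarAlgebra A] [PartialOrder A]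
    [StarOrderedRing A] (n : ℕ) : Prop :=
  IsLeast {m : ℕ | HasDecomposableApproximations A m} n

end NuclearDimension

end

noncomputable section

open Filter Topology

universe u

/-! Write `θ i = φ i ∘ ψ i` for the maps of an approximation `∑ i, φ i ∘ ψ i → id`. Each `θ i` is
dominated by a map close to the identity, so by the Kadison-Schwarz inequality it is
asymptotically a bimodule map over `A`, and `θ i a` can be compared with `b i` through the
finite-dimensional algebra in the middle: a relation `k a ≾ k b` in `A` is carried by `ψ i` to an
approximate relation in `M_k(F)`, where the multiplicity `k` can be cancelled, because projections
are compared by their ranks in the irreducible representations of `F`. The order zero map `φ i`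
carries the resulting element of `F` back to `A`. To control the errors, `φ i` is first cut by a
central projection of `F`, at a small cost in norm, which makes it bounded below. Summing over `i`
gives `a ≾ b 0 ⊕ ⋯ ⊕ b n` over `A`, and approximation by corners extends this to `A ⊗ 𝒦`. -/

/-! ### Spectral theory in finite-dimensional C*-algebras -/

section SpectralProjection

variable {F : Type*} [CStarAlgebra F] [FiniteDimensional ℂ F]

theorem finite_spectrum_real (x : F) : (spectrum ℝ x).Finite := by
  have : FiniteDimensional ℝ F := Module.Finite.trans ℂ F
  have hne : minpoly ℝ x ≠ 0 := minpoly.ne_zero (.of_finite ℝ x)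
  refine (minpoly ℝ x).roots.toFinset.finite_toSet.subset fun t ht => ?_
  rcases subsingleton_or_nontrivial F with h | h
  · simp at ht
  have h_eval := spectrum.subset_polynomial_aeval x (minpoly ℝ x) ⟨t, ht, rfl⟩
  rw [minpoly.aeval, spectrum.zero_eq] at h_eval
  simpa [hne] using h_eval

theorem continuousOn_spectrum_of_finiteDimensional (x : F) (f : ℝ → ℝ) :
    ContinuousOn f (spectrum ℝ x) :=
  (finite_spectrum_real x).continuousOn f

theorem cfc_mul_of_finiteDimensional (x : F) (f g : ℝ → ℝ) :
    cfc f x * cfc g x = cfc (fun t => f t * g t) x :=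
  (cfc_mul f g x (continuousOn_spectrum_of_finiteDimensional x f)
    (continuousOn_spectrum_of_finiteDimensional x g)).symm

theorem self_mul_cfc_of_finiteDimensional {x : F} (hx : IsSelfAdjoint x) (f : ℝ → ℝ) :
    x * cfc f x = cfc (fun t => t * f t) x := by
  nth_rewrite 1 [← cfc_id' ℝ x]
  exact cfc_mul_of_finiteDimensional x _ f

theorem isStarProjection_cfc_indicator (x : F) (s : Set ℝ) :
    IsStarProjection (cfc (s.indicator 1) x) := by
  refine ⟨?_, cfc_predicate _ x⟩
  rw [IsIdempotentElem, cfc_mul_of_finiteDimensional]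
  refine cfc_congr fun t _ => ?_
  by_cases ht : t ∈ s <;> simp [ht]

/-- The pair `(p, y)` is a truncation of `X` at level `δ` if `p` is a projection on whose range `X`
is invertible with inverse `y` of norm at most `δ⁻¹`, and `X` has norm at most `δ` on the range of
`1 - p`. The example to have in mind is the spectral projection of `X ≥ 0` for `(δ, ∞)`. -/
structure IsSpectralTruncation (δ : ℝ) {H : Type*} [CStarAlgebra H] (X p y : H) : Prop where
  isStarProjection : IsStarProjection p
  isSelfAdjoint_inv : IsSelfAdjoint y
  mul_inv : X * y = p
  norm_inv_le : ‖y‖ ≤ δ⁻¹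
  norm_sub_le : ‖X - X * p‖ ≤ δ

theorem exists_isSpectralTruncation [PartialOrder F] [StarOrderedRing F] {X : F} (hX : 0 ≤ X)
    {δ : ℝ} (hδ : 0 < δ) : ∃ p y : F, IsSpectralTruncation δ X p y := by
  have hXs : IsSelfAdjoint X := .of_nonneg hX
  let f : ℝ → ℝ := (Set.Ioi δ).indicator (·⁻¹)
  have h_mul : X * cfc f X = cfc ((Set.Ioi δ).indicator 1) X := by
    rw [self_mul_cfc_of_finiteDimensional hXs]
    refine cfc_congr fun t _ => ?_
    by_cases ht : δ < t
    · simp [f, ht, (hδ.trans ht).ne']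
    · simp [f, ht]
  refine ⟨cfc ((Set.Ioi δ).indicator 1) X, cfc f X,
    isStarProjection_cfc_indicator X _, cfc_predicate f X, h_mul, ?_, ?_⟩
  · refine norm_cfc_le (by positivity) fun t _ => ?_
    by_cases ht : δ < t
    · have ht0 : 0 ≤ t := (hδ.trans ht).le
      simpa [f, ht, abs_of_nonneg ht0] using inv_anti₀ hδ ht.le
    · simpa [f, ht] using hδ.le
  · have h_sub : X - X * cfc ((Set.Ioi δ).indicator 1) X =
        cfc (fun t => t - t * (Set.Ioi δ).indicator 1 t) X := by
      rw [cfc_sub (fun t : ℝ => t) _ X (by fun_prop)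
        (continuousOn_spectrum_of_finiteDimensional X _), self_mul_cfc_of_finiteDimensional hXs,
        cfc_id' ℝ X]
    rw [h_sub]
    refine norm_cfc_le hδ.le fun t h_spec => ?_
    by_cases ht : δ < t
    · simpa [ht] using hδ.le
    · simpa [ht, abs_of_nonneg (spectrum_nonneg_of_nonneg hX h_spec)] using not_lt.1 ht

theorem exists_isStarProjection_mul_eq_norm_smul [PartialOrder F] [StarOrderedRing F] {w : F}
    (hw : 0 ≤ w) (hw0 : w ≠ 0) : ∃ p : F, IsStarProjection p ∧ p ≠ 0 ∧ w * p = ‖w‖ • p := by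
  have hws : IsSelfAdjoint w := .of_nonneg hw
  have : Nontrivial F := ⟨w, 0, hw0⟩
  refine ⟨cfc (Set.indicator {‖w‖} 1) w, isStarProjection_cfc_indicator w _, fun h => ?_, ?_⟩
  · rw [← cfc_const_zero ℝ w, cfc_eq_cfc_iff_eqOn
      (hf := continuousOn_spectrum_of_finiteDimensional w _)] at h
    simpa using h (CStarAlgebra.norm_mem_spectrum_of_nonneg hw)
  · rw [self_mul_cfc_of_finiteDimensional hws,
      ← cfc_smul _ _ _ (continuousOn_spectrum_of_finiteDimensional w _)]
    refine cfc_congr fun t _ => ?_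
    by_cases ht : t = ‖w‖ <;> simp [ht]

theorem exists_sum_smul_isStarProjection {x : F} (hx : IsSelfAdjoint x) :
    ∃ (s : Finset ℝ) (p : ℝ → F), (∀ t, IsStarProjection (p t)) ∧
      Pairwise (fun t t' => p t * p t' = 0) ∧ x = ∑ t ∈ s, t • p t ∧ 1 = ∑ t ∈ s, p t := by
  let s := (finite_spectrum_real x).toFinset
  have h_mem {t : ℝ} (ht : t ∈ spectrum ℝ x) : t ∈ s := (Set.Finite.mem_toFinset _).2 ht
  have hc := continuousOn_spectrum_of_finiteDimensional x
  refine ⟨s, fun a => cfc (Set.indicator {a} 1) x,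
    fun a => isStarProjection_cfc_indicator x _, fun a b hab => ?_, ?_, ?_⟩
  · refine (cfc_mul_of_finiteDimensional x _ _).trans ?_
    rw [← cfc_const_zero ℝ x]
    refine cfc_congr fun t _ => ?_
    by_cases ha : t = a
    · simp [ha, hab]
    · simp [ha]
  · have h_smul (a : ℝ) : a • cfc (Set.indicator {a} 1) x =
        cfc (fun t => a • Set.indicator {a} (1 : ℝ → ℝ) t) x :=
      (cfc_smul _ _ _ (hc _)).symm
    simp only [h_smul]
    rw [← cfc_sum _ _ _ (fun i _ => hc _)]
    nth_rewrite 1 [← cfc_id' ℝ x]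
    refine cfc_congr fun t ht => ?_
    simp [Set.indicator_apply, h_mem ht]
  · rw [← cfc_sum _ _ _ (fun i _ => hc _), ← cfc_one ℝ x]
    refine cfc_congr fun t ht => ?_
    simp [Finset.sum_apply, h_mem ht]

end SpectralProjection

namespace IsSpectralTruncation

variable {δ : ℝ} {H : Type*} [CStarAlgebra H] {X p y : H}

theorem inv_mul (h : IsSpectralTruncation δ X p y) (hX : IsSelfAdjoint X) : y * X = p := by
  rw [← h.isStarProjection.isSelfAdjoint.star_eq, ← h.mul_inv, star_mul, hX.star_eq,
    h.isSelfAdjoint_inv.star_eq]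

theorem commute (h : IsSpectralTruncation δ X p y) (hX : IsSelfAdjoint X) : Commute X p := by
  calc X * p = X * y * X := by rw [← h.inv_mul hX, mul_assoc]
    _ = p * X := by rw [h.mul_inv]

theorem inv_mul_cube_mul (h : IsSpectralTruncation δ X p y) (hX : IsSelfAdjoint X) :
    y * (X * X * X) * (y * y) = p := by
  have hpp := h.isStarProjection.isIdempotentElem.eq
  calc y * (X * X * X) * (y * y) = (y * X) * X * (X * y) * y := by simp only [mul_assoc]
    _ = p * (X * p) * y := by rw [h.inv_mul hX, h.mul_inv, mul_assoc p]
    _ = p * p * (X * y) := by rw [(h.commute hX).eq]; simp only [mul_assoc]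
    _ = p := by rw [h.mul_inv, hpp, hpp]

variable [PartialOrder H] [StarOrderedRing H]

theorem mul_nonneg (h : IsSpectralTruncation δ X p y) (hX : 0 ≤ X) : 0 ≤ X * p :=
  (h.commute (.of_nonneg hX)).mul_nonneg hX h.isStarProjection.nonneg

theorem sub_mul_nonneg (h : IsSpectralTruncation δ X p y) (hX : 0 ≤ X) : 0 ≤ X - X * p := by
  rw [← mul_one_sub]
  exact ((Commute.one_right X).sub_right (h.commute (.of_nonneg hX))).mul_nonneg hX
    h.isStarProjection.one_sub.nonneg

end IsSpectralTruncation

section Unit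

variable (F : Type*) [NonUnitalCStarAlgebra F] [FiniteDimensional ℂ F]

/- By compactness of the unit ball an approximate unit has a cluster point, which is a unit. -/
theorem exists_unit_of_finiteDimensional : ∃ e : F, ∀ x, e * x = x ∧ x * e = x := by
  let : PartialOrder F := CStarAlgebra.spectralOrder F
  have : StarOrderedRing F := CStarAlgebra.spectralOrderedRing F
  have hl := CStarAlgebra.increasingApproximateUnit F
  have := hl.neBot
  have : ProperSpace F := FiniteDimensional.proper ℂ F
  have h_ball : CStarAlgebra.approximateUnit F ≤ 𝓟 (Metric.closedBall (0 : F) 1) := by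
    rw [le_principal_iff]
    filter_upwards [hl.eventually_norm] with e he
    simpa using he
  obtain ⟨e, -, he⟩ := isCompact_closedBall (0 : F) 1 h_ball
  have h_eq (f : F → F) (hf : Continuous f) (x : F)
      (hx : Tendsto f (CStarAlgebra.approximateUnit F) (𝓝 x)) : f e = x :=
    eq_of_nhds_neBot ((he.map hf.continuousAt tendsto_map).mono hx)
  exact ⟨e, fun x => ⟨h_eq (· * x) (by fun_prop) x (hl.tendsto_mul_right x),
    h_eq (x * ·) (by fun_prop) x (hl.tendsto_mul_left x)⟩⟩

theorem exists_cstarAlgebra_of_finiteDimensional :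
    ∃ c : CStarAlgebra F, c.toNonUnitalCStarAlgebra = ‹NonUnitalCStarAlgebra F› := by
  obtain ⟨e, he⟩ := exists_unit_of_finiteDimensional F
  let ring : NormedRing F :=
    { (inferInstance : NonUnitalNormedRing F) with
      one := e
      one_mul := fun x => (he x).1
      mul_one := fun x => (he x).2 }
  let algebra : NormedAlgebra ℂ F :=
    { Algebra.ofModule (R := ℂ) (A := F) smul_mul_assoc mul_smul_comm with
      norm_smul_le := norm_smul_le }
  exact ⟨{ ring, algebra, ‹NonUnitalCStarAlgebra F› with }, rfl⟩

end Unit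

/-! ### Completely positive maps -/

/-- A linear map is completely positive if its amplifications to matrix algebras are positive.
Unlike `CompletelyPositiveMap`, this is a predicate on linear maps, so that it applies to sums and
composites. -/
def IsCompletelyPositive {A B : Type*} [NonUnitalCStarAlgebra A] [PartialOrder A]
    [StarOrderedRing A] [NonUnitalCStarAlgebra B] [PartialOrder B] [StarOrderedRing B]
    (f : A →ₗ[ℂ] B) : Prop :=
  ∀ (ι : Type) [Fintype ι] (M : CStarMatrix ι ι A), 0 ≤ M → 0 ≤ M.map f

namespace IsCompletelyPositive

variable {A B C : Type*} [NonUnitalCStarAlgebra A] [PartialOrder A] [StarOrderedRing A]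
  [NonUnitalCStarAlgebra B] [PartialOrder B] [StarOrderedRing B]
  [NonUnitalCStarAlgebra C] [PartialOrder C] [StarOrderedRing C]

theorem of_completelyPositiveMap (f : CompletelyPositiveMap A B) :
    IsCompletelyPositive f.toLinearMap :=
  fun _ _ M hM => f.map_cstarMatrix_nonneg M hM

theorem of_nonUnitalStarAlgHom (f : A →⋆ₙₐ[ℂ] B) :
    IsCompletelyPositive (f : A →ₗ[ℂ] B) :=
  fun _ _ _ hM => _root_.map_nonneg (CStarMatrix.mapₙₐ f) hM

theorem comp {g : B →ₗ[ℂ] C} {f : A →ₗ[ℂ] B} (hg : IsCompletelyPositive g)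
    (hf : IsCompletelyPositive f) : IsCompletelyPositive (g ∘ₗ f) :=
  fun ι _ M hM => hg ι _ (hf ι M hM)

theorem add {f g : A →ₗ[ℂ] B} (hf : IsCompletelyPositive f) (hg : IsCompletelyPositive g) :
    IsCompletelyPositive (f + g) :=
  fun ι _ M hM => add_nonneg (hf ι M hM) (hg ι M hM)

theorem sum {κ : Type*} (s : Finset κ) {f : κ → A →ₗ[ℂ] B}
    (hf : ∀ k ∈ s, IsCompletelyPositive (f k)) : IsCompletelyPositive (∑ k ∈ s, f k) :=
  Finset.sum_induction f IsCompletelyPositive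
    (fun _ _ hf hg => hf.add hg) (fun _ _ _ _ => le_rfl) hf

variable {f : A →ₗ[ℂ] B} (hf : IsCompletelyPositive f)

/-- The bundled version of a completely positive linear map. -/
def toCompletelyPositiveMap : CompletelyPositiveMap A B := ⟨f, fun k M hM => hf (Fin k) M hM⟩

include hf

theorem map_nonneg {a : A} (ha : 0 ≤ a) : 0 ≤ f a :=
  _root_.map_nonneg hf.toCompletelyPositiveMap ha

theorem map_star (a : A) : f (star a) = star (f a) :=
  StarHomClass.map_star hf.toCompletelyPositiveMap a

theorem exists_sum_star_mul_eq {n : ℕ} (c : Fin (n + 1) → A) :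
    ∃ N : Fin (n + 1) → Fin (n + 1) → B,
      ∀ i j, f (star (c i) * c j) = ∑ k, star (N k i) * N k j := by
  let R : CStarMatrix (Fin (n + 1)) (Fin (n + 1)) A :=
    CStarMatrix.ofMatrix fun k j => if k = 0 then c j else 0
  have h_gram (i j) : (star R * R) i j = star (c i) * c j := by
    change ∑ k : Fin (n + 1), star (if k = 0 then c i else 0) * (if k = 0 then c j else 0) = _
    simp
  obtain ⟨N, hN⟩ := exists_eq_star_mul_self (hf _ _ (star_mul_self_nonneg R))
  refine ⟨fun k j => N k j, fun i j => ?_⟩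
  rw [← h_gram]
  exact (congrFun₂ hN i j).trans CStarMatrix.mul_apply

end IsCompletelyPositive

/-! ### Order zero maps -/

section Polarization

variable {E V : Type*} [AddCommGroup E] [StarAddMonoid E] [Module ℂ E] [StarModule ℂ E]
  [AddCommGroup V] [Module ℂ V]

theorem map_eq_zero_of_isSelfAdjoint {f : E →ₗ[ℂ] V} (hf : ∀ x, IsSelfAdjoint x → f x = 0)
    (x : E) : f x = 0 := by
  rw [← realPart_add_I_smul_imaginaryPart x, map_add, map_smul, hf _ (realPart x).2,
    hf _ (imaginaryPart x).2, smul_zero, add_zero]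

theorem add_swap_eq_zero_of_isSelfAdjoint {B : E →ₗ[ℂ] E →ₗ[ℂ] V}
    (hB : ∀ x, IsSelfAdjoint x → B x x = 0) (x y : E) : B x y + B y x = 0 := by
  have h_selfAdjoint (x y : E) (hx : IsSelfAdjoint x) (hy : IsSelfAdjoint y) :
      (B + B.flip) x y = 0 := by
    have h := hB (x + y) (hx.add hy)
    simpa [hB x hx, hB y hy, add_comm] using h
  have h_left (y : E) (hy : IsSelfAdjoint y) (x : E) : (B + B.flip).flip y x = 0 :=
    map_eq_zero_of_isSelfAdjoint (fun x hx => h_selfAdjoint x y hx hy) x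
  exact map_eq_zero_of_isSelfAdjoint (f := (B + B.flip) x) (fun y hy => h_left y hy x) y

theorem bilin_eq_zero_of_star_self {B : E →ₗ[ℂ] E →ₗ[ℂ] V} (hB : ∀ x, B (star x) x = 0)
    (x y : E) : B x y = 0 := by
  have h_symm (x y : E) : B (star x) y + B (star y) x = 0 := by
    simpa [hB x, hB y, add_comm] using hB (x + y)
  have h_anti : Complex.I • (B (star (star x)) y - B (star y) (star x)) = 0 := by
    simpa [smul_sub, sub_eq_add_neg] using h_symm (star x) (Complex.I • y)
  have h_diff := (smul_eq_zero.1 h_anti).resolve_left Complex.I_ne_zero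
  have h_two : (2 : ℂ) • B (star (star x)) y = 0 := by
    rw [two_smul]
    nth_rewrite 2 [sub_eq_zero.1 h_diff]
    exact h_symm _ _
  simpa using h_two

end Polarization

section OrderZeroDefect

variable {F A : Type*} [CStarAlgebra F] [NonUnitalCStarAlgebra A] {φ : F →ₗ[ℂ] A}

/-- The bilinear map `(x, y) ↦ φ 1 φ (x y) - φ x φ y`, which vanishes if `φ` has order zero. -/
def orderZeroDefect (φ : F →ₗ[ℂ] A) : F →ₗ[ℂ] F →ₗ[ℂ] A :=
  (LinearMap.mul ℂ F).compr₂ (LinearMap.mulLeft ℂ (φ 1) ∘ₗ φ) - (LinearMap.mul ℂ A).compl₁₂ φ φ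

theorem orderZeroDefect_apply (φ : F →ₗ[ℂ] A) (x y : F) :
    orderZeroDefect φ x y = φ 1 * φ (x * y) - φ x * φ y := rfl

theorem map_mul_self_of_isSelfAdjoint [PartialOrder F] [StarOrderedRing F]
    [FiniteDimensional ℂ F] (h_orth : ∀ a b, 0 ≤ a → 0 ≤ b → a * b = 0 → φ a * φ b = 0)
    {x : F} (hx : IsSelfAdjoint x) : φ x * φ x = φ 1 * φ (x * x) := by
  obtain ⟨s, p, hp, hpp, hxs, h_one⟩ := exists_sum_smul_isStarProjection hx
  have h_map (c : ℝ → ℝ) : φ (∑ t ∈ s, c t • p t) = ∑ t ∈ s, c t • φ (p t) := by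
    rw [map_sum]
    exact Finset.sum_congr rfl fun t _ => LinearMap.map_smul_of_tower φ (c t) (p t)
  have h_mul (c : ℝ → ℝ) (t : ℝ) (ht : t ∈ s) :
      (∑ t' ∈ s, c t' • φ (p t')) * φ (p t) = c t • (φ (p t) * φ (p t)) := by
    rw [Finset.sum_mul, Finset.sum_eq_single_of_mem t ht, smul_mul_assoc]
    intro t' _ ht'
    rw [smul_mul_assoc, h_orth _ _ (hp t').nonneg (hp t).nonneg (hpp ht'), smul_zero]
  have h_self_mul (t : ℝ) (ht : t ∈ s) : x * p t = t • p t := by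
    rw [hxs, Finset.sum_mul, Finset.sum_eq_single_of_mem t ht, smul_mul_assoc,
      (hp t).isIdempotentElem.eq]
    intro t' _ ht'
    rw [smul_mul_assoc, hpp ht', smul_zero]
  have hφx : φ x = ∑ t ∈ s, t • φ (p t) := by rw [← h_map, ← hxs]
  have hφ1 : φ 1 = ∑ t ∈ s, (1 : ℝ) • φ (p t) := by
    rw [← h_map]
    simp only [one_smul, h_one]
  have h_sq : x * x = ∑ t ∈ s, (t * t) • p t := by
    nth_rewrite 2 [hxs]
    rw [Finset.mul_sum]
    refine Finset.sum_congr rfl fun t ht => ?_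
    rw [mul_smul_comm, h_self_mul t ht, mul_smul]
  rw [h_sq, h_map, hφx, hφ1, Finset.mul_sum, Finset.mul_sum]
  refine Finset.sum_congr rfl fun t ht => ?_
  rw [mul_smul_comm, mul_smul_comm, h_mul (fun t => t) t ht, h_mul (fun _ => 1) t ht, one_smul,
    mul_smul]

theorem orderZeroDefect_add_swap_eq_zero
    (h_sq : ∀ x, IsSelfAdjoint x → φ x * φ x = φ 1 * φ (x * x)) (x y : F) :
    orderZeroDefect φ x y + orderZeroDefect φ y x = 0 :=
  add_swap_eq_zero_of_isSelfAdjoint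
    (fun x hx => by rw [orderZeroDefect_apply, h_sq x hx, sub_self]) x y

theorem map_mul_map_one_of_sq (h_sq : ∀ x, IsSelfAdjoint x → φ x * φ x = φ 1 * φ (x * x)) (x : F) :
    φ x * φ 1 = φ 1 * φ x := by
  have h := orderZeroDefect_add_swap_eq_zero h_sq x 1
  simp only [orderZeroDefect_apply, mul_one, one_mul, sub_self, add_zero] at h
  exact (sub_eq_zero.1 h).symm

end OrderZeroDefect

/-- Order zero maps on a unital C*-algebra, in their multiplicative form: the relation
`φ x φ y = φ 1 φ (x y)` says that `φ` is the product of a `*`-homomorphism and the element `φ 1`,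
which commutes with its range. -/
structure IsOrderZeroMap {F A : Type*} [CStarAlgebra F] [PartialOrder F] [StarOrderedRing F]
    [NonUnitalCStarAlgebra A] [PartialOrder A] [StarOrderedRing A] (φ : F →ₗ[ℂ] A) : Prop where
  completelyPositive : IsCompletelyPositive φ
  map_mul_map : ∀ x y, φ x * φ y = φ 1 * φ (x * y)

section OrderZero

variable {F A : Type*} [CStarAlgebra F] [PartialOrder F] [StarOrderedRing F]
  [NonUnitalCStarAlgebra A] [PartialOrder A] [StarOrderedRing A] {φ : F →ₗ[ℂ] A}

theorem IsCompletelyPositive.map_one_mul_orderZeroDefect_nonneg (hφ : IsCompletelyPositive φ)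
    (h_comm : ∀ x, φ x * φ 1 = φ 1 * φ x) (x : F) :
    0 ≤ φ 1 * orderZeroDefect φ (star x) x := by
  obtain ⟨N, hN⟩ := hφ.exists_sum_star_mul_eq ![1, x]
  have h_one : star (φ 1) = φ 1 := (IsSelfAdjoint.of_nonneg (hφ.map_nonneg zero_le_one)).star_eq
  have h_expand (k) : star (N k 1 * φ 1 - N k 0 * φ x) * (N k 1 * φ 1 - N k 0 * φ x) =
      φ 1 * (star (N k 1) * N k 1) * φ 1 - φ 1 * (star (N k 1) * N k 0) * φ x
        - φ (star x) * (star (N k 0) * N k 1) * φ 1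
        + φ (star x) * (star (N k 0) * N k 0) * φ x := by
    simp only [star_sub, star_mul, h_one, ← hφ.map_star]
    noncomm_ring
  have h_sum : φ 1 * orderZeroDefect φ (star x) x =
      ∑ k, star (N k 1 * φ 1 - N k 0 * φ x) * (N k 1 * φ 1 - N k 0 * φ x) := by
    simp only [h_expand, Finset.sum_add_distrib, Finset.sum_sub_distrib, ← Finset.sum_mul,
      ← Finset.mul_sum, ← hN, Matrix.cons_val_zero, Matrix.cons_val_one, star_one, mul_one,
      one_mul, orderZeroDefect_apply, mul_sub]
    simp only [mul_assoc, h_comm]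
    simp only [← mul_assoc, h_comm]
    abel
  rw [h_sum]
  exact Finset.sum_nonneg fun k _ => star_mul_self_nonneg _

theorem star_orderZeroDefect_star_self (hφ : IsCompletelyPositive φ)
    (h_comm : ∀ x, φ x * φ 1 = φ 1 * φ x) (x : F) :
    star (orderZeroDefect φ (star x) x) = orderZeroDefect φ (star x) x := by
  simp only [orderZeroDefect_apply, star_sub, star_mul, ← hφ.map_star, star_star, star_one, h_comm]

theorem map_one_mul_orderZeroDefect_star_self (hφ : IsCompletelyPositive φ)
    (h_sq : ∀ x, IsSelfAdjoint x → φ x * φ x = φ 1 * φ (x * x)) (x : F) :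
    φ 1 * orderZeroDefect φ (star x) x = 0 := by
  have h_swap := orderZeroDefect_add_swap_eq_zero h_sq (star x) x
  have h_nonneg := hφ.map_one_mul_orderZeroDefect_nonneg (map_mul_map_one_of_sq h_sq)
  refine le_antisymm ?_ (h_nonneg x)
  rw [eq_neg_of_add_eq_zero_left h_swap, mul_neg, neg_nonpos]
  simpa using h_nonneg (star x)

theorem orderZeroDefect_star_self_mul_map (hφ : IsCompletelyPositive φ)
    (h_sq : ∀ x, IsSelfAdjoint x → φ x * φ x = φ 1 * φ (x * x)) (x v : F) :
    orderZeroDefect φ (star x) x * φ v = 0 := by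
  have h_comm := map_mul_map_one_of_sq h_sq
  have h_star := star_orderZeroDefect_star_self hφ h_comm x
  have h_mul_one : orderZeroDefect φ (star x) x * φ 1 = 0 := by
    have h := congrArg star (map_one_mul_orderZeroDefect_star_self hφ h_sq x)
    rwa [star_mul, h_star, ← hφ.map_star, star_one, star_zero] at h
  refine map_eq_zero_of_isSelfAdjoint
    (f := LinearMap.mulLeft ℂ (orderZeroDefect φ (star x) x) ∘ₗ φ) (fun v hv => ?_) v
  change orderZeroDefect φ (star x) x * φ v = 0
  have h_star_v : star (φ v) = φ v := by rw [← hφ.map_star, hv.star_eq]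
  rw [← CStarRing.mul_star_self_eq_zero_iff, star_mul, h_star, h_star_v]
  calc orderZeroDefect φ (star x) x * φ v * (φ v * orderZeroDefect φ (star x) x)
      = orderZeroDefect φ (star x) x * (φ v * φ v) * orderZeroDefect φ (star x) x := by
        simp only [mul_assoc]
    _ = 0 := by rw [h_sq v hv, ← mul_assoc, h_mul_one, zero_mul, zero_mul]

theorem orderZeroDefect_star_self (hφ : IsCompletelyPositive φ)
    (h_sq : ∀ x, IsSelfAdjoint x → φ x * φ x = φ 1 * φ (x * x)) (x : F) :
    orderZeroDefect φ (star x) x = 0 := by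
  have h_comm := map_mul_map_one_of_sq h_sq
  have h_star := star_orderZeroDefect_star_self hφ h_comm x
  have h_mul := orderZeroDefect_star_self_mul_map hφ h_sq x
  rw [← CStarRing.star_mul_self_eq_zero_iff, h_star]
  nth_rewrite 2 [orderZeroDefect_apply]
  rw [mul_sub, ← mul_assoc, ← mul_assoc, h_mul, h_mul, zero_mul, zero_mul, sub_zero]

/- The multiplicative form of the order zero condition is due to Winter and Zacharias. Here the
defect of multiplicativity is killed by `φ 1` because it changes sign when its arguments are
swapped, while its product with `φ 1` is positive by complete positivity. -/
theorem isOrderZeroMap_of_orthogonal [FiniteDimensional ℂ F] (hφ : IsCompletelyPositive φ)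
    (h_orth : ∀ a b, 0 ≤ a → 0 ≤ b → a * b = 0 → φ a * φ b = 0) : IsOrderZeroMap φ where
  completelyPositive := hφ
  map_mul_map x y := by
    have h := bilin_eq_zero_of_star_self (orderZeroDefect_star_self hφ fun _ =>
      map_mul_self_of_isSelfAdjoint h_orth) x y
    exact (sub_eq_zero.1 h).symm

end OrderZero

/-! ### Cutting an order zero map -/

theorem exists_isStarProjection_of_mul_mem {F : Type*} [CStarAlgebra F] [FiniteDimensional ℂ F]
    (K : NonUnitalStarSubalgebra ℂ F) (hK : ∀ x ∈ K, ∀ y, x * y ∈ K) :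
    ∃ e ∈ K, IsStarProjection e ∧ (∀ x, e * x = x * e) ∧ ∀ x ∈ K, e * x = x := by
  have h_left (x) (hx : x ∈ K) (y : F) : y * x ∈ K := by
    simpa using star_mem (hK _ (star_mem hx) (star y))
  have : IsClosed (K : Set F) := K.toSubmodule.closed_of_finiteDimensional
  have : FiniteDimensional ℂ K := inferInstanceAs (FiniteDimensional ℂ K.toSubmodule)
  obtain ⟨⟨e, heK⟩, he⟩ := exists_unit_of_finiteDimensional K
  have h_one_mul (x) (hx : x ∈ K) : e * x = x := congrArg Subtype.val (he ⟨x, hx⟩).1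
  have h_mul_one (x) (hx : x ∈ K) : x * e = x := congrArg Subtype.val (he ⟨x, hx⟩).2
  have h_star : star e = e := by
    have h_mul_star : e * star e = star e := h_one_mul _ (star_mem heK)
    have h := congrArg star h_mul_star
    rw [star_mul, star_star, h_mul_star] at h
    exact h
  refine ⟨e, heK, ⟨h_one_mul e heK, h_star⟩, fun x => ?_, h_one_mul⟩
  rw [← h_mul_one _ (hK e heK x), mul_assoc, h_one_mul _ (h_left e heK x)]

theorem exists_isStarProjection_star_mul_mul_eq {F : Type*} [CStarAlgebra F] [PartialOrder F]
    [StarOrderedRing F] [FiniteDimensional ℂ F] {z u : F} (hz : IsStarProjection z)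
    (h_comm : ∀ x, z * x = x * z) (hzu : z * u ≠ 0) :
    ∃ p : F, IsStarProjection p ∧ p ≠ 0 ∧ z * p = p ∧ star u * z * u * p = ‖z * u‖ ^ 2 • p := by
  have hw : star (z * u) * (z * u) = star u * z * u := by
    rw [star_mul, hz.isSelfAdjoint.star_eq, mul_assoc, ← mul_assoc z, hz.isIdempotentElem.eq,
      mul_assoc]
  have hw_ne : star (z * u) * (z * u) ≠ 0 := by rwa [Ne, CStarRing.star_mul_self_eq_zero_iff]
  obtain ⟨p, hp, hp_ne, hwp⟩ :=
    exists_isStarProjection_mul_eq_norm_smul (star_mul_self_nonneg (z * u)) hw_ne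
  refine ⟨p, hp, hp_ne, ?_, ?_⟩
  · have h : z * (star (z * u) * (z * u) * p) = star (z * u) * (z * u) * p := by
      rw [hw, ← h_comm, mul_assoc z, mul_assoc z, ← mul_assoc z z, hz.isIdempotentElem.eq]
    rw [hwp, mul_smul_comm] at h
    exact smul_right_injective F (norm_ne_zero_iff.2 hw_ne) h
  · rwa [hw, ← hw, CStarRing.norm_star_mul_self, ← sq, hw] at hwp

namespace IsOrderZeroMap

open Unitization

variable {F A : Type*} [CStarAlgebra F] [PartialOrder F] [StarOrderedRing F]
  [NonUnitalCStarAlgebra A] [PartialOrder A] [StarOrderedRing A] {φ : F →ₗ[ℂ] A}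
  (hφ : IsOrderZeroMap φ)

include hφ

theorem map_mul_map_one (x : F) : φ x * φ 1 = φ 1 * φ x := by
  rw [hφ.map_mul_map, mul_one]

theorem map_one_mul_map_of_isIdempotentElem {p : F} (hp : IsIdempotentElem p) :
    φ 1 * φ p = φ p * φ p := by
  rw [hφ.map_mul_map p, hp.eq]

theorem map_one_pow_mul_map {p : F} (hp : IsIdempotentElem p) (m : ℕ) :
    (φ 1 : Unitization ℂ A) ^ m * (φ p : Unitization ℂ A) = (φ p : Unitization ℂ A) ^ (m + 1) := by
  induction m with
  | zero => simp
  | succ m ih =>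
    rw [pow_succ, mul_assoc, ← inr_mul, hφ.map_one_mul_map_of_isIdempotentElem hp, inr_mul,
      ← mul_assoc, ih, ← pow_succ]

theorem star_map_one : star (φ 1) = φ 1 := by
  rw [← hφ.completelyPositive.map_star, star_one]

theorem exists_growth_bound_mul {s : ℝ} (hs : 0 < s) {x : F} (y : F)
    (hx : ∃ C : ℝ, ∀ m : ℕ, ‖(φ 1 : Unitization ℂ A) ^ m * (φ x : Unitization ℂ A)‖ ≤ C * s ^ m) :
    ∃ C : ℝ, ∀ m : ℕ,
      ‖(φ 1 : Unitization ℂ A) ^ m * (φ (x * y) : Unitization ℂ A)‖ ≤ C * s ^ m := by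
  obtain ⟨C, hC⟩ := hx
  refine ⟨max ‖φ (x * y)‖ (C * ‖φ y‖ / s), fun m => ?_⟩
  cases m with
  | zero => simp [norm_inr]
  | succ m =>
    rw [pow_succ, mul_assoc, ← inr_mul, ← hφ.map_mul_map, inr_mul, ← mul_assoc]
    calc _ ≤ ‖(φ 1 : Unitization ℂ A) ^ m * (φ x : Unitization ℂ A)‖ * ‖φ y‖ := by
          simpa [norm_inr] using norm_mul_le ((φ 1 : Unitization ℂ A) ^ m * φ x) (φ y)
      _ ≤ C * s ^ m * ‖φ y‖ := by gcongr; exact hC m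
      _ = (C * ‖φ y‖ / s) * s ^ (m + 1) := by field_simp; ring
      _ ≤ _ := by gcongr; exact le_max_right _ _

/-- The ideal of the elements `x` for which `φ x` lives where `φ 1` is at most `s`, expressed by the
growth of the powers of `φ 1` in the unitization. -/
def growthIdeal {s : ℝ} (hs : 0 < s) : NonUnitalStarSubalgebra ℂ F where
  carrier := {x | ∃ C : ℝ, ∀ m : ℕ,
    ‖(φ 1 : Unitization ℂ A) ^ m * (φ x : Unitization ℂ A)‖ ≤ C * s ^ m}
  zero_mem' := ⟨0, fun m => by simp⟩
  add_mem' := by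
    rintro x y ⟨C, hC⟩ ⟨D, hD⟩
    refine ⟨C + D, fun m => ?_⟩
    rw [map_add, inr_add, mul_add, add_mul]
    exact (norm_add_le _ _).trans (add_le_add (hC m) (hD m))
  smul_mem' := by
    rintro c x ⟨C, hC⟩
    refine ⟨‖c‖ * C, fun m => ?_⟩
    rw [map_smul, inr_smul, mul_smul_comm, norm_smul, mul_assoc]
    exact mul_le_mul_of_nonneg_left (hC m) (norm_nonneg c)
  mul_mem' hx _ := hφ.exists_growth_bound_mul hs _ hx
  star_mem' := by
    rintro x ⟨C, hC⟩
    refine ⟨C, fun m => ?_⟩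
    have h_comm : Commute (φ 1 : Unitization ℂ A) (φ x : Unitization ℂ A) := by
      rw [Commute, SemiconjBy, ← inr_mul, ← inr_mul, hφ.map_mul_map_one]
    have h_star : (φ 1 : Unitization ℂ A) ^ m * (φ (star x) : Unitization ℂ A) =
        star ((φ 1 : Unitization ℂ A) ^ m * (φ x : Unitization ℂ A)) := by
      rw [(h_comm.pow_left m).eq, star_mul, star_pow, ← inr_star, ← inr_star, hφ.star_map_one,
        hφ.completelyPositive.map_star]
    rw [h_star, norm_star]
    exact hC m

theorem mem_growthIdeal_of_norm_le {s : ℝ} (hs : 0 < s) {p : F} (hp : IsIdempotentElem p)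
    (hps : ‖φ p‖ ≤ s) : p ∈ hφ.growthIdeal hs := by
  refine ⟨s, fun m => ?_⟩
  rw [hφ.map_one_pow_mul_map hp, mul_comm, ← pow_succ]
  refine (norm_pow_le' _ m.succ_pos).trans ?_
  rw [norm_inr]
  gcongr

theorem norm_map_le_of_mem_growthIdeal {s : ℝ} {hs : 0 < s} {p : F} (hp : IsStarProjection p)
    (hps : p ∈ hφ.growthIdeal hs) : ‖φ p‖ ≤ s := by
  obtain ⟨C, hC⟩ := hps
  by_contra! h_lt
  have hsa : IsSelfAdjoint (φ p : Unitization ℂ A) := by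
    rw [IsSelfAdjoint, ← inr_star, ← hφ.completelyPositive.map_star, hp.isSelfAdjoint.star_eq]
  have h_pow (j : ℕ) : (‖φ p‖ / s) ^ 2 ^ j ≤ C / s := by
    have hj : 2 ^ j - 1 + 1 = 2 ^ j := Nat.sub_add_cancel Nat.one_le_two_pow
    have h := hC (2 ^ j - 1)
    rw [hφ.map_one_pow_mul_map hp.isIdempotentElem, hj, hsa.norm_pow_two_pow, norm_inr] at h
    rw [div_pow, div_le_div_iff₀ (by positivity) hs]
    calc ‖φ p‖ ^ 2 ^ j * s ≤ C * s ^ (2 ^ j - 1) * s := by gcongr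
      _ = C * s ^ 2 ^ j := by rw [mul_assoc, ← pow_succ, hj]
  have h_tendsto : Tendsto (fun j : ℕ => (‖φ p‖ / s) ^ 2 ^ j) atTop atTop :=
    (tendsto_pow_atTop_atTop_of_one_lt ((one_lt_div hs).2 h_lt)).comp
      (tendsto_pow_atTop_atTop_of_one_lt one_lt_two)
  obtain ⟨j, hj⟩ := (h_tendsto.eventually_gt_atTop (C / s)).exists
  exact (h_pow j).not_gt hj

theorem exists_central_isStarProjection_norm_map_le [FiniteDimensional ℂ F] {s : ℝ} (hs : 0 < s) :
    ∃ e : F, IsStarProjection e ∧ (∀ x, e * x = x * e) ∧ ‖φ e‖ ≤ s ∧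
      ∀ p, IsStarProjection p → ‖φ p‖ ≤ s → e * p = p := by
  obtain ⟨e, heK, he, h_comm, h_mul⟩ := exists_isStarProjection_of_mul_mem (hφ.growthIdeal hs)
    fun _ hx y => hφ.exists_growth_bound_mul hs y hx
  exact ⟨e, he, h_comm, hφ.norm_map_le_of_mem_growthIdeal he heK, fun p hp hps =>
    h_mul p (hφ.mem_growthIdeal_of_norm_le hs hp.isIdempotentElem hps)⟩

variable (h_norm : ∀ x, ‖φ x‖ ≤ ‖x‖)

include h_norm

theorem norm_map_mul_sq_le {e : F} (he : IsStarProjection e) (h_comm : ∀ x, e * x = x * e)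
    (u : F) : ‖φ (e * u)‖ ^ 2 ≤ ‖φ e‖ * ‖u‖ ^ 2 := by
  have h_star_mul : star u * e * (e * u) = e * (star u * u) := by
    rw [mul_assoc, ← mul_assoc e e, he.isIdempotentElem.eq, ← mul_assoc, ← h_comm, mul_assoc]
  calc ‖φ (e * u)‖ ^ 2 = ‖φ e * φ (star u * u)‖ := by
        rw [sq, ← CStarRing.norm_star_mul_self, ← hφ.completelyPositive.map_star, hφ.map_mul_map,
          star_mul, he.isSelfAdjoint.star_eq, h_star_mul, ← hφ.map_mul_map]
    _ ≤ ‖φ e‖ * ‖φ (star u * u)‖ := norm_mul_le _ _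
    _ ≤ ‖φ e‖ * ‖star u * u‖ := by gcongr; exact h_norm _
    _ = ‖φ e‖ * ‖u‖ ^ 2 := by rw [CStarRing.norm_star_mul_self, sq]

theorem mul_norm_map_cube_le {a p : F} (hp : IsStarProjection p) {c : ℝ} (hc : 0 ≤ c) {u : F}
    (hap : a * u * p = c • p) : c * ‖φ p‖ ^ 3 ≤ ‖a‖ * ‖φ 1 * φ u‖ := by
  rcases (norm_nonneg (φ p)).eq_or_lt' with h_zero | h_pos
  · rw [h_zero, zero_pow three_ne_zero, mul_zero]
    positivity
  have h_star : star (φ p) = φ p := by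
    rw [← hφ.completelyPositive.map_star, hp.isSelfAdjoint.star_eq]
  have h_one_p := hφ.map_one_mul_map_of_isIdempotentElem hp.isIdempotentElem
  have h_prod : φ a * (φ 1 * φ u) * φ p =
      c • (star (star (φ p) * φ p) * (star (φ p) * φ p)) := by
    calc φ a * (φ 1 * φ u) * φ p = φ 1 * (φ 1 * φ (a * u)) * φ p := by
          rw [← mul_assoc (φ a), hφ.map_mul_map_one, mul_assoc (φ 1), hφ.map_mul_map a]
      _ = φ 1 * (φ 1 * (φ 1 * φ (a * u * p))) := by simp only [mul_assoc, hφ.map_mul_map (a * u)]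
      _ = c • (φ 1 * (φ 1 * (φ 1 * φ p))) := by
          rw [hap, LinearMap.map_smul_of_tower]
          simp only [mul_smul_comm]
      _ = c • (star (star (φ p) * φ p) * (star (φ p) * φ p)) := by
          simp only [star_mul, h_star]
          rw [h_one_p, ← mul_assoc (φ 1) (φ p), h_one_p, ← mul_assoc (φ 1), ← mul_assoc (φ 1),
            h_one_p, mul_assoc]
  refine le_of_mul_le_mul_right ?_ h_pos
  calc c * ‖φ p‖ ^ 3 * ‖φ p‖ = ‖φ a * (φ 1 * φ u) * φ p‖ := by
        rw [h_prod, norm_smul, CStarRing.norm_star_mul_self, CStarRing.norm_star_mul_self,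
          Real.norm_of_nonneg hc]
        ring
    _ ≤ ‖φ a‖ * ‖φ 1 * φ u‖ * ‖φ p‖ := (norm_mul_le _ _).trans (by gcongr; exact norm_mul_le _ _)
    _ ≤ ‖a‖ * ‖φ 1 * φ u‖ * ‖φ p‖ := by gcongr; exact h_norm a

/- Here `z = 1 - e`, where `e` is the largest projection with `‖φ e‖ ≤ s`. The lower bound for `u`
is tested on the projection where `star u * u` attains its norm, on which `φ` is larger than `s`. -/
theorem exists_central_cut [FiniteDimensional ℂ F] {s : ℝ} (hs : 0 < s) :
    ∃ z : F, IsStarProjection z ∧ (∀ x, z * x = x * z) ∧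
      (∀ u, ‖φ ((1 - z) * u)‖ ^ 2 ≤ s * ‖u‖ ^ 2) ∧
      ∀ u, ‖z * u‖ ^ 2 * s ^ 3 ≤ ‖u‖ * ‖φ 1 * φ u‖ := by
  obtain ⟨e, he, h_comm, hes, h_max⟩ := hφ.exists_central_isStarProjection_norm_map_le hs
  have hz : IsStarProjection (1 - e) := he.one_sub
  have h_comm_z (x : F) : (1 - e) * x = x * (1 - e) := by
    rw [sub_mul, mul_sub, one_mul, mul_one, h_comm]
  refine ⟨1 - e, hz, h_comm_z, fun u => ?_, fun u => ?_⟩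
  · rw [sub_sub_cancel]
    exact (hφ.norm_map_mul_sq_le h_norm he h_comm u).trans (by gcongr)
  set z := 1 - e with hz_def
  rcases eq_or_ne (z * u) 0 with h_zero | h_ne
  · rw [h_zero, norm_zero, zero_pow two_ne_zero, zero_mul]
    positivity
  obtain ⟨p, hp, hp_ne, hzp, hup⟩ := exists_isStarProjection_star_mul_mul_eq hz h_comm_z h_ne
  have hsp : s < ‖φ p‖ := by
    by_contra! h
    rw [hz_def, sub_mul, one_mul, h_max p hp h, sub_self] at hzp
    exact hp_ne hzp.symm
  calc ‖z * u‖ ^ 2 * s ^ 3 ≤ ‖z * u‖ ^ 2 * ‖φ p‖ ^ 3 := by gcongr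
    _ ≤ ‖star u * z‖ * ‖φ 1 * φ u‖ := hφ.mul_norm_map_cube_le h_norm hp (sq_nonneg _) hup
    _ ≤ ‖star u‖ * ‖z‖ * ‖φ 1 * φ u‖ := by gcongr; exact norm_mul_le _ _
    _ ≤ ‖star u‖ * 1 * ‖φ 1 * φ u‖ := by gcongr; exact hz.norm_le
    _ = ‖u‖ * ‖φ 1 * φ u‖ := by rw [mul_one, norm_star]

end IsOrderZeroMap

/-! ### Asymptotic bimodule maps -/

section Bimodule

variable {A : Type*} [NonUnitalCStarAlgebra A]

/-- The defect of a completely positive map `f` from being right `A`-linear. It is the value at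
`star d * d`, where `d = x ⊗ y - x y ⊗ 1`, of the positive form `star (a ⊗ b) * (a' ⊗ b') ↦
star b * f (star a * a') * b'` of Stinespring's construction. -/
def moduleDefect (f : A →ₗ[ℂ] A) (x y : A) : A :=
  f (star (x * y) * (x * y)) - f (star (x * y) * x) * y - star y * f (star x * (x * y)) +
    star y * f (star x * x) * y

theorem moduleDefect_add (f g : A →ₗ[ℂ] A) (x y : A) :
    moduleDefect (f + g) x y = moduleDefect f x y + moduleDefect g x y := by
  simp only [moduleDefect, LinearMap.add_apply, add_mul, mul_add]
  abel

theorem tendsto_moduleDefect_zero {Λ : Type*} {l : Filter Λ} {T : Λ → A →ₗ[ℂ] A}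
    (hT : ∀ x, Tendsto (fun i => T i x) l (𝓝 x)) (x y : A) :
    Tendsto (fun i => moduleDefect (T i) x y) l (𝓝 0) := by
  have h_zero : (0 : A) = star (x * y) * (x * y) - star (x * y) * x * y -
      star y * (star x * (x * y)) + star y * (star x * x) * y := by
    simp only [star_mul]
    noncomm_ring
  rw [h_zero]
  exact (((hT _).sub ((hT _).mul_const y)).sub ((hT _).const_mul (star y))).add
    (((hT _).const_mul (star y)).mul_const y)

variable [PartialOrder A] [StarOrderedRing A]

theorem norm_le_sqrt_norm_sum_star_mul_self {κ : Type*} [Fintype κ] (w : κ → A) (k : κ) :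
    ‖w k‖ ≤ √‖∑ k, star (w k) * w k‖ := by
  refine Real.le_sqrt_of_sq_le ?_
  rw [sq, ← CStarRing.norm_star_mul_self]
  exact CStarAlgebra.norm_le_norm_of_nonneg_of_le (star_mul_self_nonneg _)
    (Finset.single_le_sum (f := fun k => star (w k) * w k)
      (fun k _ => star_mul_self_nonneg (w k)) (Finset.mem_univ k))

namespace IsCompletelyPositive

variable {f : A →ₗ[ℂ] A} (hf : IsCompletelyPositive f)

include hf

theorem exists_moduleDefect_eq (x y c : A) :
    ∃ u v : Fin 3 → A, moduleDefect f x y = ∑ k, star (u k) * u k ∧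
      f (star c * c) = ∑ k, star (v k) * v k ∧
      f (star c * (x * y)) - f (star c * x) * y = ∑ k, star (v k) * u k := by
  obtain ⟨N, hN⟩ := hf.exists_sum_star_mul_eq ![x * y, x, c]
  refine ⟨fun k => N k 0 - N k 1 * y, fun k => N k 2, ?_, hN 2 2, ?_⟩
  · have h_expand (k) : star (N k 0 - N k 1 * y) * (N k 0 - N k 1 * y) =
        star (N k 0) * N k 0 - star (N k 0) * N k 1 * y - star y * (star (N k 1) * N k 0)
          + star y * (star (N k 1) * N k 1) * y := by
      simp only [star_sub, star_mul]
      noncomm_ring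
    simp only [h_expand, Finset.sum_add_distrib, Finset.sum_sub_distrib, ← Finset.sum_mul,
      ← Finset.mul_sum, ← hN]
    rfl
  · simp only [mul_sub, ← mul_assoc, Finset.sum_sub_distrib, ← Finset.sum_mul, ← hN]
    simp [mul_assoc]

theorem moduleDefect_nonneg (x y : A) : 0 ≤ moduleDefect f x y := by
  obtain ⟨u, -, h, -⟩ := hf.exists_moduleDefect_eq x y 0
  rw [h]
  exact Finset.sum_nonneg fun k _ => star_mul_self_nonneg _

theorem norm_map_mul_sub_le (x y c : A) :
    ‖f (star c * (x * y)) - f (star c * x) * y‖ ≤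
      3 * (√‖f (star c * c)‖ * √‖moduleDefect f x y‖) := by
  obtain ⟨u, v, h_defect, h_sq, h_sub⟩ := hf.exists_moduleDefect_eq x y c
  rw [h_sub, h_sq, h_defect]
  calc ‖∑ k, star (v k) * u k‖ ≤ ∑ k : Fin 3, ‖star (v k) * u k‖ := norm_sum_le _ _
    _ ≤ ∑ _k : Fin 3, (√‖∑ k, star (v k) * v k‖ * √‖∑ k, star (u k) * u k‖) := by
        refine Finset.sum_le_sum fun k _ => (norm_mul_le _ _).trans ?_
        rw [norm_star]
        gcongr
        exacts [norm_le_sqrt_norm_sum_star_mul_self v k, norm_le_sqrt_norm_sum_star_mul_self u k]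
    _ = 3 * (√‖∑ k, star (v k) * v k‖ * √‖∑ k, star (u k) * u k‖) := by simp

end IsCompletelyPositive

variable {Λ : Type*} {l : Filter Λ} {θ R : Λ → A →ₗ[ℂ] A}
  (hθ : ∀ i, IsCompletelyPositive (θ i)) (hR : ∀ i, IsCompletelyPositive (R i))
  (hid : ∀ x, Tendsto (fun i => (θ i + R i) x) l (𝓝 x))

include hθ hR hid

theorem tendsto_moduleDefect_zero_of_add (x y : A) :
    Tendsto (fun i => moduleDefect (θ i) x y) l (𝓝 0) := by
  refine squeeze_zero_norm (fun i => ?_) (by simpa using (tendsto_moduleDefect_zero hid x y).norm)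
  refine CStarAlgebra.norm_le_norm_of_nonneg_of_le ((hθ i).moduleDefect_nonneg x y) ?_
  rw [moduleDefect_add]
  exact le_add_of_nonneg_right ((hR i).moduleDefect_nonneg x y)

variable (hb : ∀ i x, ‖θ i x‖ ≤ ‖x‖)

include hb

theorem tendsto_map_mul_sub_map_mul (w y : A) :
    Tendsto (fun i => θ i (w * y) - θ i w * y) l (𝓝 0) := by
  have hw : w ∈ Submodule.span ℂ {a : A | 0 ≤ a} := by
    rw [CStarAlgebra.span_nonneg]
    trivial
  induction hw using Submodule.span_induction with
  | mem x hx =>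
    obtain ⟨c, rfl⟩ := exists_eq_star_mul_self hx
    have h_defect := (tendsto_moduleDefect_zero_of_add hθ hR hid c y).norm.sqrt
    refine squeeze_zero_norm (fun i => ?_)
      (by simpa using (h_defect.const_mul √‖star c * c‖).const_mul 3)
    rw [mul_assoc (star c)]
    refine ((hθ i).norm_map_mul_sub_le c y c).trans ?_
    gcongr
    exact hb i _
  | zero => simpa using tendsto_const_nhds
  | add x x' _ _ hx hx' =>
    have h := hx.add hx'
    rw [add_zero] at h
    refine h.congr fun i => ?_
    simp only [add_mul, map_add]
    abel
  | smul c x _ hx =>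
    have h := hx.const_smul c
    rw [smul_zero] at h
    refine h.congr fun i => ?_
    simp only [smul_mul_assoc, map_smul, smul_sub]

theorem tendsto_map_mul_sub_mul_map (w y : A) :
    Tendsto (fun i => θ i (w * y) - w * θ i y) l (𝓝 0) := by
  have h := (tendsto_map_mul_sub_map_mul hθ hR hid hb (star y) (star w)).star
  rw [star_zero] at h
  refine h.congr fun i => ?_
  rw [star_sub, star_mul, ← (hθ i).map_star, ← (hθ i).map_star, star_mul, star_star, star_star]

end Bimodule

/-! ### Comparison of projections over finite-dimensional C*-algebras -/

section PartialIsometry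

variable {G : Type*} [CStarAlgebra G] {p q u x y : G}

theorem isUnit_star_mul_self_add_one_sub [PartialOrder G] [StarOrderedRing G]
    (hp : IsStarProjection p) (hpu : p = x * u) : IsUnit (star u * u + (1 - p)) := by
  set k := ‖star x * x‖
  have hk : 0 < k + 1 := by positivity
  have h_le : p ≤ k • (star u * u) := by
    calc p = star p * p := by rw [hp.isSelfAdjoint.star_eq, hp.isIdempotentElem.eq]
      _ = star u * (star x * x) * u := by rw [hpu, star_mul]; simp only [mul_assoc]
      _ ≤ k • (star u * u) := CStarAlgebra.star_left_conjugate_le_norm_smul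
  have h_one_le : 1 ≤ (k + 1) • (star u * u + (1 - p)) := by
    have hu : 0 ≤ star u * u := star_mul_self_nonneg u
    have hp' : 0 ≤ k • (1 - p) := smul_nonneg (norm_nonneg _) hp.one_sub.nonneg
    rw [← sub_nonneg] at h_le ⊢
    convert add_nonneg (add_nonneg h_le hu) hp' using 1
    module
  have h_unit := CStarAlgebra.isUnit_of_le 1 h_one_le
  rwa [← Units.smul_mk0 hk.ne', isUnit_smul_iff] at h_unit

/- The witness is the polar part `u * (star u * u + (1 - p))^(-1/2)` of `u = q * y * p`. -/
theorem exists_partialIsometry_of_eq_mul (hp : IsStarProjection p) (hq : IsIdempotentElem q)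
    (h : p = x * q * y) : ∃ t : G, star t * t = p ∧ q * t = t := by
  let : PartialOrder G := CStarAlgebra.spectralOrder G
  have : StarOrderedRing G := CStarAlgebra.spectralOrderedRing G
  obtain ⟨u, hu⟩ : ∃ u, u = q * y * p := ⟨_, rfl⟩
  have hqu : q * u = u := by rw [hu, mul_assoc, ← mul_assoc q q, hq.eq]
  have hup : u * p = u := by rw [hu, mul_assoc, hp.isIdempotentElem.eq]
  have hpu : p = x * u := by
    calc p = x * q * y * p := by rw [← h, hp.isIdempotentElem.eq]
      _ = x * u := by rw [hu]; simp only [mul_assoc]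
  have hp_star_u : p * star u = star u := by
    rw [← hp.isSelfAdjoint.star_eq, ← star_mul, hup]
  obtain ⟨V, hV⟩ : ∃ V, V = star u * u + (1 - p) := ⟨_, rfl⟩
  have hV_nonneg : 0 ≤ V := hV ▸ add_nonneg (star_mul_self_nonneg u) hp.one_sub.nonneg
  have hVp : V * p = star u * u := by
    rw [hV, add_mul, mul_assoc, hup, sub_mul, one_mul, hp.isIdempotentElem.eq, sub_self, add_zero]
  have hpV : p * V = star u * u := by
    rw [hV, mul_add, ← mul_assoc, hp_star_u, mul_sub, mul_one, hp.isIdempotentElem.eq, sub_self,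
      add_zero]
  obtain ⟨s, hs⟩ : IsUnit (CFC.sqrt V) :=
    (CFC.isUnit_sqrt_iff V).2 (hV ▸ isUnit_star_mul_self_add_one_sub hp hpu)
  have hs_sq : (s : G) * s = V := by rw [hs, CFC.sqrt_mul_sqrt_self V]
  have hs_comm : Commute p s := by
    rw [hs, CFC.sqrt_eq_cfc]
    exact (Commute.cfc_nnreal (hVp.trans hpV.symm) _).symm
  have hs_star : star s = s := Units.ext <| by
    rw [Units.coe_star, hs, (CFC.sqrt_nonneg V).isSelfAdjoint.star_eq]
  refine ⟨u * ↑s⁻¹, ?_, by rw [← mul_assoc, hqu]⟩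
  calc star (u * ↑s⁻¹) * (u * ↑s⁻¹) = ↑s⁻¹ * (star u * u) * ↑s⁻¹ := by
        rw [star_mul, ← Units.coe_star, star_inv, hs_star]
        simp only [mul_assoc]
    _ = ↑s⁻¹ * (s * (s * p)) * ↑s⁻¹ := by rw [← hVp, ← hs_sq, mul_assoc (s : G)]
    _ = p := by rw [Units.inv_mul_cancel_left, ← hs_comm.eq, Units.mul_inv_cancel_right]

end PartialIsometry

section Rank

variable {n : Type*} [Fintype n] {P Q : Matrix n n ℂ}

theorem matrix_rank_eq_trace_of_isIdempotentElem (hP : IsIdempotentElem P) :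
    (P.rank : ℂ) = P.trace := by
  classical
  have h : IsIdempotentElem (Matrix.toLin' P) := by
    rw [IsIdempotentElem, Module.End.mul_eq_comp, ← Matrix.toLin'_mul, hP.eq]
  rw [← Matrix.trace_toLin'_eq P, (LinearMap.IsIdempotentElem.isProj_range _ h).trace]
  rfl

theorem exists_eq_mul_mul_of_rank_le (h : P.rank ≤ Q.rank) :
    ∃ X Y : Matrix n n ℂ, P = X * Q * Y := by
  classical
  let p := Matrix.toLin' P
  let q := Matrix.toLin' Q
  have h_finrank : Module.finrank ℂ p.range ≤ Module.finrank ℂ q.range := h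
  obtain ⟨f, hf⟩ := finrank_le_iff_exists_linearMap.1 h_finrank
  obtain ⟨g, hg⟩ := q.rangeRestrict.exists_rightInverse_of_surjective q.range_rangeRestrict
  obtain ⟨k, hk⟩ := (q.range.subtype ∘ₗ f).exists_leftInverse_of_injective
    (LinearMap.ker_eq_bot.2 (Subtype.val_injective.comp hf))
  refine ⟨LinearMap.toMatrix' (p.range.subtype ∘ₗ k),
    LinearMap.toMatrix' (g ∘ₗ f ∘ₗ p.rangeRestrict), Matrix.toLin'.injective ?_⟩
  rw [Matrix.toLin'_mul, Matrix.toLin'_mul, Matrix.toLin'_toMatrix', Matrix.toLin'_toMatrix']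
  refine LinearMap.ext fun v => ?_
  have hqg : q (g (f (p.rangeRestrict v))) = f (p.rangeRestrict v) :=
    congrArg Subtype.val (LinearMap.congr_fun hg (f (p.rangeRestrict v)))
  have hkf : k (f (p.rangeRestrict v)) = p.rangeRestrict v :=
    LinearMap.congr_fun hk (p.rangeRestrict v)
  change p v = k (q (g (f (p.rangeRestrict v))))
  rw [hqg, hkf]
  rfl

end Rank

section DiagCopies

variable (κ : Type) [Fintype κ] [DecidableEq κ] {ι : Type} [Fintype ι]

/-- The block diagonal matrix with `κ` copies of a matrix on the diagonal. -/
def diagCopies {B : Type*} [NonUnitalCStarAlgebra B] :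
    CStarMatrix ι ι B →⋆ₙₐ[ℂ] CStarMatrix (κ × ι) (κ × ι) B where
  toFun X := CStarMatrix.ofMatrix fun a b => if a.1 = b.1 then X a.2 b.2 else 0
  map_smul' c X := by
    ext a b
    change (if a.1 = b.1 then c • X a.2 b.2 else 0) = c • (if a.1 = b.1 then X a.2 b.2 else 0)
    split_ifs <;> simp
  map_zero' := by
    ext a b
    change (if a.1 = b.1 then (0 : B) else 0) = 0
    simp
  map_add' X Y := by
    ext a b
    change (if a.1 = b.1 then X a.2 b.2 + Y a.2 b.2 else 0) =
      (if a.1 = b.1 then X a.2 b.2 else 0) + (if a.1 = b.1 then Y a.2 b.2 else 0)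
    split_ifs <;> simp
  map_mul' X Y := by
    ext a b
    change (if a.1 = b.1 then (X * Y) a.2 b.2 else 0) = ∑ c : κ × ι,
      (if a.1 = c.1 then X a.2 c.2 else 0) * (if c.1 = b.1 then Y c.2 b.2 else 0)
    rw [Fintype.sum_prod_type, Finset.sum_eq_single a.1]
    · simp only [if_true]
      split_ifs
      · rfl
      · simp
    · intro k _ hk
      simp [Ne.symm hk]
    · simp
  map_star' X := by
    ext a b
    change (if a.1 = b.1 then star (X b.2 a.2) else 0) =
      star (if b.1 = a.1 then X b.2 a.2 else 0)
    simp only [eq_comm (a := a.1)]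
    split_ifs <;> simp

theorem diagCopies_apply {B : Type*} [NonUnitalCStarAlgebra B] (X : CStarMatrix ι ι B)
    (a b : κ × ι) : diagCopies κ X a b = if a.1 = b.1 then X a.2 b.2 else 0 := rfl

theorem diagCopies_map {B C : Type*} [NonUnitalCStarAlgebra B] [NonUnitalCStarAlgebra C]
    (f : B →ₗ[ℂ] C) (X : CStarMatrix ι ι B) :
    diagCopies κ (X.map f) = (diagCopies κ X).map f := by
  ext a b
  rw [CStarMatrix.map_apply, diagCopies_apply, diagCopies_apply, apply_ite f, map_zero]
  rfl

end DiagCopies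

theorem isSemisimpleRing_of_finiteDimensional (F : Type*) [CStarAlgebra F]
    [FiniteDimensional ℂ F] : IsSemisimpleRing F := by
  have : IsArtinianRing F := IsArtinianRing.of_finite ℂ F
  rw [IsArtinianRing.isSemisimpleRing_iff_jacobson, eq_bot_iff]
  intro x hx
  obtain ⟨n, hn⟩ := IsSemiprimaryRing.isNilpotent (R := F)
  have h_pow : (star x * x) ^ n = 0 := by
    have h := Ideal.pow_mem_pow (Ideal.mul_mem_left _ (star x) hx) n
    rw [hn] at h
    simpa using h
  have h_pow_two : (star x * x) ^ 2 ^ n = 0 := pow_eq_zero_of_le Nat.lt_two_pow_self.le h_pow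
  rw [← norm_eq_zero, (IsSelfAdjoint.star_mul_self x).norm_pow_two_pow,
    pow_eq_zero_iff (by positivity), norm_eq_zero, CStarRing.star_mul_self_eq_zero_iff] at h_pow_two
  simpa using h_pow_two

section Cancellation

variable {F : Type*} [CStarAlgebra F] {ι κ : Type} [Fintype ι] [DecidableEq ι] [Fintype κ]
  [DecidableEq κ]

section MatrixAmplification

variable {d : Type*} [Fintype d] [DecidableEq d] (ρ : F →+* Matrix d d ℂ)

/-- The amplification of a representation of `F` on `ℂᵈ` to matrices over `F`. -/
def matrixAmplification (ι : Type) [Fintype ι] [DecidableEq ι] :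
    CStarMatrix ι ι F →+* Matrix (ι × d) (ι × d) ℂ :=
  ((Matrix.compRingEquiv ι d ℂ).toRingHom.comp ρ.mapMatrix).comp
    CStarMatrix.ofMatrixRingEquiv.symm.toRingHom

theorem matrixAmplification_apply (X : CStarMatrix ι ι F) (a b : ι × d) :
    matrixAmplification ρ ι X a b = ρ (X a.1 b.1) a.2 b.2 := rfl

theorem trace_matrixAmplification_diagCopies (X : CStarMatrix ι ι F) :
    (matrixAmplification ρ (κ × ι) (diagCopies κ X)).trace =
      Fintype.card κ * (matrixAmplification ρ ι X).trace := by
  simp only [Matrix.trace, Matrix.diag, matrixAmplification_apply, Fintype.sum_prod_type,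
    diagCopies_apply, if_true, Finset.sum_const, Finset.card_univ, nsmul_eq_mul]

theorem rank_matrixAmplification_diagCopies {X : CStarMatrix ι ι F} (hX : IsIdempotentElem X) :
    (matrixAmplification ρ (κ × ι) (diagCopies κ X)).rank =
      Fintype.card κ * (matrixAmplification ρ ι X).rank := by
  have h := trace_matrixAmplification_diagCopies (κ := κ) ρ X
  rw [← matrix_rank_eq_trace_of_isIdempotentElem (hX.map _),
    ← matrix_rank_eq_trace_of_isIdempotentElem ((hX.map (diagCopies κ)).map _)] at h
  exact_mod_cast h

theorem rank_matrixAmplification_le [Nonempty κ] {p q : CStarMatrix ι ι F}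
    (hp : IsIdempotentElem p) (hq : IsIdempotentElem q) {S R : CStarMatrix (κ × ι) (κ × ι) F}
    (h : diagCopies κ p = S * diagCopies κ q * R) :
    (matrixAmplification ρ ι p).rank ≤ (matrixAmplification ρ ι q).rank := by
  refine Nat.le_of_mul_le_mul_left ?_ (Fintype.card_pos (α := κ))
  rw [← rank_matrixAmplification_diagCopies ρ hp, ← rank_matrixAmplification_diagCopies ρ hq, h,
    map_mul, map_mul]
  exact (Matrix.rank_mul_le_left _ _).trans (Matrix.rank_mul_le_right _ _)

end MatrixAmplification

theorem exists_eq_mul_mul_of_rank_matrixAmplification_le {κ : Type*} {d : κ → Type*}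
    [∀ i, Fintype (d i)] [∀ i, DecidableEq (d i)] (ρ : F ≃+* ∀ i, Matrix (d i) (d i) ℂ)
    {p q : CStarMatrix ι ι F}
    (h : ∀ i, (matrixAmplification ((Pi.evalRingHom _ i).comp ρ.toRingHom) ι p).rank ≤
      (matrixAmplification ((Pi.evalRingHom _ i).comp ρ.toRingHom) ι q).rank) :
    ∃ x y : CStarMatrix ι ι F, p = x * q * y := by
  choose X Y hXY using fun i => exists_eq_mul_mul_of_rank_le (h i)
  let lift (Z : ∀ i, Matrix (ι × d i) (ι × d i) ℂ) : CStarMatrix ι ι F :=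
    CStarMatrix.ofMatrix fun a b => ρ.symm fun i => Matrix.of fun c e => Z i (a, c) (b, e)
  have h_lift (Z) (i) :
      matrixAmplification ((Pi.evalRingHom _ i).comp ρ.toRingHom) ι (lift Z) = Z i := by
    ext a b
    change ρ (ρ.symm fun i => Matrix.of fun c e => Z i (a.1, c) (b.1, e)) i a.2 b.2 = Z i a b
    rw [RingEquiv.apply_symm_apply]
    rfl
  refine ⟨lift X, lift Y, ?_⟩
  ext a b
  refine ρ.injective ?_
  ext i c e
  have h_eq : matrixAmplification ((Pi.evalRingHom _ i).comp ρ.toRingHom) ι p =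
      matrixAmplification ((Pi.evalRingHom _ i).comp ρ.toRingHom) ι (lift X * q * lift Y) := by
    rw [map_mul, map_mul, h_lift, h_lift, hXY i]
  exact congrFun₂ h_eq (a, c) (b, e)

end Cancellation

theorem exists_partialIsometry_of_diagCopies {F : Type*} [CStarAlgebra F] [FiniteDimensional ℂ F]
    {ι κ : Type} [Fintype ι] [Fintype κ] [DecidableEq κ] [Nonempty κ]
    {p q : CStarMatrix ι ι F} (hp : IsStarProjection p) (hq : IsIdempotentElem q)
    {S R : CStarMatrix (κ × ι) (κ × ι) F} (h : diagCopies κ p = S * diagCopies κ q * R) :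
    ∃ t : CStarMatrix ι ι F, star t * t = p ∧ q * t = t := by
  classical
  have := isSemisimpleRing_of_finiteDimensional F
  obtain ⟨n, d, -, ⟨ρ⟩⟩ := IsSemisimpleRing.exists_algEquiv_pi_matrix_of_isAlgClosed ℂ F
  obtain ⟨x, y, h_eq⟩ := exists_eq_mul_mul_of_rank_matrixAmplification_le ρ.toRingEquiv
    fun i => rank_matrixAmplification_le _ hp.isIdempotentElem hq h
  let : PartialOrder F := CStarAlgebra.spectralOrder F
  have : StarOrderedRing F := CStarAlgebra.spectralOrderedRing F
  exact exists_partialIsometry_of_eq_mul hp hq h_eq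

/-! ### Completely positive contractions -/

theorem tendsto_star_mul_mul_approximateUnit {C : Type*} [NonUnitalCStarAlgebra C]
    [PartialOrder C] [StarOrderedRing C] (c : C) :
    Tendsto (fun e => star e * c * e) (CStarAlgebra.approximateUnit C) (𝓝 c) := by
  have hl := CStarAlgebra.increasingApproximateUnit C
  have h_right := tendsto_iff_norm_sub_tendsto_zero.1 (hl.tendsto_mul_right c)
  have h_left := tendsto_iff_norm_sub_tendsto_zero.1 (hl.tendsto_mul_left c)
  rw [tendsto_iff_norm_sub_tendsto_zero]
  refine squeeze_zero' (Eventually.of_forall fun _ => norm_nonneg _) ?_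
    (by simpa using h_right.add h_left)
  filter_upwards [hl.eventually_norm, hl.eventually_star_eq] with e he he_star
  calc ‖star e * c * e - c‖ = ‖(e * c - c) * e + (c * e - c)‖ := by
        rw [he_star, sub_mul, sub_add_sub_cancel]
    _ ≤ ‖e * c - c‖ * ‖e‖ + ‖c * e - c‖ := norm_add_le_of_le (norm_mul_le _ _) le_rfl
    _ ≤ ‖e * c - c‖ + ‖c * e - c‖ := by gcongr; exact mul_le_of_le_one_right (norm_nonneg _) he

open CStarMatrix WithCStarModule in
theorem cstarMatrix_norm_le_sum_norm_entry {m n A : Type*} [Fintype m] [Fintype n]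
    [NonUnitalCStarAlgebra A] [PartialOrder A] [StarOrderedRing A] (M : CStarMatrix m n A) :
    ‖M‖ ≤ ∑ j, ∑ i, ‖M i j‖ := by
  rw [norm_def]
  refine (toCLM M).opNorm_le_bound (by positivity) fun v => ?_
  simp only [toCLM_apply_eq_sum, Finset.sum_mul]
  refine (pi_norm_le_sum_norm _).trans ?_
  gcongr with i _
  refine (norm_sum_le _ _).trans ?_
  gcongr with j _
  rw [mul_comm ‖M j i‖]
  refine (norm_mul_le _ _).trans ?_
  gcongr
  exact norm_apply_le_norm v j

section DiagConst

variable (ι : Type) {B : Type*} [Fintype ι] [DecidableEq ι] [NonUnitalCStarAlgebra B]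

/-- The diagonal matrix with constant diagonal. -/
def diagConst : B →⋆ₙₐ[ℂ] CStarMatrix ι ι B where
  toFun x := CStarMatrix.ofMatrix fun a b => if a = b then x else 0
  map_smul' c x := by
    ext a b
    change (if a = b then c • x else 0) = c • (if a = b then x else 0)
    split_ifs <;> simp
  map_zero' := by
    ext a b
    change (if a = b then (0 : B) else 0) = 0
    simp
  map_add' x y := by
    ext a b
    change (if a = b then x + y else 0) = (if a = b then x else 0) + (if a = b then y else 0)
    split_ifs <;> simp
  map_mul' x y := by
    ext a b
    change (if a = b then x * y else 0) =
      ∑ c, (if a = c then x else 0) * (if c = b then y else 0)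
    simp
  map_star' x := by
    ext a b
    change (if a = b then star x else 0) = star (if b = a then x else 0)
    simp only [eq_comm (a := a)]
    split_ifs <;> simp

theorem diagConst_apply (x : B) (a b : ι) : diagConst ι x a b = if a = b then x else 0 := rfl

theorem diagConst_map {C : Type*} [NonUnitalCStarAlgebra C] (f : B →ₗ[ℂ] C) (x : B) :
    (diagConst ι x).map f = diagConst ι (f x) := by
  ext a b
  rw [CStarMatrix.map_apply, diagConst_apply, diagConst_apply, apply_ite f, map_zero]

theorem star_diagConst_mul_mul_apply (x : B) (M : CStarMatrix ι ι B) (a b : ι) :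
    (star (diagConst ι x) * M * diagConst ι x) a b = star x * M a b * x := by
  rw [← map_star]
  simp only [CStarMatrix.mul_apply, diagConst_apply, ite_mul, mul_ite, zero_mul, mul_zero,
    Finset.sum_ite_eq, Finset.sum_ite_eq', Finset.mem_univ, if_true]

end DiagConst

/-- Completely positive contractions. -/
structure IsCPContraction {A B : Type*} [NonUnitalCStarAlgebra A] [PartialOrder A]
    [StarOrderedRing A] [NonUnitalCStarAlgebra B] [PartialOrder B] [StarOrderedRing B]
    (f : A →ₗ[ℂ] B) : Prop where
  completelyPositive : IsCompletelyPositive f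
  norm_map_le : ∀ x, ‖f x‖ ≤ ‖x‖

section CPContraction

variable {B C D : Type*} [NonUnitalCStarAlgebra B] [PartialOrder B] [StarOrderedRing B]
  [NonUnitalCStarAlgebra C] [PartialOrder C] [StarOrderedRing C]
  [NonUnitalCStarAlgebra D] [PartialOrder D] [StarOrderedRing D]
  {f : C →ₗ[ℂ] D} {ι : Type}

theorem IsCompletelyPositive.matrixMap_star (hf : IsCompletelyPositive f)
    (M : CStarMatrix ι ι C) : (star M).map f = star (M.map f) := by
  ext a b
  exact hf.map_star _

theorem IsCPContraction.comp {g : B →ₗ[ℂ] C} (hf : IsCPContraction f) (hg : IsCPContraction g) :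
    IsCPContraction (f ∘ₗ g) where
  completelyPositive := hf.completelyPositive.comp hg.completelyPositive
  norm_map_le x := (hf.norm_map_le _).trans (hg.norm_map_le x)

variable [Fintype ι]

theorem IsCompletelyPositive.matrixMap_mono (hf : IsCompletelyPositive f)
    {M N : CStarMatrix ι ι C} (h : M ≤ N) : M.map f ≤ N.map f := by
  rw [← sub_nonneg] at h ⊢
  rw [show N.map f - M.map f = (N - M).map f from (map_sub (CStarMatrix.mapₗ f) N M).symm]
  exact hf ι _ h

theorem IsCPContraction.norm_matrixMap_conj_diagConst_le [DecidableEq ι] (hf : IsCPContraction f)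
    {M : CStarMatrix ι ι C} (hM : 0 ≤ M) {e : C} (he : ‖e‖ ≤ 1) :
    ‖(star (diagConst ι e) * M * diagConst ι e).map f‖ ≤ ‖M‖ := by
  have h_le : star (diagConst ι e) * M * diagConst ι e ≤
      diagConst ι ((‖M‖ : ℂ) • (star e * e)) := by
    rw [map_smul, map_mul, map_star]
    convert CStarAlgebra.star_left_conjugate_le_norm_smul (a := diagConst ι e) (b := M) using 1
    ext a b
    exact Complex.coe_smul _ _
  calc ‖(star (diagConst ι e) * M * diagConst ι e).map f‖
      ≤ ‖diagConst ι (f ((‖M‖ : ℂ) • (star e * e)))‖ := by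
        rw [← diagConst_map]
        exact CStarAlgebra.norm_le_norm_of_nonneg_of_le
          (hf.completelyPositive ι _ (star_left_conjugate_nonneg hM _))
          (hf.completelyPositive.matrixMap_mono h_le)
    _ ≤ ‖(‖M‖ : ℂ) • (star e * e)‖ :=
        (NonUnitalStarAlgHom.norm_apply_le _ _).trans (hf.norm_map_le _)
    _ = ‖M‖ * (‖e‖ * ‖e‖) := by
        rw [norm_smul, Complex.norm_real, norm_norm, CStarRing.norm_star_mul_self]
    _ ≤ ‖M‖ := mul_le_of_le_one_right (norm_nonneg _) (mul_le_one₀ he (norm_nonneg _) he)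

theorem IsCPContraction.norm_matrixMap_le_of_nonneg (hf : IsCPContraction f)
    {M : CStarMatrix ι ι C} (hM : 0 ≤ M) : ‖M.map f‖ ≤ ‖M‖ := by
  classical
  have hl := CStarAlgebra.increasingApproximateUnit C
  have := hl.neBot
  have h_cont : Continuous f :=
    AddMonoidHomClass.continuous_of_bound f 1 (by simpa using hf.norm_map_le)
  have h_tendsto : Tendsto (fun e => (star (diagConst ι e) * M * diagConst ι e).map f)
      (CStarAlgebra.approximateUnit C) (𝓝 (M.map f)) := by
    rw [CuntzLE.tendsto_iff]
    intro a b
    simp only [CStarMatrix.map_apply, star_diagConst_mul_mul_apply]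
    exact (h_cont.tendsto _).comp (tendsto_star_mul_mul_approximateUnit (M a b))
  refine le_of_tendsto h_tendsto.norm ?_
  filter_upwards [hl.eventually_norm] with e he
  exact hf.norm_matrixMap_conj_diagConst_le hM he

/- The sharp constant is `1`; splitting `M` into four positive elements gives `4` at once. -/
theorem IsCPContraction.norm_matrixMap_le (hf : IsCPContraction f) (M : CStarMatrix ι ι C) :
    ‖M.map f‖ ≤ 4 * ‖M‖ := by
  obtain ⟨x, hx, h_norm, h_sum⟩ := CStarAlgebra.exists_sum_four_nonneg M
  calc ‖M.map f‖ = ‖∑ i : Fin 4, Complex.I ^ (i : ℕ) • (x i).map f‖ := by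
        conv_lhs => rw [h_sum]
        change ‖CStarMatrix.mapₗ f _‖ =
          ‖∑ i : Fin 4, Complex.I ^ (i : ℕ) • CStarMatrix.mapₗ f (x i)‖
        simp only [map_sum, map_smul]
    _ ≤ ∑ i : Fin 4, ‖Complex.I ^ (i : ℕ) • (x i).map f‖ := norm_sum_le _ _
    _ ≤ ∑ _i : Fin 4, ‖M‖ := by
        refine Finset.sum_le_sum fun i _ => ?_
        rw [norm_smul, norm_pow, Complex.norm_I, one_pow, one_mul]
        exact (hf.norm_matrixMap_le_of_nonneg (hx i)).trans (h_norm i)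
    _ = 4 * ‖M‖ := by simp

end CPContraction

section PowFour

variable {η t : ℝ}

theorem sqrt_div_sq_le (hη : 0 < η) (ht : 0 ≤ t) : √t / (t + η) ^ 2 ≤ 1 / (η * √η) := by
  have h_amgm : √η * √t ≤ t + η := by
    nlinarith [sq_nonneg (√t - √η), Real.sq_sqrt ht, Real.sq_sqrt hη.le]
  rw [div_le_div_iff₀ (by positivity) (by positivity)]
  calc √t * (η * √η) = η * (√η * √t) := by ring
    _ ≤ (t + η) * (t + η) := by gcongr; linarith
    _ = 1 * (t + η) ^ 2 := by ring

theorem abs_sub_sqrt_div_sq_mul_le (hη : 0 < η) (ht : 0 ≤ t) :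
    |t - √t / (t + η) ^ 2 * (t * t * (t * t)) * (√t / (t + η) ^ 2)| ≤ 4 * η := by
  have h_pos : 0 < t + η := by positivity
  obtain ⟨w, hw⟩ : ∃ w, w = t / (t + η) := ⟨_, rfl⟩
  have hw0 : 0 ≤ w := hw ▸ by positivity
  have hw1 : w ≤ 1 := by rw [hw, div_le_one h_pos]; linarith
  have htw : t * (1 - w) = w * η := by rw [hw]; field_simp; ring
  have h_eq : t - √t / (t + η) ^ 2 * (t * t * (t * t)) * (√t / (t + η) ^ 2) =
      t * (1 - w) * ((1 + w) * (1 + w ^ 2)) := by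
    rw [hw]
    field_simp
    rw [Real.sq_sqrt ht]
    ring
  rw [h_eq, htw, abs_of_nonneg (by positivity)]
  calc w * η * ((1 + w) * (1 + w ^ 2)) ≤ 1 * η * ((1 + 1) * (1 + 1 ^ 2)) := by gcongr
    _ = 4 * η := by ring

variable {B : Type*} [NonUnitalCStarAlgebra B]

theorem cfcₙ_sub_mul_pow_four_mul {E : B} (hE : IsSelfAdjoint E) {g : ℝ → ℝ}
    (hg : ContinuousOn g (quasispectrum ℝ E)) (hg0 : g 0 = 0) :
    cfcₙ (fun t => t - g t * (t * t * (t * t)) * g t) E =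
      E - cfcₙ g E * (E * E * (E * E)) * cfcₙ g E := by
  have h_id : cfcₙ (fun t : ℝ => t) E = E := cfcₙ_id' ℝ E
  have h_pow : cfcₙ (fun t : ℝ => t * t * (t * t)) E = E * E * (E * E) := by
    rw [cfcₙ_mul (fun t : ℝ => t * t) (fun t : ℝ => t * t) E, cfcₙ_mul (fun t : ℝ => t)
      (fun t : ℝ => t) E, h_id]
  rw [cfcₙ_sub (fun t : ℝ => t) (fun t => g t * (t * t * (t * t)) * g t) E (by fun_prop)
      (by simp) ((hg.mul (by fun_prop)).mul hg) (by simp),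
    cfcₙ_mul (fun t => g t * (t * t * (t * t))) g E (hg.mul (by fun_prop)) (by simp) hg hg0,
    cfcₙ_mul g (fun t : ℝ => t * t * (t * t)) E hg hg0 (by fun_prop) (by simp), h_pow, h_id]

/- The witness is `d = g(E)` with `g(t) = √t / (t + δ / 4)²`. -/
theorem exists_approx_conj_pow_four (B : Type*) [NonUnitalCStarAlgebra B] [PartialOrder B]
    [StarOrderedRing B] {δ : ℝ} (hδ : 0 < δ) :
    ∃ D : ℝ, 0 ≤ D ∧ ∀ E : B, 0 ≤ E →
      ∃ d : B, IsSelfAdjoint d ∧ ‖d‖ ≤ D ∧ ‖E - d * (E * E * (E * E)) * d‖ ≤ δ := by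
  obtain ⟨η, hη⟩ : ∃ η, η = δ / 4 := ⟨_, rfl⟩
  have hη_pos : 0 < η := by rw [hη]; positivity
  refine ⟨1 / (η * √η), by positivity, fun E hE => ?_⟩
  have h_nonneg {t : ℝ} (ht : t ∈ quasispectrum ℝ E) : 0 ≤ t :=
    quasispectrum_nonneg_of_nonneg E hE t ht
  let g : ℝ → ℝ := fun t => √t / (t + η) ^ 2
  have hg : ContinuousOn g (quasispectrum ℝ E) := by
    refine ContinuousOn.div (by fun_prop) (by fun_prop) fun t ht => ?_
    have := h_nonneg ht
    positivity
  refine ⟨cfcₙ g E, cfcₙ_predicate g E, norm_cfcₙ_le fun t ht => ?_, ?_⟩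
  · have ht0 := h_nonneg ht
    rw [Real.norm_of_nonneg (by positivity)]
    exact sqrt_div_sq_le hη_pos ht0
  · rw [← cfcₙ_sub_mul_pow_four_mul (.of_nonneg hE) hg (by simp [g])]
    refine norm_cfcₙ_le fun t ht => ?_
    exact (abs_sub_sqrt_div_sq_mul_le hη_pos (h_nonneg ht)).trans_eq (by rw [hη]; ring)

end PowFour

/-! ### Comparison through a single order zero factorization -/

namespace IsSpectralTruncation

variable {H : Type*} [CStarAlgebra H] {X p y : H} {δ : ℝ}

theorem map {K : Type*} [CStarAlgebra K] (h : IsSpectralTruncation δ X p y) (f : H →⋆ₙₐ[ℂ] K) :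
    IsSpectralTruncation δ (f X) (f p) (f y) where
  isStarProjection := h.isStarProjection.map f
  isSelfAdjoint_inv := h.isSelfAdjoint_inv.map f
  mul_inv := by rw [← map_mul, h.mul_inv]
  norm_inv_le := (NonUnitalStarAlgHom.norm_apply_le f y).trans h.norm_inv_le
  norm_sub_le := by
    rw [← map_mul, ← map_sub]
    exact (NonUnitalStarAlgHom.norm_apply_le f _).trans h.norm_sub_le

theorem norm_sub_conj_lt_one (h : IsSpectralTruncation δ X p y) (hX : IsSelfAdjoint X)
    (hδ : 0 < δ) {L T : H} (hL : ‖X - L‖ ≤ δ / 4) (hT : ‖X * L * X - T‖ ≤ δ ^ 3 / 2) :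
    ‖p - y * T * (y * y)‖ < 1 := by
  have h_eq : p - y * T * (y * y) = p * (X - L) * p * y + y * (X * L * X - T) * (y * y) := by
    have h_first : p * (X - L) * p * y = p - y * (X * L * X) * (y * y) := by
      calc p * (X - L) * p * y = (y * X) * (X - L) * (X * y) * y := by
            rw [h.inv_mul hX, h.mul_inv]
        _ = y * (X * X * X) * (y * y) - y * (X * L * X) * (y * y) := by noncomm_ring
        _ = p - y * (X * L * X) * (y * y) := by rw [h.inv_mul_cube_mul hX]
    rw [h_first, mul_sub, sub_mul, sub_add_sub_cancel]
  have hp : ‖p‖ ≤ 1 := h.isStarProjection.norm_le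
  have hy : ‖y‖ ≤ δ⁻¹ := h.norm_inv_le
  calc ‖p - y * T * (y * y)‖
      ≤ ‖p * (X - L) * p * y‖ + ‖y * (X * L * X - T) * (y * y)‖ := h_eq ▸ norm_add_le _ _
    _ ≤ ‖p‖ * ‖X - L‖ * ‖p‖ * ‖y‖ + ‖y‖ * ‖X * L * X - T‖ * (‖y‖ * ‖y‖) := by
        gcongr
        · exact norm_mul_le_of_le (norm_mul_le_of_le (norm_mul_le _ _) le_rfl) le_rfl
        · exact norm_mul_le_of_le (norm_mul_le _ _) (norm_mul_le _ _)
    _ ≤ 1 * (δ / 4) * 1 * δ⁻¹ + δ⁻¹ * (δ ^ 3 / 2) * (δ⁻¹ * δ⁻¹) := by gcongr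
    _ < 1 := by
        field_simp
        norm_num

theorem exists_eq_mul_mul (h : IsSpectralTruncation δ X p y) (hX : IsSelfAdjoint X)
    (hδ : 0 < δ) {L T : H} (hL : ‖X - L‖ ≤ δ / 4) (hT : ‖X * L * X - T‖ ≤ δ ^ 3 / 2) :
    ∃ S R : H, p = S * T * R := by
  obtain ⟨R, hR⟩ :=
    (isUnit_one_sub_of_norm_lt_one (h.norm_sub_conj_lt_one hX hδ hL hT)).exists_right_inv
  refine ⟨p * y, y * y * R, ?_⟩
  calc p = p * (1 - (p - y * T * (y * y))) * R := by rw [mul_assoc, hR, mul_one]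
    _ = p * (y * T * (y * y)) * R := by
        rw [mul_sub, mul_sub, mul_one, h.isStarProjection.isIdempotentElem.eq, sub_sub_cancel]
    _ = p * y * T * (y * y * R) := by simp only [mul_assoc]

theorem conj_mul_mul_eq_pow_four {Y q z t : H} {η : ℝ} (h : IsSpectralTruncation δ X p y)
    (hX : IsSelfAdjoint X) (hz : IsSpectralTruncation η Y q z) (hY : IsSelfAdjoint Y)
    (htp : star t * t = p) (hqt : q * t = t) :
    star (z * t * X * X) * (Y * Y) * (z * t * X * X) = X * p * (X * p * (X * p)) * (X * p) := by
  have h_comm : Commute X p := h.commute hX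
  have h_sq : X * p * (X * p) = X * X * p := by
    rw [h_comm.symm.mul_mul_mul_comm, h.isStarProjection.isIdempotentElem.eq]
  calc star (z * t * X * X) * (Y * Y) * (z * t * X * X)
      = X * X * star t * (z * Y) * (Y * z) * t * X * X := by
        simp only [star_mul, hX.star_eq, hz.isSelfAdjoint_inv.star_eq, mul_assoc]
    _ = X * X * star t * (q * (q * t)) * X * X := by
        rw [hz.inv_mul hY, hz.mul_inv]
        simp only [mul_assoc]
    _ = X * X * (p * p) * (X * X) := by
        rw [hqt, hqt, h.isStarProjection.isIdempotentElem.eq, ← htp]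
        simp only [mul_assoc]
    _ = (X * X * p) * (p * (X * X)) := by simp only [mul_assoc]
    _ = X * p * (X * p * (X * p)) * (X * p) := by
        rw [← (h_comm.mul_left h_comm).eq, ← h_sq]
        simp only [mul_assoc]

end IsSpectralTruncation

theorem norm_mul_mul_sub_mul_mul_le {R : Type*} [NonUnitalNormedRing R] (X L V U B Q W : R) :
    ‖X * L * X - V * Q * W‖ ≤
      ‖X * L - V * U‖ * ‖X‖ + ‖V‖ * ‖B * W - U * X‖ + ‖V‖ * ‖B - Q‖ * ‖W‖ := by
  have h_eq : X * L * X - V * Q * W =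
      (X * L - V * U) * X - V * (B * W - U * X) + V * (B - Q) * W := by
    noncomm_ring
  rw [h_eq]
  exact norm_add_le_of_le (norm_sub_le_of_le (norm_mul_le _ _) (norm_mul_le _ _))
    (norm_mul_le_of_le (norm_mul_le _ _) le_rfl)

/-- The defect of associativity of `ψ` on a product of three elements. It vanishes when `ψ` is a
homomorphism, but also when `ψ` is the product of a homomorphism and a central element. -/
def assocDefect {A G : Type*} [NonUnitalCStarAlgebra A] [NonUnitalCStarAlgebra G]
    (ψ : A →ₗ[ℂ] G) (x y w : A) : G :=
  ψ x * ψ (y * w) - ψ (x * y) * ψ w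

theorem exists_pos_mul_le (K : ℝ) {c : ℝ} (hc : 0 < c) : ∃ η : ℝ, 0 < η ∧ K * η ≤ c := by
  refine ⟨c / (|K| + 1), by positivity, ?_⟩
  rw [mul_div_assoc', div_le_iff₀ (by positivity)]
  nlinarith [le_abs_self K, abs_nonneg K]

section OrderZeroMatrix

variable {F B : Type*} [CStarAlgebra F] [PartialOrder F] [StarOrderedRing F]
  [NonUnitalCStarAlgebra B] [PartialOrder B] [StarOrderedRing B] {φ : F →ₗ[ℂ] B}
  {ι : Type} [Fintype ι] [DecidableEq ι]

theorem IsOrderZeroMap.matrixMap_mul_matrixMap (hφ : IsOrderZeroMap φ)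
    (X Y : CStarMatrix ι ι F) : X.map φ * Y.map φ = diagConst ι (φ 1) * (X * Y).map φ := by
  ext a b
  simp only [CStarMatrix.mul_apply, CStarMatrix.map_apply, diagConst_apply, ite_mul, zero_mul,
    Finset.sum_ite_eq, Finset.mem_univ, if_true]
  rw [map_sum, Finset.mul_sum]
  exact Finset.sum_congr rfl fun c _ => hφ.map_mul_map _ _

theorem IsOrderZeroMap.matrixMap_mul_four (hφ : IsOrderZeroMap φ)
    (X Y Z W : CStarMatrix ι ι F) :
    X.map φ * (Y.map φ * Z.map φ) * W.map φ = diagConst ι (φ 1) *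
      (diagConst ι (φ 1) * (diagConst ι (φ 1) * (X * (Y * Z) * W).map φ)) := by
  rw [← mul_assoc (X.map φ), hφ.matrixMap_mul_matrixMap X Y, mul_assoc (diagConst ι (φ 1)),
    hφ.matrixMap_mul_matrixMap (X * Y) Z, mul_assoc, mul_assoc,
    hφ.matrixMap_mul_matrixMap (X * Y * Z) W, mul_assoc X Y Z]

/- Both sides are `φ 1` cubed times the image of one and the same element: order zero maps have
no multiplicative domain to speak of, but they respect equalities between products of four. -/
theorem IsOrderZeroMap.exists_conj_eq_pow_four (hφ : IsOrderZeroMap φ)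
    (hφ_norm : ∀ x, ‖φ x‖ ≤ ‖x‖) {X p y Y q z t : CStarMatrix ι ι F} {δ η : ℝ}
    (h : IsSpectralTruncation δ X p y) (hX : IsSelfAdjoint X)
    (hz : IsSpectralTruncation η Y q z) (hY : IsSelfAdjoint Y)
    (htp : star t * t = p) (hqt : q * t = t) :
    ∃ r : CStarMatrix ι ι B, ‖r‖ ≤ 4 * (η⁻¹ * ‖X‖ * ‖X‖) ∧
      (X * p).map φ * (X * p).map φ * ((X * p).map φ * (X * p).map φ) =
        star r * (Y.map φ * Y.map φ) * r := by
  have hφ_cpc : IsCPContraction φ := ⟨hφ.completelyPositive, hφ_norm⟩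
  have ht : ‖t‖ ≤ 1 := by
    rw [← sq_le_one_iff₀ (norm_nonneg t), sq, ← CStarRing.norm_star_mul_self, htp]
    exact h.isStarProjection.norm_le
  refine ⟨(z * t * X * X).map φ, (hφ_cpc.norm_matrixMap_le _).trans ?_, ?_⟩
  · gcongr
    refine norm_mul_le_of_le (norm_mul_le_of_le ?_ le_rfl) le_rfl
    exact (norm_mul_le_of_le hz.norm_inv_le ht).trans_eq (mul_one _)
  · rw [← hφ.completelyPositive.matrixMap_star, hφ.matrixMap_mul_four,
      h.conj_mul_mul_eq_pow_four hX hz hY htp hqt, ← hφ.matrixMap_mul_four]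
    simp only [mul_assoc]

end OrderZeroMatrix

theorem IsCPContraction.norm_matrixMap_mul_mul_sub_le {A G : Type*} [NonUnitalCStarAlgebra A]
    [PartialOrder A] [StarOrderedRing A] [NonUnitalCStarAlgebra G] [PartialOrder G]
    [StarOrderedRing G] {ι : Type} [Fintype ι] {ψ : A →ₗ[ℂ] G} (hψ : IsCPContraction ψ)
    {M N v w : CStarMatrix ι ι A} {Q : CStarMatrix ι ι G} {η : ℝ}
    (h₁ : ‖assocDefect (CStarMatrix.mapₗ ψ) M w (N * v)‖ ≤ η)
    (h₂ : ‖assocDefect (CStarMatrix.mapₗ ψ) N v M‖ ≤ η) (hQ : ‖N.map ψ - Q‖ ≤ η) :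
    ‖M.map ψ * (w * (N * v)).map ψ * M.map ψ - (M * w).map ψ * Q * (v * M).map ψ‖ ≤
      (4 * ‖M‖ + 4 * ‖M * w‖ + 4 * ‖M * w‖ * (4 * ‖v * M‖)) * η := by
  have hη : 0 ≤ η := (norm_nonneg _).trans hQ
  calc ‖M.map ψ * (w * (N * v)).map ψ * M.map ψ - (M * w).map ψ * Q * (v * M).map ψ‖
      ≤ η * ‖M.map ψ‖ + ‖(M * w).map ψ‖ * η + ‖(M * w).map ψ‖ * η * ‖(v * M).map ψ‖ := by
        refine (norm_mul_mul_sub_mul_mul_le _ _ _ ((N * v).map ψ) (N.map ψ) _ _).trans ?_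
        gcongr
        exacts [h₁, h₂]
    _ ≤ η * (4 * ‖M‖) + 4 * ‖M * w‖ * η + 4 * ‖M * w‖ * η * (4 * ‖v * M‖) := by
        gcongr <;> exact hψ.norm_matrixMap_le _
    _ = (4 * ‖M‖ + 4 * ‖M * w‖ + 4 * ‖M * w‖ * (4 * ‖v * M‖)) * η := by ring

/-- A factorization `A → F → A` through a unital finite-dimensional C*-algebra `F` of a completely
positive contraction into a completely positive contraction and an order zero contraction. -/
structure OrderZeroFactorization (A : Type u) [NonUnitalCStarAlgebra A] [PartialOrder A]
    [StarOrderedRing A] : Type (u + 1) where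
  carrier : Type u
  [cstarAlgebra : CStarAlgebra carrier]
  [partialOrder : PartialOrder carrier]
  [starOrderedRing : StarOrderedRing carrier]
  [finiteDimensional : FiniteDimensional ℂ carrier]
  down : A →ₗ[ℂ] carrier
  up : carrier →ₗ[ℂ] A
  down_isCPContraction : IsCPContraction down
  up_isOrderZeroMap : IsOrderZeroMap up
  norm_up_le : ∀ x, ‖up x‖ ≤ ‖x‖

namespace OrderZeroFactorization

attribute [instance] cstarAlgebra partialOrder starOrderedRing finiteDimensional

variable {A : Type u} [NonUnitalCStarAlgebra A] [PartialOrder A] [StarOrderedRing A]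

/-- The map `A → A` that is being factored. -/
def toMap (f : OrderZeroFactorization A) : A →ₗ[ℂ] A := f.up ∘ₗ f.down

theorem up_isCPContraction (f : OrderZeroFactorization A) : IsCPContraction f.up :=
  ⟨f.up_isOrderZeroMap.completelyPositive, f.norm_up_le⟩

theorem toMap_isCPContraction (f : OrderZeroFactorization A) : IsCPContraction f.toMap :=
  f.up_isCPContraction.comp f.down_isCPContraction

end OrderZeroFactorization

theorem norm_sub_conj_le_of_pow_four_eq {B : Type*} [NonUnitalCStarAlgebra B]
    {x E d r s b θb : B} (hE : E * E * (E * E) = star r * (θb * θb) * r)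
    (hd : IsSelfAdjoint d) (hs : IsSelfAdjoint s) :
    ‖x - star (s * r * d) * b * (s * r * d)‖ ≤ ‖x - E‖ + ‖E - d * (E * E * (E * E)) * d‖ +
      ‖d‖ * ‖r‖ * ‖θb * θb - s * b * s‖ * (‖r‖ * ‖d‖) := by
  have h_eq : x - star (s * r * d) * b * (s * r * d) = (x - E) +
      (E - d * (E * E * (E * E)) * d) + d * star r * (θb * θb - s * b * s) * (r * d) := by
    rw [hE]
    simp only [star_mul, hs.star_eq, hd.star_eq, mul_sub, sub_mul, mul_assoc]
    abel
  rw [h_eq]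
  refine norm_add₃_le.trans (add_le_add le_rfl ?_)
  refine norm_mul_le_of_le (norm_mul_le_of_le ?_ le_rfl) (norm_mul_le _ _)
  exact (norm_mul_le _ _).trans_eq (by rw [norm_star])

section SingleFactorization

variable {A : Type u} [NonUnitalCStarAlgebra A] [PartialOrder A] [StarOrderedRing A]
  {ι κ : Type} [Fintype ι] [Fintype κ] [DecidableEq κ]
  {a b s : CStarMatrix ι ι A} {v : CStarMatrix (κ × ι) (κ × ι) A} {δ : ℝ}

theorem OrderZeroFactorization.norm_matrixMap_toMap_sub_le [DecidableEq ι]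
    (f : OrderZeroFactorization A) (ha : 0 ≤ a) {p y : CStarMatrix ι ι f.carrier}
    (h : IsSpectralTruncation δ (a.map f.down) p y) :
    ‖a.map f.toMap - (a.map f.down * p).map f.up‖ ≤ δ := by
  have hX : 0 ≤ a.map f.down := f.down_isCPContraction.completelyPositive ι a ha
  rw [show a.map f.toMap - (a.map f.down * p).map f.up = (a.map f.down - a.map f.down * p).map f.up
    from (map_sub (CStarMatrix.mapₗ f.up) (a.map f.down) _).symm]
  exact (f.up_isCPContraction.norm_matrixMap_le_of_nonneg (h.sub_mul_nonneg hX)).trans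
    h.norm_sub_le

theorem exists_pos_forall_exists_partialIsometry [DecidableEq ι] [Nonempty κ] (hδ : 0 < δ)
    (ha : IsSelfAdjoint a) (hv : ‖diagCopies κ a - star v * diagCopies κ b * v‖ ≤ δ / 16) :
    ∃ η : ℝ, 0 < η ∧ ∀ (G : Type u) [CStarAlgebra G] [PartialOrder G] [StarOrderedRing G]
      [FiniteDimensional ℂ G] (ψ : A →ₗ[ℂ] G), IsCPContraction ψ →
      ‖assocDefect (CStarMatrix.mapₗ ψ) (diagCopies κ a) (star v) (diagCopies κ b * v)‖ ≤ η →
      ‖assocDefect (CStarMatrix.mapₗ ψ) (diagCopies κ b) v (diagCopies κ a)‖ ≤ η →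
      ∀ p y q, IsSpectralTruncation δ (a.map ψ) p y → IsStarProjection q →
        ‖b.map ψ - b.map ψ * q‖ ≤ η → ∃ t, star t * t = p ∧ q * t = t := by
  obtain ⟨η, hη, hη_le⟩ := exists_pos_mul_le (c := δ ^ 3 / 2)
    (4 * ‖diagCopies κ a‖ + 4 * ‖diagCopies κ a * star v‖ +
      4 * ‖diagCopies κ a * star v‖ * (4 * ‖v * diagCopies κ a‖)) (by positivity)
  refine ⟨η, hη, fun G _ _ _ _ ψ hψ h_defect₁ h_defect₂ p y q hp hq hbq => ?_⟩
  have hX : IsSelfAdjoint (diagCopies κ (a.map ψ)) := by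
    have h_map : IsSelfAdjoint (a.map ψ) := by
      rw [IsSelfAdjoint, ← hψ.completelyPositive.matrixMap_star, ha.star_eq]
    exact h_map.map (diagCopies (ι := ι) (B := G) κ)
  have hL : ‖diagCopies κ (a.map ψ) - (star v * (diagCopies κ b * v)).map ψ‖ ≤ δ / 4 := by
    have h := (hψ.norm_matrixMap_le _).trans (mul_le_mul_of_nonneg_left hv zero_le_four)
    rw [diagCopies_map, ← mul_assoc]
    refine le_of_eq_of_le (congrArg norm ?_) (h.trans_eq (by ring))
    exact (map_sub (CStarMatrix.mapₗ ψ) _ _).symm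
  have hT : ‖diagCopies κ (a.map ψ) * (star v * (diagCopies κ b * v)).map ψ *
      diagCopies κ (a.map ψ) - (diagCopies κ a * star v).map ψ *
      diagCopies κ (b.map ψ * q) * (v * diagCopies κ a).map ψ‖ ≤ δ ^ 3 / 2 := by
    rw [diagCopies_map]
    refine (hψ.norm_matrixMap_mul_mul_sub_le h_defect₁ h_defect₂ ?_).trans hη_le
    rw [← diagCopies_map, ← map_sub]
    exact (NonUnitalStarAlgHom.norm_apply_le (diagCopies (ι := ι) (B := G) κ) _).trans hbq
  obtain ⟨S, R, h_factor⟩ := (hp.map (diagCopies κ)).exists_eq_mul_mul hX hδ hL hT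
  refine exists_partialIsometry_of_diagCopies (κ := κ) hp.isStarProjection hq.isIdempotentElem
    (S := S * (diagCopies κ a * star v).map ψ * diagCopies κ (b.map ψ))
    (R := (v * diagCopies κ a).map ψ * R) (h_factor.trans ?_)
  rw [map_mul (diagCopies κ) (b.map ψ) q]
  simp only [mul_assoc]

theorem exists_pos_forall_exists_conj_approx [Nonempty κ] (hδ : 0 < δ) (ha : 0 ≤ a)
    (hb : 0 ≤ b) (hs : IsSelfAdjoint s)
    (hv : ‖diagCopies κ a - star v * diagCopies κ b * v‖ ≤ δ / 16) :
    ∃ η : ℝ, 0 < η ∧ ∀ f : OrderZeroFactorization A,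
      ‖assocDefect (CStarMatrix.mapₗ f.down) (diagCopies κ a) (star v) (diagCopies κ b * v)‖ ≤ η →
      ‖assocDefect (CStarMatrix.mapₗ f.down) (diagCopies κ b) v (diagCopies κ a)‖ ≤ η →
      ‖b.map f.toMap * b.map f.toMap - s.map f.toMap * b * s.map f.toMap‖ ≤ η →
      ∃ x : CStarMatrix ι ι A, ‖a.map f.toMap - star x * b * x‖ ≤ 3 * δ := by
  classical
  obtain ⟨D, hD_nonneg, hD⟩ := exists_approx_conj_pow_four (B := CStarMatrix ι ι A) hδ
  obtain ⟨η₁, hη₁, h_compare⟩ := exists_pos_forall_exists_partialIsometry hδ (.of_nonneg ha) hv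
  let K := 4 * (η₁⁻¹ * ‖a‖ * ‖a‖)
  obtain ⟨η₂, hη₂, hη₂_le⟩ := exists_pos_mul_le (D * K * (K * D)) hδ
  refine ⟨min η₁ η₂, lt_min hη₁ hη₂, fun f h_defect₁ h_defect₂ h_sq => ?_⟩
  have : FiniteDimensional ℂ (CStarMatrix ι ι f.carrier) :=
    inferInstanceAs (FiniteDimensional ℂ (Matrix ι ι f.carrier))
  have hX : 0 ≤ a.map f.down := f.down_isCPContraction.completelyPositive ι a ha
  have hY : 0 ≤ b.map f.down := f.down_isCPContraction.completelyPositive ι b hb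
  obtain ⟨p, y, hp⟩ := exists_isSpectralTruncation hX hδ
  obtain ⟨q, z, hq⟩ := exists_isSpectralTruncation hY hη₁
  obtain ⟨t, htp, hqt⟩ := h_compare f.carrier f.down f.down_isCPContraction
    (h_defect₁.trans (min_le_left _ _)) (h_defect₂.trans (min_le_left _ _)) p y q hp
    hq.isStarProjection hq.norm_sub_le
  obtain ⟨r, hr, h_pow⟩ := f.up_isOrderZeroMap.exists_conj_eq_pow_four f.norm_up_le hp
    (.of_nonneg hX) hq (.of_nonneg hY) htp hqt
  have hrK : ‖r‖ ≤ K := by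
    refine hr.trans ?_
    have := f.down_isCPContraction.norm_matrixMap_le_of_nonneg ha
    simp only [K]
    gcongr
  obtain ⟨d, hd, hdD, h_root⟩ :=
    hD _ (f.up_isOrderZeroMap.completelyPositive ι _ (hp.mul_nonneg hX))
  have hsθ : IsSelfAdjoint (s.map f.toMap) := by
    rw [IsSelfAdjoint, ← f.toMap_isCPContraction.completelyPositive.matrixMap_star, hs.star_eq]
  refine ⟨s.map f.toMap * r * d, (norm_sub_conj_le_of_pow_four_eq h_pow hd hsθ).trans ?_⟩
  calc _ ≤ δ + δ + D * K * η₂ * (K * D) := by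
        gcongr
        · exact f.norm_matrixMap_toMap_sub_le ha hp
        · exact h_sq.trans (min_le_right _ _)
    _ ≤ 3 * δ := by linarith

end SingleFactorization

/-! ### Cutting order zero factorizations -/

section AssocDefect

variable {A F : Type*} [NonUnitalCStarAlgebra A]

theorem norm_assocDefect_le [NonUnitalCStarAlgebra F] {ψ : A →ₗ[ℂ] F}
    (hψ : ∀ x, ‖ψ x‖ ≤ ‖x‖) (x y w : A) :
    ‖assocDefect ψ x y w‖ ≤ 2 * (‖x‖ * ‖y‖ * ‖w‖) := by
  calc ‖assocDefect ψ x y w‖ ≤ ‖x‖ * (‖y‖ * ‖w‖) + ‖x‖ * ‖y‖ * ‖w‖ :=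
        norm_sub_le_of_le (norm_mul_le_of_le (hψ x) ((hψ _).trans (norm_mul_le _ _)))
          (norm_mul_le_of_le ((hψ _).trans (norm_mul_le _ _)) (hψ w))
    _ = 2 * (‖x‖ * ‖y‖ * ‖w‖) := by ring

theorem assocDefect_nonUnitalStarAlgHom_comp {G : Type*} [NonUnitalCStarAlgebra F]
    [NonUnitalCStarAlgebra G] (m : F →⋆ₙₐ[ℂ] G) {ψ : A →ₗ[ℂ] F} (x y w : A) :
    assocDefect ((m : F →ₗ[ℂ] G) ∘ₗ ψ) x y w = m (assocDefect ψ x y w) := by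
  simp only [assocDefect, LinearMap.comp_apply, map_sub, map_mul]
  rfl

theorem IsOrderZeroMap.assocDefect_comp {B : Type*} [CStarAlgebra F] [PartialOrder F]
    [StarOrderedRing F] [NonUnitalCStarAlgebra B] [PartialOrder B] [StarOrderedRing B]
    {φ : F →ₗ[ℂ] B} (hφ : IsOrderZeroMap φ) {ψ : A →ₗ[ℂ] F} (x y w : A) :
    assocDefect (φ ∘ₗ ψ) x y w = φ 1 * φ (assocDefect ψ x y w) := by
  simp only [assocDefect, LinearMap.comp_apply]
  rw [hφ.map_mul_map, hφ.map_mul_map (ψ (x * y)), map_sub, mul_sub]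

end AssocDefect

/-- Multiplication by a central projection, as a homomorphism. -/
def mulCentralProjection {F : Type*} [NonUnitalCStarAlgebra F] (z : F) (hz : IsStarProjection z)
    (hc : ∀ x, z * x = x * z) : F →⋆ₙₐ[ℂ] F where
  toFun x := z * x
  map_smul' c x := mul_smul_comm c z x
  map_zero' := mul_zero z
  map_add' := mul_add z
  map_mul' x y := by
    rw [mul_assoc z x, ← mul_assoc x z, ← hc, mul_assoc z x, ← mul_assoc z z,
      hz.isIdempotentElem.eq]
  map_star' x := by rw [star_mul, hz.isSelfAdjoint.star_eq, hc]

/-- The factorization `f` arises from a map `θ` by cutting it down at level `σ`: this changes `θ`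
by at most `σ`, and allows `f.down` to inherit the asymptotic multiplicativity of `θ`. -/
structure OrderZeroFactorization.IsCut {A : Type u} [NonUnitalCStarAlgebra A] [PartialOrder A]
    [StarOrderedRing A] (f : OrderZeroFactorization A) (σ : ℝ) (θ : A →ₗ[ℂ] A) : Prop where
  sub_completelyPositive : IsCompletelyPositive (θ - f.toMap)
  norm_sub_le : ∀ x, ‖θ x - f.toMap x‖ ≤ σ * ‖x‖
  norm_assocDefect_sq_le : ∀ x y w, ‖assocDefect f.down x y w‖ ^ 2 * (σ ^ 2) ^ 3 ≤
    2 * (‖x‖ * ‖y‖ * ‖w‖) * ‖assocDefect θ x y w‖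

theorem IsOrderZeroMap.exists_isCut {A F : Type u} [NonUnitalCStarAlgebra A] [PartialOrder A]
    [StarOrderedRing A] [CStarAlgebra F] [PartialOrder F] [StarOrderedRing F]
    [FiniteDimensional ℂ F] {ψ : A →ₗ[ℂ] F} {φ : F →ₗ[ℂ] A} (hφ : IsOrderZeroMap φ)
    (hφ_norm : ∀ x, ‖φ x‖ ≤ ‖x‖) (hψ : IsCPContraction ψ) {σ : ℝ} (hσ : 0 < σ) :
    ∃ f : OrderZeroFactorization A, f.IsCut σ (φ ∘ₗ ψ) := by
  obtain ⟨z, hz, h_comm, h_small, h_large⟩ := hφ.exists_central_cut hφ_norm (sq_pos_of_pos hσ)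
  have h_comm' (x : F) : (1 - z) * x = x * (1 - z) := by
    rw [sub_mul, mul_sub, h_comm, one_mul, mul_one]
  let m := mulCentralProjection z hz h_comm
  let m' := mulCentralProjection (1 - z) hz.one_sub h_comm'
  let f : OrderZeroFactorization A :=
    { carrier := F
      down := (m : F →ₗ[ℂ] F) ∘ₗ ψ
      up := φ
      down_isCPContraction :=
        { completelyPositive := (IsCompletelyPositive.of_nonUnitalStarAlgHom m).comp
            hψ.completelyPositive
          norm_map_le x := (NonUnitalStarAlgHom.norm_apply_le m _).trans (hψ.norm_map_le x) }
      up_isOrderZeroMap := hφ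
      norm_up_le := hφ_norm }
  have h_sub : φ ∘ₗ ψ - f.toMap = φ ∘ₗ (m' : F →ₗ[ℂ] F) ∘ₗ ψ := by
    ext x
    change φ (ψ x) - φ (z * ψ x) = φ ((1 - z) * ψ x)
    rw [← map_sub, sub_mul, one_mul]
  refine ⟨f, ?_, fun x => ?_, fun x y w => ?_⟩
  · rw [h_sub]
    exact hφ.completelyPositive.comp
      ((IsCompletelyPositive.of_nonUnitalStarAlgHom m').comp hψ.completelyPositive)
  · have h_sq : ‖φ ((1 - z) * ψ x)‖ ^ 2 ≤ (σ * ‖x‖) ^ 2 := by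
      rw [mul_pow]
      exact (h_small _).trans (by gcongr; exact hψ.norm_map_le x)
    exact (congrArg norm (LinearMap.congr_fun h_sub x)).trans_le
      (le_of_sq_le_sq h_sq (by positivity))
  · rw [assocDefect_nonUnitalStarAlgHom_comp, hφ.assocDefect_comp]
    refine (h_large _).trans ?_
    gcongr
    exact norm_assocDefect_le hψ.norm_map_le x y w

theorem exists_isCut_of_orthogonal {A F : Type u} [NonUnitalCStarAlgebra A]
    [PartialOrder A] [StarOrderedRing A] [NonUnitalCStarAlgebra F] [PartialOrder F]
    [StarOrderedRing F] [FiniteDimensional ℂ F] {ψ : A →ₗ[ℂ] F} {φ : F →ₗ[ℂ] A}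
    (hψ : IsCPContraction ψ) (hφ : IsCPContraction φ)
    (h_orth : ∀ a b, 0 ≤ a → 0 ≤ b → a * b = 0 → φ a * φ b = 0) {σ : ℝ} (hσ : 0 < σ) :
    ∃ f : OrderZeroFactorization A, f.IsCut σ (φ ∘ₗ ψ) := by
  obtain ⟨c, rfl⟩ := exists_cstarAlgebra_of_finiteDimensional F
  exact (isOrderZeroMap_of_orthogonal hφ.completelyPositive h_orth).exists_isCut hφ.norm_map_le
    hψ hσ

section Net

variable {A : Type u} [NonUnitalCStarAlgebra A] {Λ : Type*} {l : Filter Λ}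
  {ι : Type} [Fintype ι]

theorem tendsto_norm_zero_of_entries {G : Λ → Type*} [∀ j, NonUnitalCStarAlgebra (G j)]
    [∀ j, PartialOrder (G j)] [∀ j, StarOrderedRing (G j)] (M : ∀ j, CStarMatrix ι ι (G j))
    (h : ∀ a b, Tendsto (fun j => ‖M j a b‖) l (𝓝 0)) : Tendsto (fun j => ‖M j‖) l (𝓝 0) := by
  refine squeeze_zero (fun _ => norm_nonneg _)
    (fun j => cstarMatrix_norm_le_sum_norm_entry (M j)) ?_
  simpa using tendsto_finsetSum Finset.univ fun b _ =>
    tendsto_finsetSum Finset.univ fun a _ => h a b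

theorem assocDefect_matrixMap_apply [PartialOrder A] [StarOrderedRing A] {G : Type*}
    [NonUnitalCStarAlgebra G] [PartialOrder G] [StarOrderedRing G] (ψ : A →ₗ[ℂ] G)
    (X Y Z : CStarMatrix ι ι A) (a b : ι) :
    assocDefect (CStarMatrix.mapₗ ψ) X Y Z a b =
      ∑ c, ∑ d, assocDefect ψ (X a c) (Y c d) (Z d b) := by
  have h_left : (X.map ψ * (Y * Z).map ψ) a b =
      ∑ c, ∑ d, ψ (X a c) * ψ (Y c d * Z d b) := by
    simp only [CStarMatrix.mul_apply, CStarMatrix.map_apply, map_sum, Finset.mul_sum]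
  have h_right : ((X * Y).map ψ * Z.map ψ) a b =
      ∑ c, ∑ d, ψ (X a c * Y c d) * ψ (Z d b) := by
    simp only [CStarMatrix.mul_apply, CStarMatrix.map_apply, map_sum, Finset.sum_mul]
    exact Finset.sum_comm
  simp only [assocDefect, Finset.sum_sub_distrib]
  rw [← h_left, ← h_right]
  rfl

theorem tendsto_norm_assocDefect_matrixMap [PartialOrder A] [StarOrderedRing A]
    {G : Λ → Type*} [∀ j, NonUnitalCStarAlgebra (G j)] [∀ j, PartialOrder (G j)]
    [∀ j, StarOrderedRing (G j)]
    {ψ : ∀ j, A →ₗ[ℂ] G j} (h : ∀ x y w, Tendsto (fun j => ‖assocDefect (ψ j) x y w‖) l (𝓝 0))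
    (X Y Z : CStarMatrix ι ι A) :
    Tendsto (fun j => ‖assocDefect (CStarMatrix.mapₗ (ψ j)) X Y Z‖) l (𝓝 0) := by
  refine tendsto_norm_zero_of_entries _ fun a b => ?_
  simp only [assocDefect_matrixMap_apply]
  refine squeeze_zero (fun _ => norm_nonneg _) (fun j =>
    (norm_sum_le _ _).trans (Finset.sum_le_sum fun c _ => norm_sum_le _ _)) ?_
  simpa using tendsto_finsetSum Finset.univ fun c _ =>
    tendsto_finsetSum Finset.univ fun d _ => h (X a c) (Y c d) (Z d b)

/-- A net of maps `A → A` is asymptotically a net of `A`-bimodule maps. -/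
structure IsAsymptoticBimoduleMap (θ : Λ → A →ₗ[ℂ] A) (l : Filter Λ) : Prop where
  tendsto_map_mul_sub_map_mul : ∀ w y, Tendsto (fun j => θ j (w * y) - θ j w * y) l (𝓝 0)
  tendsto_map_mul_sub_mul_map : ∀ w y, Tendsto (fun j => θ j (w * y) - w * θ j y) l (𝓝 0)

namespace IsAsymptoticBimoduleMap

variable {θ : Λ → A →ₗ[ℂ] A}

theorem tendsto_matrixMap_mul_sub_map_mul (h : IsAsymptoticBimoduleMap θ l)
    (X Y : CStarMatrix ι ι A) :
    Tendsto (fun j => (X * Y).map (θ j) - X.map (θ j) * Y) l (𝓝 0) := by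
  rw [CuntzLE.tendsto_iff]
  intro a b
  simp only [CStarMatrix.sub_apply, CStarMatrix.mul_apply, CStarMatrix.map_apply, map_sum,
    ← Finset.sum_sub_distrib]
  simpa using tendsto_finsetSum Finset.univ fun c _ =>
    h.tendsto_map_mul_sub_map_mul (X a c) (Y c b)

theorem tendsto_matrixMap_mul_sub_mul_map (h : IsAsymptoticBimoduleMap θ l)
    (X Y : CStarMatrix ι ι A) :
    Tendsto (fun j => (X * Y).map (θ j) - X * Y.map (θ j)) l (𝓝 0) := by
  rw [CuntzLE.tendsto_iff]
  intro a b
  simp only [CStarMatrix.sub_apply, CStarMatrix.mul_apply, CStarMatrix.map_apply, map_sum,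
    ← Finset.sum_sub_distrib]
  simpa using tendsto_finsetSum Finset.univ fun c _ =>
    h.tendsto_map_mul_sub_mul_map (X a c) (Y c b)

theorem tendsto_norm_assocDefect (h : IsAsymptoticBimoduleMap θ l) (hθ : ∀ j x, ‖θ j x‖ ≤ ‖x‖)
    (x y w : A) : Tendsto (fun j => ‖assocDefect (θ j) x y w‖) l (𝓝 0) := by
  have h_bound := ((h.tendsto_map_mul_sub_mul_map y w).norm.const_mul ‖x‖).add
    ((h.tendsto_map_mul_sub_map_mul x y).norm.mul_const ‖w‖)
  rw [norm_zero, mul_zero, zero_mul, add_zero] at h_bound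
  refine squeeze_zero (fun _ => norm_nonneg _) (fun j => ?_) h_bound
  have h_eq : assocDefect (θ j) x y w =
      θ j x * (θ j (y * w) - y * θ j w) - (θ j (x * y) - θ j x * y) * θ j w := by
    rw [assocDefect]
    noncomm_ring
  rw [h_eq]
  exact norm_sub_le_of_le (norm_mul_le_of_le (hθ j x) le_rfl) (norm_mul_le_of_le le_rfl (hθ j w))

variable [PartialOrder A] [StarOrderedRing A]

theorem of_tendsto_add {R : Λ → A →ₗ[ℂ] A} (hθ : ∀ j, IsCompletelyPositive (θ j))
    (hR : ∀ j, IsCompletelyPositive (R j))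
    (hid : ∀ x, Tendsto (fun j => (θ j + R j) x) l (𝓝 x)) (hb : ∀ j x, ‖θ j x‖ ≤ ‖x‖) :
    IsAsymptoticBimoduleMap θ l where
  tendsto_map_mul_sub_map_mul := _root_.tendsto_map_mul_sub_map_mul hθ hR hid hb
  tendsto_map_mul_sub_mul_map := _root_.tendsto_map_mul_sub_mul_map hθ hR hid hb

theorem tendsto_norm_matrixMap_sq_sub_conj (h : IsAsymptoticBimoduleMap θ l)
    (hθ : ∀ j, IsCPContraction (θ j)) (s : CStarMatrix ι ι A) :
    Tendsto (fun j => ‖(s * s).map (θ j) * (s * s).map (θ j) -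
      s.map (θ j) * (s * s) * s.map (θ j)‖) l (𝓝 0) := by
  have h_bound :=
    ((h.tendsto_matrixMap_mul_sub_map_mul s s).norm.mul_const (4 * ‖s * s‖)).add
      ((h.tendsto_matrixMap_mul_sub_mul_map s s).norm.const_mul (4 * ‖s‖ * ‖s‖))
  rw [norm_zero, mul_zero, zero_mul, add_zero] at h_bound
  refine squeeze_zero (fun _ => norm_nonneg _) (fun j => ?_) h_bound
  have h_eq : (s * s).map (θ j) * (s * s).map (θ j) - s.map (θ j) * (s * s) * s.map (θ j) =
      ((s * s).map (θ j) - s.map (θ j) * s) * (s * s).map (θ j) +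
        s.map (θ j) * s * ((s * s).map (θ j) - s * s.map (θ j)) := by
    noncomm_ring
  rw [h_eq]
  exact norm_add_le_of_le (norm_mul_le_of_le le_rfl ((hθ j).norm_matrixMap_le _))
    (norm_mul_le_of_le (norm_mul_le_of_le ((hθ j).norm_matrixMap_le _) le_rfl) le_rfl)

end IsAsymptoticBimoduleMap

variable [PartialOrder A] [StarOrderedRing A]

theorem OrderZeroFactorization.IsCut.tendsto_norm_assocDefect_down
    {f : Λ → OrderZeroFactorization A} {θ : Λ → A →ₗ[ℂ] A} {σ : ℝ} (hσ : 0 < σ)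
    (hf : ∀ j, (f j).IsCut σ (θ j)) {x y w : A}
    (h : Tendsto (fun j => ‖assocDefect (θ j) x y w‖) l (𝓝 0)) :
    Tendsto (fun j => ‖assocDefect (f j).down x y w‖) l (𝓝 0) := by
  have h_bound := ((h.const_mul (2 * (‖x‖ * ‖y‖ * ‖w‖))).div_const ((σ ^ 2) ^ 3)).sqrt
  rw [mul_zero, zero_div, Real.sqrt_zero] at h_bound
  refine squeeze_zero (fun _ => norm_nonneg _) (fun j => Real.le_sqrt_of_sq_le ?_) h_bound
  rw [le_div_iff₀ (by positivity)]
  exact (hf j).norm_assocDefect_sq_le x y w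

end Net

section Core

theorem exists_isSelfAdjoint_mul_self_eq {C : Type*} [NonUnitalCStarAlgebra C] [PartialOrder C]
    [StarOrderedRing C] {b : C} (hb : 0 ≤ b) : ∃ s, IsSelfAdjoint s ∧ s * s = b :=
  ⟨CFC.sqrt b, .of_nonneg (CFC.sqrt_nonneg b), CFC.sqrt_mul_sqrt_self b hb⟩

variable {A : Type u} [NonUnitalCStarAlgebra A] [PartialOrder A] [StarOrderedRing A]
  {ι : Type} [Fintype ι]

theorem OrderZeroFactorization.IsCut.norm_matrixMap_sub_le {f : OrderZeroFactorization A}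
    {σ : ℝ} {θ : A →ₗ[ℂ] A} (hf : f.IsCut σ θ) (a : CStarMatrix ι ι A) :
    ‖a.map θ - a.map f.toMap‖ ≤ (∑ c, ∑ d, ‖a d c‖) * σ := by
  refine (cstarMatrix_norm_le_sum_norm_entry _).trans ?_
  simp only [Finset.sum_mul]
  gcongr with c _ d _
  rw [mul_comm]
  exact hf.norm_sub_le (a d c)

variable {κ : Type} [Fintype κ] [DecidableEq κ] [Nonempty κ]
  {a b : CStarMatrix ι ι A} {v : CStarMatrix (κ × ι) (κ × ι) A} {δ : ℝ}
  {Λ : Type*} {l : Filter Λ}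

theorem eventually_exists_conj_approx_toMap {f : Λ → OrderZeroFactorization A}
    (hf : IsAsymptoticBimoduleMap (fun j => (f j).toMap) l)
    (h_down : ∀ x y w, Tendsto (fun j => ‖assocDefect (f j).down x y w‖) l (𝓝 0))
    (hδ : 0 < δ) (ha : 0 ≤ a) (hb : 0 ≤ b)
    (hv : ‖diagCopies κ a - star v * diagCopies κ b * v‖ ≤ δ / 16) :
    ∀ᶠ j in l, ∃ x : CStarMatrix ι ι A, ‖a.map (f j).toMap - star x * b * x‖ ≤ 3 * δ := by
  obtain ⟨s, hs, rfl⟩ := exists_isSelfAdjoint_mul_self_eq hb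
  obtain ⟨η, hη, h_approx⟩ := exists_pos_forall_exists_conj_approx hδ ha hb hs hv
  have h_sq := hf.tendsto_norm_matrixMap_sq_sub_conj (fun j => (f j).toMap_isCPContraction) s
  filter_upwards [
    (tendsto_norm_assocDefect_matrixMap h_down (diagCopies κ a) (star v)
      (diagCopies κ (s * s) * v)).eventually_le_const hη,
    (tendsto_norm_assocDefect_matrixMap h_down (diagCopies κ (s * s)) v
      (diagCopies κ a)).eventually_le_const hη,
    h_sq.eventually_le_const hη] with j h₁ h₂ h₃
  exact h_approx (f j) h₁ h₂ h₃

theorem eventually_exists_conj_approx {F : Λ → FinDimCStarAlgebra.{u}}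
    {ψ : ∀ j, A →ₗ[ℂ] F j} {φ : ∀ j, F j →ₗ[ℂ] A} {R : Λ → A →ₗ[ℂ] A}
    (hψ : ∀ j, IsCPContraction (ψ j)) (hφ : ∀ j, IsCPContraction (φ j))
    (h_orth : ∀ j a b, 0 ≤ a → 0 ≤ b → a * b = 0 → φ j a * φ j b = 0)
    (hR : ∀ j, IsCompletelyPositive (R j))
    (hid : ∀ x, Tendsto (fun j => (φ j ∘ₗ ψ j + R j) x) l (𝓝 x))
    (hδ : 0 < δ) (ha : 0 ≤ a) (hb : 0 ≤ b)
    (hv : ‖diagCopies κ a - star v * diagCopies κ b * v‖ ≤ δ / 16) :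
    ∀ᶠ j in l, ∃ x : CStarMatrix ι ι A, ‖a.map (φ j ∘ₗ ψ j) - star x * b * x‖ ≤ 4 * δ := by
  obtain ⟨σ, hσ, hσ_le⟩ := exists_pos_mul_le (∑ c, ∑ d, ‖a d c‖) hδ
  choose f hf using fun j => exists_isCut_of_orthogonal (hψ j) (hφ j) (h_orth j) hσ
  have hθ (j : Λ) : IsCPContraction (φ j ∘ₗ ψ j) := (hφ j).comp (hψ j)
  have h_bimodule : IsAsymptoticBimoduleMap (fun j => φ j ∘ₗ ψ j) l :=
    .of_tendsto_add (fun j => (hθ j).completelyPositive) hR hid fun j => (hθ j).norm_map_le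
  have h_bimodule_cut : IsAsymptoticBimoduleMap (fun j => (f j).toMap) l := by
    refine .of_tendsto_add (fun j => (f j).toMap_isCPContraction.completelyPositive)
      (fun j => (hR j).add (hf j).sub_completelyPositive) (fun x => (hid x).congr fun j => ?_)
      fun j => (f j).toMap_isCPContraction.norm_map_le
    congr 1
    abel
  have h_down (x y w : A) : Tendsto (fun j => ‖assocDefect (f j).down x y w‖) l (𝓝 0) :=
    OrderZeroFactorization.IsCut.tendsto_norm_assocDefect_down hσ hf
      (h_bimodule.tendsto_norm_assocDefect (fun j => (hθ j).norm_map_le) x y w)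
  filter_upwards [eventually_exists_conj_approx_toMap h_bimodule_cut h_down hδ ha hb hv]
    with j ⟨x, hx⟩
  refine ⟨x, ?_⟩
  calc ‖a.map (φ j ∘ₗ ψ j) - star x * b * x‖
      ≤ ‖a.map (φ j ∘ₗ ψ j) - a.map (f j).toMap‖ + ‖a.map (f j).toMap - star x * b * x‖ :=
        norm_sub_le_norm_sub_add_norm_sub _ _ _
    _ ≤ δ + 3 * δ := add_le_add (((hf j).norm_matrixMap_sub_le a).trans hσ_le) hx
    _ = 4 * δ := by ring

end Core

section DecomposableApproximations

variable {A : Type u} [NonUnitalCStarAlgebra A]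

theorem tendsto_sum_matrixMap {ι : Type} {Λ I : Type*} [Fintype I] {l : Filter Λ}
    {θ : I → Λ → A →ₗ[ℂ] A}
    (h : ∀ x, Tendsto (fun j => ∑ i, θ i j x) l (𝓝 x)) (a : CStarMatrix ι ι A) :
    Tendsto (fun j => ∑ i, a.map (θ i j)) l (𝓝 a) := by
  rw [CuntzLE.tendsto_iff]
  exact fun c d => (h (a c d)).congr fun j =>
    (Matrix.sum_apply c d Finset.univ fun i => a.map (θ i j)).symm

theorem norm_sub_sum_le {I E : Type*} [Fintype I] [SeminormedAddCommGroup E] {a : E}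
    {y z : I → E} {ε ε' : ℝ} (h : ‖a - ∑ i, y i‖ ≤ ε) (h' : ∀ i, ‖y i - z i‖ ≤ ε') :
    ‖a - ∑ i, z i‖ ≤ ε + Fintype.card I * ε' := by
  calc ‖a - ∑ i, z i‖ ≤ ‖a - ∑ i, y i‖ + ‖∑ i, y i - ∑ i, z i‖ :=
        norm_sub_le_norm_sub_add_norm_sub _ _ _
    _ ≤ ε + ∑ _i : I, ε' := by
        rw [← Finset.sum_sub_distrib]
        exact add_le_add h (norm_sum_le_of_le _ fun i _ => h' i)
    _ = ε + Fintype.card I * ε' := by simp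

theorem HasDecomposableApproximations.exists_sum_conj_approx [PartialOrder A]
    [StarOrderedRing A] {n : ℕ} (hA : HasDecomposableApproximations A n) {ι : Type} [Fintype ι]
    {a : CStarMatrix ι ι A} {b : Fin (n + 1) → CStarMatrix ι ι A} {k : Fin (n + 1) → ℕ}
    (hk : ∀ i, 0 < k i)
    {v : ∀ i, CStarMatrix (Fin (k i) × ι) (Fin (k i) × ι) A} {δ : ℝ}
    (hδ : 0 < δ) (ha : 0 ≤ a) (hb : ∀ i, 0 ≤ b i)
    (hv : ∀ i, ‖diagCopies (Fin (k i)) a - star (v i) * diagCopies (Fin (k i)) (b i) * v i‖ ≤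
      δ / 16) :
    ∃ x : Fin (n + 1) → CStarMatrix ι ι A,
      ‖a - ∑ i, star (x i) * b i * x i‖ ≤ (4 * (n + 1) + 1) * δ := by
  obtain ⟨Λ, _, _, _, F, ψ, φ, hψ_norm, hφ_norm, h_orth, hid⟩ := hA
  let ψ' i l := (ψ i l).toLinearMap
  let φ' i l := (φ i l).toLinearMap
  have hψ (i l) : IsCPContraction (ψ' i l) := ⟨.of_completelyPositiveMap _, hψ_norm i l⟩
  have hφ (i l) : IsCPContraction (φ' i l) := ⟨.of_completelyPositiveMap _, hφ_norm i l⟩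
  have h_color (i) : ∀ᶠ l in atTop, ∃ x : CStarMatrix ι ι A,
      ‖a.map (φ' i l ∘ₗ ψ' i l) - star x * b i * x‖ ≤ 4 * δ := by
    have : Nonempty (Fin (k i)) := ⟨⟨0, hk i⟩⟩
    refine eventually_exists_conj_approx (hψ i) (hφ i) (h_orth i)
      (R := fun l => ∑ i' ∈ Finset.univ.erase i, φ' i' l ∘ₗ ψ' i' l)
      (fun l => .sum _ fun i' _ => (hφ i' l).completelyPositive.comp (hψ i' l).completelyPositive)
      (fun x => (hid x).congr fun l => ?_) hδ ha (hb i) (hv i)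
    rw [LinearMap.add_apply, LinearMap.sum_apply]
    exact (Finset.add_sum_erase _ (fun i' => φ' i' l (ψ' i' l x)) (Finset.mem_univ i)).symm
  have h_close : ∀ᶠ l in atTop, ‖a - ∑ i, a.map (φ' i l ∘ₗ ψ' i l)‖ ≤ δ := by
    have h_sum := tendsto_sum_matrixMap (θ := fun i l => φ' i l ∘ₗ ψ' i l) hid a
    filter_upwards [(tendsto_iff_norm_sub_tendsto_zero.1 h_sum).eventually_le_const hδ] with l hl
    rwa [norm_sub_rev]
  obtain ⟨l, hl, hl_color⟩ := (h_close.and (eventually_all.2 h_color)).exists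
  choose x hx using hl_color
  refine ⟨x, (norm_sub_sum_le hl hx).trans_eq ?_⟩
  push_cast [Fintype.card_fin]
  ring

end DecomposableApproximations

/-! ### Matrix algebras in the stabilization -/

section StarHom

variable {C D : Type*} [NonUnitalCStarAlgebra C] [NonUnitalCStarAlgebra D] {f : C →⋆ₙₐ[ℂ] D}

theorem isClosed_range_of_injective (hf : Function.Injective f) : IsClosed (Set.range f) :=
  (NonUnitalStarAlgHom.isometry f hf).isClosedEmbedding.isClosed_range

theorem nonneg_of_map_nonneg [PartialOrder C] [StarOrderedRing C] [PartialOrder D]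
    [StarOrderedRing D] (hf : Function.Injective f) {x : C} (hx : 0 ≤ f x) : 0 ≤ x := by
  have hx_sa : IsSelfAdjoint x :=
    hf (by rw [StarHomClass.map_star, (IsSelfAdjoint.of_nonneg hx).star_eq])
  have h_neg : f x⁻ = 0 := by
    rw [CFC.negPart_def, NonUnitalStarAlgHom.map_cfcₙ f (·⁻) x
      (hφ := (NonUnitalStarAlgHom.isometry f hf).continuous), ← CFC.negPart_def]
    exact (CFC.negPart_eq_zero_iff (f x)).2 hx
  rw [← CFC.negPart_eq_zero_iff x hx_sa]
  exact hf (h_neg.trans (map_zero f).symm)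

end StarHom

open FinSuppMatrix

theorem FinSuppMatrix.SuppLE.mul_mul {A : Type u} [NonUnitalCStarAlgebra A] {N : ℕ}
    {x z : FinSuppMatrix A} (hx : x.SuppLE N) (hz : z.SuppLE N) (y : FinSuppMatrix A) :
    (x * y * z).SuppLE N := by
  intro i j hij
  obtain ⟨K, hK⟩ := (x * y).exists_suppLE
  rw [entry_mul hK]
  refine Finset.sum_eq_zero fun c _ => ?_
  rcases hij with hi | hj
  · rw [entry_mul hx, Finset.sum_eq_zero fun d _ => by rw [hx i d (.inl hi), zero_mul], zero_mul]
  · rw [hz c j (.inr hj), mul_zero]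

/-- The inclusion of `M_N(A)` in `A ⊗ 𝒦` as a corner. -/
def cornerHom (A : Type u) [NonUnitalCStarAlgebra A] [PartialOrder A] [StarOrderedRing A]
    (N : ℕ) : CStarMatrix (Fin N) (Fin N) A →⋆ₙₐ[ℂ] Stabilization A where
  toFun X := Stabilization.of (ofCorner X)
  map_smul' c X := by
    rw [← map_smul]
    congr 1
    refine ext_corner (ofCorner_suppLE _) ((ofCorner_suppLE _).smul c) ?_
    rw [corner_ofCorner, corner_smul, corner_ofCorner]
    rfl
  map_zero' := by
    rw [← map_zero Stabilization.of]
    congr 1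
    exact ext_corner (ofCorner_suppLE _) (fun _ _ _ => rfl)
      (by rw [corner_ofCorner, corner_zero])
  map_add' X Y := by
    rw [← map_add]
    congr 1
    refine ext_corner (ofCorner_suppLE _) ((ofCorner_suppLE _).add (ofCorner_suppLE _)) ?_
    rw [corner_ofCorner, corner_add, corner_ofCorner, corner_ofCorner]
  map_mul' X Y := by
    rw [← Stabilization.of_mul]
    congr 1
    refine ext_corner (ofCorner_suppLE _) ((ofCorner_suppLE _).mul (ofCorner_suppLE _)) ?_
    rw [corner_ofCorner, corner_mul (ofCorner_suppLE _), corner_ofCorner, corner_ofCorner]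
  map_star' X := by
    rw [← Stabilization.of_star]
    congr 1
    refine ext_corner (ofCorner_suppLE _) (ofCorner_suppLE _).star ?_
    rw [corner_ofCorner, corner_star, corner_ofCorner]

section Block

variable {A : Type u}

/-- The block at position `(s, t)` of a matrix which is partitioned along `e` into blocks of size
`N`. -/
def blockAt {τ ρ : Type} {N : ℕ} (e : τ × Fin N ≃ ρ) (X : CStarMatrix ρ ρ A) (s t : τ) :
    CStarMatrix (Fin N) (Fin N) A :=
  CStarMatrix.ofMatrix fun p q => X (e (s, p)) (e (t, q))

variable [NonUnitalCStarAlgebra A]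

theorem blockAt_mul {τ ρ : Type} [Fintype τ] [Fintype ρ] {N : ℕ} (e : τ × Fin N ≃ ρ)
    (X Y : CStarMatrix ρ ρ A) (s t : τ) :
    blockAt e (X * Y) s t = ∑ c, blockAt e X s c * blockAt e Y c t := by
  ext p q
  calc (X * Y) (e (s, p)) (e (t, q))
      = ∑ c, ∑ d, X (e (s, p)) (e (c, d)) * Y (e (c, d)) (e (t, q)) := by
        rw [CStarMatrix.mul_apply, ← e.sum_comp, Fintype.sum_prod_type]
    _ = ∑ c, (blockAt e X s c * blockAt e Y c t) p q := by
        simp only [CStarMatrix.mul_apply]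
        rfl
    _ = (∑ c, blockAt e X s c * blockAt e Y c t) p q := (Matrix.sum_apply p q _ _).symm

variable [PartialOrder A] [StarOrderedRing A]

theorem cornerHom_corner {N : ℕ} {x : FinSuppMatrix A} (hx : x.SuppLE N) :
    cornerHom A N (corner N x) = Stabilization.of x :=
  congrArg Stabilization.of (ofCorner_corner hx)

theorem cornerHom_injective (N : ℕ) : Function.Injective (cornerHom A N) := by
  intro X Y h
  have h_eq : ofCorner X = ofCorner Y := Stabilization.of.injective h
  rw [← corner_ofCorner X, ← corner_ofCorner Y, h_eq]

theorem cornerHom_mul_mul_mem_range {N : ℕ} (X Y : CStarMatrix (Fin N) (Fin N) A)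
    (b : Stabilization A) : cornerHom A N X * b * cornerHom A N Y ∈ Set.range (cornerHom A N) := by
  induction b using Stabilization.denseRange_of.induction_on with
  | hp =>
    exact (isClosed_range_of_injective (cornerHom_injective N)).preimage
      ((continuous_const.mul continuous_id).mul continuous_const)
  | ih y =>
    refine ⟨corner N (ofCorner X * y * ofCorner Y), ?_⟩
    rw [cornerHom_corner ((ofCorner_suppLE X).mul_mul (ofCorner_suppLE Y) y),
      Stabilization.of_mul, Stabilization.of_mul]
    rfl

theorem tendsto_infDist_range_cornerHom (b : Stabilization A) :
    Tendsto (fun N => Metric.infDist b (Set.range (cornerHom A N))) atTop (𝓝 0) := by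
  refine Metric.tendsto_atTop.2 fun ε hε => ?_
  obtain ⟨x, hx⟩ := Stabilization.denseRange_of.exists_dist_lt b hε
  obtain ⟨N, hN⟩ := x.exists_suppLE
  refine ⟨N, fun K hK => ?_⟩
  rw [Real.dist_0_eq_abs, abs_of_nonneg Metric.infDist_nonneg]
  have h_mem : Stabilization.of x ∈ Set.range (cornerHom A K) :=
    ⟨corner K x, cornerHom_corner (hN.mono hK)⟩
  exact (Metric.infDist_le_dist_of_mem h_mem).trans_lt hx

theorem exists_tendsto_of_tendsto_infDist {X : Type*} [PseudoMetricSpace X] {b : X}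
    {s : ℕ → Set X} (hs : ∀ N, (s N).Nonempty)
    (h : Tendsto (fun N => Metric.infDist b (s N)) atTop (𝓝 0)) :
    ∃ x : ℕ → X, (∀ N, x N ∈ s N) ∧ Tendsto x atTop (𝓝 b) := by
  choose x hx h_dist using fun N => (Metric.infDist_lt_iff (hs N)).1
    (lt_add_of_pos_right (Metric.infDist b (s N)) (Nat.one_div_pos_of_nat (n := N)))
  refine ⟨x, hx, tendsto_iff_dist_tendsto_zero.2 ?_⟩
  have h_bound := h.add (tendsto_one_div_add_atTop_nhds_zero_nat (𝕜 := ℝ))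
  rw [add_zero] at h_bound
  refine squeeze_zero (fun _ => dist_nonneg) (fun N => ?_) h_bound
  rw [dist_comm]
  exact (h_dist N).le

theorem exists_tendsto_cornerHom (b : Stabilization A) :
    ∃ X : ∀ N, CStarMatrix (Fin N) (Fin N) A,
      Tendsto (fun N => cornerHom A N (X N)) atTop (𝓝 b) := by
  obtain ⟨x, hx, h_tendsto⟩ := exists_tendsto_of_tendsto_infDist
    (fun N => Set.range_nonempty (cornerHom A N)) (tendsto_infDist_range_cornerHom b)
  choose X hX using hx
  exact ⟨X, by simpa only [hX] using h_tendsto⟩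

/-- The inclusion of the matrices of `N × N` blocks over `A` in the matrices over `A ⊗ 𝒦`. -/
def blockHom (A : Type u) [NonUnitalCStarAlgebra A] [PartialOrder A] [StarOrderedRing A]
    {τ ρ : Type} [Fintype τ] [Fintype ρ] {N : ℕ} (e : τ × Fin N ≃ ρ) :
    CStarMatrix ρ ρ A →⋆ₙₐ[ℂ] CStarMatrix τ τ (Stabilization A) where
  toFun X := CStarMatrix.ofMatrix fun s t => cornerHom A N (blockAt e X s t)
  map_smul' c X := by
    ext s t
    exact map_smul (cornerHom A N) c (blockAt e X s t)
  map_zero' := by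
    ext
    exact map_zero (cornerHom A N)
  map_add' X Y := by
    ext s t
    exact map_add (cornerHom A N) (blockAt e X s t) (blockAt e Y s t)
  map_mul' X Y := by
    ext s t
    rw [CStarMatrix.mul_apply]
    change cornerHom A N (blockAt e (X * Y) s t) =
      ∑ c, cornerHom A N (blockAt e X s c) * cornerHom A N (blockAt e Y c t)
    simp only [blockAt_mul, map_sum, map_mul]
  map_star' X := by
    ext s t
    exact StarHomClass.map_star (cornerHom A N) (blockAt e X t s)

variable {τ ρ : Type} [Fintype τ] [Fintype ρ] {N : ℕ} (e : τ × Fin N ≃ ρ)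

theorem blockHom_apply (X : CStarMatrix ρ ρ A) (s t : τ) :
    blockHom A e X s t = cornerHom A N (blockAt e X s t) := rfl

theorem blockHom_injective : Function.Injective (blockHom A e) := by
  intro X Y h
  ext p q
  obtain ⟨⟨s, p⟩, rfl⟩ := e.surjective p
  obtain ⟨⟨t, q⟩, rfl⟩ := e.surjective q
  have h_block : blockAt e X s t = blockAt e Y s t :=
    cornerHom_injective N (congrFun₂ h s t)
  exact congrFun₂ h_block p q

theorem mem_range_blockHom {b : CStarMatrix τ τ (Stabilization A)}
    (h : ∀ s t, b s t ∈ Set.range (cornerHom A N)) : b ∈ Set.range (blockHom A e) := by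
  choose X hX using h
  refine ⟨CStarMatrix.ofMatrix fun p q =>
    X (e.symm p).1 (e.symm q).1 (e.symm p).2 (e.symm q).2, ?_⟩
  ext s t
  rw [blockHom_apply, ← hX]
  congr 1
  ext p q
  change X (e.symm (e (s, p))).1 (e.symm (e (t, q))).1 (e.symm (e (s, p))).2
    (e.symm (e (t, q))).2 = _
  simp only [Equiv.symm_apply_apply]

theorem blockHom_mul_mul_mem_range (X Y : CStarMatrix ρ ρ A)
    (b : CStarMatrix τ τ (Stabilization A)) :
    blockHom A e X * b * blockHom A e Y ∈ Set.range (blockHom A e) := by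
  refine mem_range_blockHom e fun s t => ?_
  let S := LinearMap.range (cornerHom A N : CStarMatrix (Fin N) (Fin N) A →ₗ[ℂ] Stabilization A)
  change _ ∈ S
  rw [CStarMatrix.mul_apply]
  refine Submodule.sum_mem _ fun c _ => ?_
  rw [CStarMatrix.mul_apply, Finset.sum_mul]
  exact Submodule.sum_mem _ fun d _ => cornerHom_mul_mul_mem_range _ _ _

theorem exists_nonneg_blockHom_eq_conj (X : CStarMatrix ρ ρ A)
    {b : CStarMatrix τ τ (Stabilization A)} (hb : 0 ≤ b) :
    ∃ Y, 0 ≤ Y ∧ blockHom A e Y = star (blockHom A e X) * b * blockHom A e X := by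
  obtain ⟨Y, hY⟩ := blockHom_mul_mul_mem_range e (star X) X b
  rw [StarHomClass.map_star] at hY
  exact ⟨Y, nonneg_of_map_nonneg (blockHom_injective e) (hY ▸ star_left_conjugate_nonneg hb _), hY⟩

theorem exists_tendsto_blockHom (b : CStarMatrix τ τ (Stabilization A)) {ρ : ℕ → Type}
    [∀ N, Fintype (ρ N)] (e : ∀ N, τ × Fin N ≃ ρ N) :
    ∃ X : ∀ N, CStarMatrix (ρ N) (ρ N) A,
      Tendsto (fun N => blockHom A (e N) (X N)) atTop (𝓝 b) := by
  choose X hX using fun s t => exists_tendsto_cornerHom (b s t)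
  choose Y hY using fun N => mem_range_blockHom (e N)
    (b := CStarMatrix.ofMatrix fun s t => cornerHom A N (X s t N)) fun s t => ⟨X s t N, rfl⟩
  refine ⟨Y, ?_⟩
  simp only [hY]
  rw [CuntzLE.tendsto_iff]
  exact hX

theorem blockHom_diagCopies {κ : Type} [Fintype κ] [DecidableEq κ]
    (X : CStarMatrix (τ × Fin N) (τ × Fin N) A) :
    blockHom A (Equiv.prodAssoc κ τ (Fin N)) (diagCopies κ X) =
      diagCopies κ (blockHom A (Equiv.refl _) X) := by
  ext s t
  have h_block : blockAt (Equiv.prodAssoc κ τ (Fin N)) (diagCopies κ X) s t =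
      if s.1 = t.1 then blockAt (Equiv.refl _) X s.2 t.2 else 0 := by
    ext p q
    change (if s.1 = t.1 then X (s.2, p) (t.2, q) else 0) = _
    split_ifs <;> rfl
  rw [blockHom_apply, diagCopies_apply, blockHom_apply, h_block, apply_ite (cornerHom A N),
    map_zero]

end Block

/-! ### Comparison in the stabilization -/

section Stabilization

theorem continuous_diagCopies {κ τ : Type} [Fintype κ] [DecidableEq κ] [Fintype τ] {C : Type*}
    [NonUnitalCStarAlgebra C] [PartialOrder C] [StarOrderedRing C] :
    Continuous (diagCopies κ : CStarMatrix τ τ C → CStarMatrix (κ × τ) (κ × τ) C) :=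
  AddMonoidHomClass.continuous_of_bound (diagCopies κ) 1 fun X => by
    rw [one_mul]
    exact NonUnitalStarAlgHom.norm_apply_le _ X

theorem eventually_norm_diagCopies_sub_conj_lt {κ τ : Type} [Fintype κ] [DecidableEq κ]
    [Fintype τ] {C : Type*} [NonUnitalCStarAlgebra C] [PartialOrder C] [StarOrderedRing C]
    {a b : CStarMatrix τ τ C} {V : CStarMatrix (κ × τ) (κ × τ) C} {δ : ℝ}
    (hV : ‖diagCopies κ a - star V * diagCopies κ b * V‖ < δ) {Λ : Type*} {l : Filter Λ}
    {a' b' : Λ → CStarMatrix τ τ C} {V' : Λ → CStarMatrix (κ × τ) (κ × τ) C}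
    (ha' : Tendsto a' l (𝓝 a)) (hb' : Tendsto b' l (𝓝 b)) (hV' : Tendsto V' l (𝓝 V)) :
    ∀ᶠ j in l, ‖diagCopies κ (a' j) - star (V' j) * diagCopies κ (b' j) * V' j‖ < δ := by
  have h_diag {c : CStarMatrix τ τ C} {c' : Λ → CStarMatrix τ τ C} (hc : Tendsto c' l (𝓝 c)) :
      Tendsto (fun j => diagCopies κ (c' j)) l (𝓝 (diagCopies κ c)) :=
    (continuous_diagCopies.tendsto c).comp hc
  exact ((h_diag ha').sub ((hV'.star.mul (h_diag hb')).mul hV')).norm.eventually_lt_const hV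

theorem exists_conj_norm_sub_lt {τ : Type} [Fintype τ] {C : Type*} [NonUnitalCStarAlgebra C]
    [PartialOrder C] [StarOrderedRing C] {I : Type*} [Finite I] {κ : I → Type}
    [∀ i, Fintype (κ i)] [∀ i, DecidableEq (κ i)] {a : CStarMatrix τ τ C}
    {b : I → CStarMatrix τ τ C} {V : ∀ i, CStarMatrix (κ i × τ) (κ i × τ) C} {δ δ' : ℝ}
    (hδ : 0 < δ)
    (hV : ∀ i, ‖diagCopies (κ i) a - star (V i) * diagCopies (κ i) (b i) * V i‖ < δ') :
    ∃ u : CStarMatrix τ τ C, ‖a - star u * a * u‖ < δ ∧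
      ∀ i, ‖diagCopies (κ i) (star u * a * u) -
        star (V i) * diagCopies (κ i) (star u * b i * u) * V i‖ < δ' := by
  have := (CStarAlgebra.increasingApproximateUnit (CStarMatrix τ τ C)).neBot
  have hu (c : CStarMatrix τ τ C) := tendsto_star_mul_mul_approximateUnit c
  have h_near : ∀ᶠ u in CStarAlgebra.approximateUnit (CStarMatrix τ τ C),
      ‖a - star u * a * u‖ < δ :=
    (tendsto_const_nhds.sub (hu a)).norm.eventually_lt_const (by rwa [sub_self, norm_zero])
  have h_conj (i) : ∀ᶠ u in CStarAlgebra.approximateUnit (CStarMatrix τ τ C),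
      ‖diagCopies (κ i) (star u * a * u) -
        star (V i) * diagCopies (κ i) (star u * b i * u) * V i‖ < δ' :=
    eventually_norm_diagCopies_sub_conj_lt (hV i) (hu a) (hu (b i)) tendsto_const_nhds
  exact (h_near.and (eventually_all.2 h_conj)).exists

variable {A : Type u} [NonUnitalCStarAlgebra A] [PartialOrder A] [StarOrderedRing A]
  {τ : Type} [Fintype τ] {a : CStarMatrix τ τ (Stabilization A)} {δ : ℝ}

theorem exists_blockHom_conj_norm_sub_lt {I : Type*} [Finite I] {κ : I → Type}
    [∀ i, Fintype (κ i)] [∀ i, DecidableEq (κ i)] {b : I → CStarMatrix τ τ (Stabilization A)}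
    {V : ∀ i, CStarMatrix (κ i × τ) (κ i × τ) (Stabilization A)} {δ' : ℝ} (hδ : 0 < δ)
    (hV : ∀ i, ‖diagCopies (κ i) a - star (V i) * diagCopies (κ i) (b i) * V i‖ < δ') :
    ∃ (N : ℕ) (X : CStarMatrix (τ × Fin N) (τ × Fin N) A)
      (v : ∀ i, CStarMatrix (κ i × τ × Fin N) (κ i × τ × Fin N) A),
      let u := blockHom A (Equiv.refl _) X
      let w i := blockHom A (Equiv.prodAssoc (κ i) τ (Fin N)) (v i)
      ‖a - star u * a * u‖ < δ ∧ ∀ i, ‖diagCopies (κ i) (star u * a * u) -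
        star (w i) * diagCopies (κ i) (star u * b i * u) * w i‖ < δ' := by
  obtain ⟨u, hu, huV⟩ := exists_conj_norm_sub_lt hδ hV
  obtain ⟨X, hX⟩ := exists_tendsto_blockHom u fun N => Equiv.refl (τ × Fin N)
  choose v hv using fun i => exists_tendsto_blockHom (V i) fun N => Equiv.prodAssoc (κ i) τ (Fin N)
  have h_conj (c : CStarMatrix τ τ (Stabilization A)) := (hX.star.mul_const c).mul hX
  obtain ⟨N, hN, hNv⟩ := (((tendsto_const_nhds.sub (h_conj a)).norm.eventually_lt_const hu).and
    (eventually_all.2 fun i => eventually_norm_diagCopies_sub_conj_lt (huV i) (h_conj a)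
      (h_conj (b i)) (hv i))).exists
  exact ⟨N, X N, fun i => v i N, hN, hNv⟩

/- Compression by an element close to a unit, coming from a corner, moves `a` and the `b i` into a
matrix algebra over `A`. -/
theorem HasDecomposableApproximations.exists_sum_conj_approx_stabilization {n : ℕ}
    (hA : HasDecomposableApproximations A n) {b : Fin (n + 1) → CStarMatrix τ τ (Stabilization A)}
    {k : Fin (n + 1) → ℕ} (hk : ∀ i, 0 < k i)
    {V : ∀ i, CStarMatrix (Fin (k i) × τ) (Fin (k i) × τ) (Stabilization A)}
    (hδ : 0 < δ) (ha : 0 ≤ a) (hb : ∀ i, 0 ≤ b i)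
    (hV : ∀ i, ‖diagCopies (Fin (k i)) a - star (V i) * diagCopies (Fin (k i)) (b i) * V i‖ <
      δ / 16) :
    ∃ x : Fin (n + 1) → CStarMatrix τ τ (Stabilization A),
      ‖a - ∑ i, star (x i) * b i * x i‖ ≤ (4 * (n + 1) + 2) * δ := by
  obtain ⟨N, X, v, hN, hNv⟩ := exists_blockHom_conj_norm_sub_lt hδ hV
  let f := blockHom A (Equiv.refl (τ × Fin N))
  obtain ⟨a', ha', ha_conj⟩ := exists_nonneg_blockHom_eq_conj (Equiv.refl _) X ha
  choose b' hb' hb_conj using fun i => exists_nonneg_blockHom_eq_conj (Equiv.refl _) X (hb i)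
  have hv (i) : ‖diagCopies (Fin (k i)) a' - star (v i) * diagCopies (Fin (k i)) (b' i) * v i‖ ≤
      δ / 16 := by
    rw [← NonUnitalStarAlgHom.norm_map (blockHom A _)
        (blockHom_injective (Equiv.prodAssoc (Fin (k i)) τ (Fin N))),
      map_sub, map_mul, map_mul, StarHomClass.map_star, blockHom_diagCopies,
      blockHom_diagCopies, ha_conj, hb_conj]
    exact (hNv i).le
  obtain ⟨x, hx⟩ := hA.exists_sum_conj_approx hk hδ ha' hb' hv
  refine ⟨fun i => f X * f (x i), ?_⟩
  calc ‖a - ∑ i, star (f X * f (x i)) * b i * (f X * f (x i))‖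
      = ‖(a - star (f X) * a * f X) + f (a' - ∑ i, star (x i) * b' i * x i)‖ := by
        rw [map_sub, map_sum, ha_conj, sub_add_sub_cancel]
        simp only [f, map_mul, StarHomClass.map_star, hb_conj, star_mul, mul_assoc]
    _ ≤ δ + (4 * (n + 1) + 1) * δ :=
        norm_add_le_of_le hN.le ((NonUnitalStarAlgHom.norm_apply_le f _).trans hx)
    _ = (4 * (n + 1) + 2) * δ := by ring

end Stabilization

/-! ### Multiples and sums in the Cuntz semigroup -/

section Semigroup

variable {B : Type u} [NonUnitalCStarAlgebra B]

section DiagBlocks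

variable {I m : Type} [DecidableEq I]

/-- The block diagonal matrix with the matrices `b i` on the diagonal: a representative of the sum
of their Cuntz classes. -/
def diagBlocks (b : I → CStarMatrix m m B) : CStarMatrix (I × m) (I × m) B :=
  CStarMatrix.ofMatrix fun s t => if s.1 = t.1 then b s.1 s.2 t.2 else 0

theorem diagBlocks_apply (b : I → CStarMatrix m m B) (s t : I × m) :
    diagBlocks b s t = if s.1 = t.1 then b s.1 s.2 t.2 else 0 := rfl

theorem diagBlocks_const [Fintype I] [Fintype m] (a : CStarMatrix m m B) :
    (diagBlocks fun _ : I => a) = diagCopies I a := rfl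

theorem conj_diagBlocks [Fintype I] [Fintype m] (b x : I → CStarMatrix m m B) :
    let y : CStarMatrix (I × m) m B := CStarMatrix.ofMatrix fun s j => x s.1 s.2 j
    y.conjTranspose * diagBlocks b * y = ∑ i, star (x i) * b i * x i := by
  ext p q
  have h_col (i : I) (j : m) :
      ∑ s : I × m, star (x s.1 s.2 p) * diagBlocks b s (i, j) = ∑ r, star (x i r p) * b i r j := by
    simp only [diagBlocks_apply, mul_ite, mul_zero]
    rw [Fintype.sum_prod_type_right]
    simp only [Finset.sum_ite_eq', Finset.mem_univ, if_true]
  calc _ = ∑ i, ∑ j, (∑ s : I × m, star (x s.1 s.2 p) * diagBlocks b s (i, j)) * x i j q := by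
        rw [CuntzLE.conj_apply, Fintype.sum_prod_type]
        rfl
    _ = ∑ i, (star (x i) * b i * x i) p q := by
        simp only [h_col]
        rfl
    _ = _ := (Matrix.sum_apply p q _ _).symm

theorem exists_equiv_blockSum_eq_diagBlocks {k : ℕ} (b : Fin (k + 1) → CStarMatrix m m B) :
    ∃ f : (Fin k × m) ⊕ m ≃ Fin (k + 1) × m, ∀ s t,
      blockSum (diagBlocks fun i => b i.castSucc) (b (Fin.last k)) s t =
        diagBlocks b (f s) (f t) := by
  let f : (Fin k × m) ⊕ m ≃ Fin (k + 1) × m :=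
    ((Equiv.refl _).sumCongr (Equiv.uniqueProd m (Fin 1)).symm).trans
      ((Equiv.sumProdDistrib (Fin k) (Fin 1) m).symm.trans
        (finSumFinEquiv.prodCongr (Equiv.refl _)))
  have hf_inl (s : Fin k × m) : f (.inl s) = (s.1.castSucc, s.2) := rfl
  have hf_inr (s : m) : f (.inr s) = (Fin.last k, s) := rfl
  refine ⟨f, ?_⟩
  rintro (s | s) (t | t)
  · rw [blockSum_inl_inl, hf_inl, hf_inl, diagBlocks_apply, diagBlocks_apply]
    simp only [Fin.castSucc_inj]
  · rw [blockSum_inl_inr, hf_inl, hf_inr, diagBlocks_apply, if_neg (Fin.castSucc_ne_last _)]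
  · rw [blockSum_inr_inl, hf_inl, hf_inr, diagBlocks_apply, if_neg (Fin.castSucc_ne_last _).symm]
  · rw [blockSum_inr_inr, hf_inr, hf_inr, diagBlocks_apply, if_pos rfl]

end DiagBlocks

theorem CuntzLE.zero_left {m n : Type} [Fintype m] [Fintype n] (b : CStarMatrix n n B) :
    CuntzLE (0 : CStarMatrix m m B) b := by
  refine ⟨fun _ => 0, CuntzLE.tendsto_iff.2 fun i j => ?_⟩
  simp only [CuntzLE.conj_apply, CStarMatrix.zero_apply, mul_zero, Finset.sum_const_zero]
  exact tendsto_const_nhds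

variable [PartialOrder B] [StarOrderedRing B]

namespace CuntzSemigroup

theorem zero_le (x : CuntzSemigroup B) : 0 ≤ x := by
  induction x using ind with | _ a
  exact CuntzLE.zero_left a.mat

theorem exists_mk_eq_of_size_le (a : PosMatrix B) {M : ℕ} (hM : a.size ≤ M) :
    ∃ (c : CStarMatrix (Fin M) (Fin M) B) (hc : 0 ≤ c), mk ⟨M, c, hc⟩ = mk a := by
  obtain ⟨d, rfl⟩ := Nat.exists_eq_add_of_le hM
  let z : PosMatrix B := ⟨d, 0, le_rfl⟩
  have hz : mk z = 0 := le_antisymm (CuntzLE.zero_left _) (zero_le _)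
  refine ⟨(a + z).mat, (a + z).nonneg, ?_⟩
  change mk (a + z) = mk a
  rw [mk_add, hz, add_zero]

theorem exists_mk_eq_sum {M k : ℕ} (b : Fin k → CStarMatrix (Fin M) (Fin M) B)
    (hb : ∀ i, 0 ≤ b i) :
    ∃ P : PosMatrix B, mk P = ∑ i, mk ⟨M, b i, hb i⟩ ∧ CuntzLE (diagBlocks b) P.mat ∧
      CuntzLE P.mat (diagBlocks b) := by
  induction k with
  | zero =>
    have h_zero : diagBlocks b = 0 := by
      ext s
      exact s.1.elim0
    rw [h_zero]
    exact ⟨0, by rw [mk_zero, Fin.sum_univ_zero], .zero_left _, .zero_left _⟩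
  | succ k ih =>
    obtain ⟨P, hP, h_le, h_ge⟩ := ih (fun i => b i.castSucc) fun i => hb i.castSucc
    let Q : PosMatrix B := ⟨M, b (Fin.last k), hb (Fin.last k)⟩
    have h_add := PosMatrix.add_mat_apply P Q
    obtain ⟨f, hf⟩ := exists_equiv_blockSum_eq_diagBlocks b
    refine ⟨P + Q, by rw [mk_add, hP, Fin.sum_univ_castSucc], ?_, ?_⟩
    · refine .trans (.of_equiv f (Equiv.refl _) fun s t => (hf s t).symm)
        (.trans (.blockSum_mono h_le (.refl Q.mat)) ?_)
      exact .of_equiv (Equiv.refl _) finSumFinEquiv fun s t => (h_add s t).symm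
    · exact .trans (.of_equiv finSumFinEquiv (Equiv.refl _) h_add)
        (.trans (.blockSum_mono h_ge (.refl Q.mat)) (.of_equiv (Equiv.refl _) f hf))

theorem cuntzLE_diagCopies_of_nsmul_le {a b : PosMatrix B} {k : ℕ} (h : k • mk a ≤ k • mk b) :
    CuntzLE (diagCopies (Fin k) a.mat) (diagCopies (Fin k) b.mat) := by
  obtain ⟨P, hP, h_le, -⟩ := exists_mk_eq_sum (fun _ : Fin k => a.mat) fun _ => a.nonneg
  obtain ⟨Q, hQ, -, h_ge⟩ := exists_mk_eq_sum (fun _ : Fin k => b.mat) fun _ => b.nonneg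
  rw [Fin.sum_const] at hP hQ
  rw [← hP, ← hQ] at h
  rw [← diagBlocks_const, ← diagBlocks_const]
  exact (h_le.trans (mk_le_mk.1 h)).trans h_ge

theorem mk_le_sum_of_approx {M k : ℕ} {a : CStarMatrix (Fin M) (Fin M) B} (ha : 0 ≤ a)
    {b : Fin k → CStarMatrix (Fin M) (Fin M) B} (hb : ∀ i, 0 ≤ b i)
    (h : ∀ ε > 0, ∃ x : Fin k → CStarMatrix (Fin M) (Fin M) B,
      ‖a - ∑ i, star (x i) * b i * x i‖ < ε) :
    mk ⟨M, a, ha⟩ ≤ ∑ i, mk ⟨M, b i, hb i⟩ := by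
  obtain ⟨P, hP, h_le, -⟩ := exists_mk_eq_sum b hb
  rw [← hP, mk_le_mk]
  refine CuntzLE.trans (CuntzLE.iff_mem_closure.2 (Metric.mem_closure_iff.2 fun ε hε => ?_)) h_le
  obtain ⟨x, hx⟩ := h ε hε
  refine ⟨_, ⟨_, conj_diagBlocks b x⟩, ?_⟩
  rwa [dist_eq_norm]

end CuntzSemigroup

end Semigroup

section Comparison

variable {A : Type u} [NonUnitalCStarAlgebra A] [PartialOrder A] [StarOrderedRing A] {n : ℕ}
  {k : Fin (n + 1) → ℕ}

namespace HasDecomposableApproximations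

theorem mk_le_sum_mk (hA : HasDecomposableApproximations A n) (hk : ∀ i, 0 < k i) {M : ℕ}
    {a : CStarMatrix (Fin M) (Fin M) (Stabilization A)} (ha : 0 ≤ a)
    {b : Fin (n + 1) → CStarMatrix (Fin M) (Fin M) (Stabilization A)} (hb : ∀ i, 0 ≤ b i)
    (h : ∀ i, CuntzLE (diagCopies (Fin (k i)) a) (diagCopies (Fin (k i)) (b i))) :
    CuntzSemigroup.mk ⟨M, a, ha⟩ ≤ ∑ i, CuntzSemigroup.mk ⟨M, b i, hb i⟩ := by
  refine CuntzSemigroup.mk_le_sum_of_approx ha hb fun ε hε => ?_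
  obtain ⟨δ, hδ, hδ_le⟩ := exists_pos_mul_le (4 * (n + 1) + 2) (half_pos hε)
  have h_conj (i) : ∃ V : CStarMatrix (Fin (k i) × Fin M) (Fin (k i) × Fin M) (Stabilization A),
      ‖diagCopies (Fin (k i)) a - star V * diagCopies (Fin (k i)) (b i) * V‖ < δ / 16 := by
    obtain ⟨_, ⟨V, rfl⟩, hV⟩ :=
      Metric.mem_closure_iff.1 (CuntzLE.iff_mem_closure.1 (h i)) (δ / 16) (by positivity)
    exact ⟨V, by rwa [dist_eq_norm] at hV⟩
  choose V hV using h_conj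
  obtain ⟨x, hx⟩ := hA.exists_sum_conj_approx_stabilization hk hδ ha hb hV
  exact ⟨x, (hx.trans hδ_le).trans_lt (half_lt_self hε)⟩

theorem le_sum_of_nsmul_le_nsmul (hA : HasDecomposableApproximations A n) {x : Cu A}
    {y : Fin (n + 1) → Cu A} (hk : ∀ i, 0 < k i) (h : ∀ i, k i • x ≤ k i • y i) :
    x ≤ ∑ i, y i := by
  induction x using CuntzSemigroup.ind with | _ a
  have h_rep (i) : ∃ c, CuntzSemigroup.mk c = y i := by
    induction y i using CuntzSemigroup.ind with | _ c
    exact ⟨c, rfl⟩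
  choose b hb using h_rep
  have h_size (i) : (b i).size ≤ a.size + ∑ i, (b i).size :=
    le_add_left (Finset.single_le_sum_of_canonicallyOrdered (f := fun i => (b i).size)
      (Finset.mem_univ i))
  obtain ⟨a', ha', ha_mk⟩ := CuntzSemigroup.exists_mk_eq_of_size_le a
    (Nat.le_add_right _ (∑ i, (b i).size))
  choose b' hb' hb_mk using fun i => CuntzSemigroup.exists_mk_eq_of_size_le (b i) (h_size i)
  simp only [← hb, ← ha_mk, ← hb_mk] at h ⊢
  exact hA.mk_le_sum_mk hk ha' hb' fun i => CuntzSemigroup.cuntzLE_diagCopies_of_nsmul_le (h i)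

end HasDecomposableApproximations

end Comparison

end

theorem theorem1p3 {A : Type*} [NonUnitalCStarAlgebra A] [PartialOrder A] [StarOrderedRing A]
    (n : ℕ) (hA : HasNuclearDimension A n) :
    HasNComparison (Cu A) n ∧
      ∀ (x : Cu A) (y : Fin (n + 1) → Cu A) (k : Fin (n + 1) → ℕ),
        (∀ i, 0 < k i) → (∀ i, k i • x ≤ k i • y i) → x ≤ ∑ i, y i := by
  refine ⟨fun x y h => ?_, fun x y k => hA.1.le_sum_of_nsmul_le_nsmul⟩
  choose k hk h using h
  refine hA.1.le_sum_of_nsmul_le_nsmul hk fun i => le_trans ?_ (h i)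
  rw [succ_nsmul]
  exact le_add_of_nonneg_right (CuntzSemigroup.zero_le x)
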